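/- Let $b\ge 2$ and $q\ge 2$ be integers and $\beta\ge 0$. Let $\mathbb T^b$ be the infinite rooted tree in which every vertex has $b$ children, let $T=T_m$ be its complete subtree of depth $m\ge 0$ (all vertices at distance at most $m$ from the root), and let $\partial T$ be the set of the $b^{m+1}$ children of the leaves of $T$. A boundary condition $\tau$ assigns to each site of $\partial T$ either a fixed spin in $\{1,\dots,q\}$ or no constraint (an unconstrained site is deleted). The ferromagnetic $q$-state Potts model on $T$ with boundary condition $\tau$ is the distribution $$\mu(\sigma)=\mu_T^\tau(\sigma)\ \propto\ \exp\Bigl(2\beta\,\#\{\text{edges } xy \text{ of } T\cup\partial T \text{ with } \sigma_x=\sigma_y\}\Bigr),\qquad \sigma\in\{1,\dots,q\}^T,$$ where $\sigma$ is extended to the fixed sites of $\partial T$ by $\tau$; for $q=2$ this is the Ising model at inverse temperature $\beta$. For $f:\{1,\dots,q\}^T\to\mathbb R$ let $\mathrm{Var}(f)=\mu(f^2)-\mu(f)^2$, for $f\ge0$ let $\mathrm{Ent}(f)=\mu(f\log f)-\mu(f)\log\mu(f)$, and let $\mathcal D(f)=\sum_{x\in T}\mu\bigl(\mathrm{Var}_{\{x\}}(f)\bigr)$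 be the Dirichlet form of the heat-bath Glauber dynamics, where $\mathrm{Var}_{\{x\}}(f)$ is the variance of $f$ under $\mu$ conditioned on the spins at all sites other than $x$. The spectral gap and the log-Sobolev constant are $$c_{\rm gap}(\mu)=\inf_f\frac{\mathcal D(f)}{\mathrm{Var}(f)},\qquad c_{\rm sob}(\mu)=\inf_{f\ge0}\frac{\mathcal D(\sqrt f)}{\mathrm{Ent}(f)},$$ the infima being over non-constant $f$. Let $\beta_0=\beta_0(b,q)$ be the critical inverse temperature for uniqueness, i.e. the infimum of the $\beta\ge0$ for which the model on $\mathbb T^b$ has more than one infinite-volume Gibbs measure. Then in each of the following situations there is a constant $c>0$, independent of the depth $m$ and of the boundary condition $\tau$ within the stated class, such that $c_{\rm gap}(\mu_T^\tau)\ge c$ and $c_{\rm sob}(\mu_T^\tau)\ge c$ for every $T=T_m$: (i) $\tau$ is arbitrary and $\beta<\max\bigl\{\beta_0,\ \tfrac12\ln\frac{\sqrt b+1}{\sqrt b-1}\bigr\}$; (ii) $\tau$ is constant (all sites of $\partial T$ have the same fixed spin) and $\beta\ge0$ is arbitrary; (iii) $\tau$ is free (all sites of $\partial T$ are unconstrained)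 and $\beta<\beta_1$, where $\beta_1$ is the unique positive solution (which exists) of $$\frac{e^{2\beta_1}-1}{e^{2\beta_1}+q-1}\cdot\frac{e^{2\beta_1}-1}{e^{2\beta_1}+1}=\frac1b .$$ -/

import Mathlib

namespace PottsTree

noncomputable section

/-! ### Heat-bath Glauber dynamics for a distribution on a finite product space -/

section Dynamics

variable {ι S : Type} [Fintype ι] [DecidableEq ι] [Fintype S]

/-- The expectation `μ(f)`, where `μ` is given by its probability weights. -/
def mean (μ : (ι → S) → ℝ) (f : (ι → S) → ℝ) : ℝ := ∑ σ, μ σ * f σ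

/-- `Var(f) = μ(f²) - μ(f)²`. -/
def variance (μ : (ι → S) → ℝ) (f : (ι → S) → ℝ) : ℝ :=
  mean μ (fun σ => f σ ^ 2) - mean μ f ^ 2

/-- `Ent(f) = μ(f log f) - μ(f) log μ(f)`, with `0 log 0 = 0`. -/
def entropy (μ : (ι → S) → ℝ) (f : (ι → S) → ℝ) : ℝ :=
  mean μ (fun σ => f σ * Real.log (f σ)) - mean μ f * Real.log (mean μ f)

/-- The heat-bath rate: the conditional probability under `μ` that the spin at `x` is `s`, given
that the spins at the other sites are those of `σ`. -/
def siteProb (μ : (ι → S) → ℝ) (x : ι) (σ : ι → S) (s : S) : ℝ :=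
  μ (Function.update σ x s) / ∑ s' : S, μ (Function.update σ x s')

/-- The conditional expectation `μ_{x}(f)`, as a function of the configuration. -/
def siteMean (μ : (ι → S) → ℝ) (x : ι) (f : (ι → S) → ℝ) (σ : ι → S) : ℝ :=
  ∑ s : S, siteProb μ x σ s * f (Function.update σ x s)

/-- The conditional variance `Var_{x}(f)`, as a function of the configuration. -/
def siteVariance (μ : (ι → S) → ℝ) (x : ι) (f : (ι → S) → ℝ) (σ : ι → S) : ℝ :=
  siteMean μ x (fun σ' => f σ' ^ 2) σ - siteMean μ x f σ ^ 2

/-- The Dirichlet form `𝓓(f) = ∑ₓ μ(Var_{x}(f))` of the heat-bath dynamics. -/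
def dirichletForm (μ : (ι → S) → ℝ) (f : (ι → S) → ℝ) : ℝ :=
  ∑ x : ι, mean μ (siteVariance μ x f)

/-- `f` is not a constant function. -/
def NonConstant (f : (ι → S) → ℝ) : Prop := ∃ σ σ', f σ ≠ f σ'

/-- The spectral gap: the infimum of `𝓓(f) / Var(f)` over non-constant `f`. -/
def cGap (μ : (ι → S) → ℝ) : ℝ :=
  ⨅ f : {f : (ι → S) → ℝ // NonConstant f}, dirichletForm μ f.1 / variance μ f.1

/-- The logarithmic Sobolev constant: the infimum of `𝓓(√f) / Ent(f)` over non-constant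
`f ≥ 0`. -/
def cSob (μ : (ι → S) → ℝ) : ℝ :=
  ⨅ f : {f : (ι → S) → ℝ // (∀ σ, 0 ≤ f σ) ∧ NonConstant f},
    dirichletForm μ (fun σ => √(f.1 σ)) / entropy μ f.1

end Dynamics

/-! ### The `b`-ary tree -/

/-- Vertices of the infinite rooted `b`-ary tree: the root is `[]`, and the children of `v` are
`i :: v` for `i : Fin b`; so the parent of a vertex `w ≠ []` is `w.tail`. -/
abbrev Vertex (b : ℕ) : Type := List (Fin b)

/-- The complete `b`-ary tree of depth `m`, as a set of vertices of the infinite tree. -/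
def completeTree (b m : ℕ) : Finset (Vertex b) := (List.finite_length_le (Fin b) m).toFinset

theorem mem_completeTree {b m : ℕ} {v : Vertex b} : v ∈ completeTree b m ↔ v.length ≤ m := by
  simp [completeTree]

/-- The edges of the infinite tree that have an endpoint in `Λ`. The edge between `w ≠ []` and its
parent is represented by its lower endpoint `w`. -/
def edgesMeeting {b : ℕ} (Λ : Finset (Vertex b)) : Finset (Vertex b) :=
  (Λ ∪ Λ.biUnion fun v => Finset.univ.image fun i : Fin b => i :: v).filter fun w => w ≠ []

theorem mem_edgesMeeting {b : ℕ} {Λ : Finset (Vertex b)} {w : Vertex b} :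
    w ∈ edgesMeeting Λ ↔ w ≠ [] ∧ (w ∈ Λ ∨ w.tail ∈ Λ) := by
  cases w with
  | nil => simp [edgesMeeting]
  | cons i v => simp [edgesMeeting]

/-! ### The ferromagnetic Potts model -/

/-- A boundary condition: `τ v = some s` fixes the spin at the site `v` to be `s`, and `τ v = none`
leaves `v` unconstrained (the site `v` is then absent). Only its values at the neighbours of the
region outside the region matter. -/
abbrev BoundaryCondition (b q : ℕ) : Type := Vertex b → Option (Fin q)

/-- The configuration that is `σ` in `Λ` and is given by the boundary condition `τ` outside. -/
def extend {b q : ℕ} (Λ : Finset (Vertex b)) (τ : BoundaryCondition b q) (σ : Λ → Fin q) :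
    BoundaryCondition b q :=
  fun v => if h : v ∈ Λ then some (σ ⟨v, h⟩) else τ v

/-- The number of edges meeting `Λ` both of whose endpoints carry a spin and carry the same one. -/
def agreeingEdges {b q : ℕ} (Λ : Finset (Vertex b)) (τ : BoundaryCondition b q)
    (σ : Λ → Fin q) : ℕ :=
  ((edgesMeeting Λ).filter fun w =>
    extend Λ τ σ w = extend Λ τ σ w.tail ∧ extend Λ τ σ w ≠ none).card

/-- The Boltzmann weight. Each edge with equal spins contributes a factor `exp (2β)`, so that for
`q = 2` this is the Ising model at inverse temperature `β`. -/
def weight {b q : ℕ} (β : ℝ) (Λ : Finset (Vertex b)) (τ : BoundaryCondition b q)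
    (σ : Λ → Fin q) : ℝ :=
  Real.exp (2 * β * agreeingEdges Λ τ σ)

/-- The Gibbs distribution of the `q`-state Potts model in the finite region `Λ` with boundary
condition `τ`. -/
def gibbs {b q : ℕ} (β : ℝ) (Λ : Finset (Vertex b)) (τ : BoundaryCondition b q)
    (σ : Λ → Fin q) : ℝ :=
  weight β Λ τ σ / ∑ σ' : Λ → Fin q, weight β Λ τ σ'

/-- The Gibbs distribution on the complete `b`-ary tree of depth `m` with boundary condition `τ`
on the `b ^ (m + 1)` children of its leaves. -/
def treeGibbs {b q : ℕ} (β : ℝ) (τ : BoundaryCondition b q) (m : ℕ) :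
    (completeTree b m → Fin q) → ℝ :=
  gibbs β (completeTree b m) τ

/-! ### Infinite-volume Gibbs measures and the critical point for uniqueness -/

/-- The configuration on the infinite tree that is `ξ` in `Λ` and `η` outside. -/
def glue {b q : ℕ} (Λ : Finset (Vertex b)) (ξ : Λ → Fin q) (η : Vertex b → Fin q) :
    Vertex b → Fin q :=
  fun v => if h : v ∈ Λ then ξ ⟨v, h⟩ else η v

/-- Infinite-volume Gibbs measures of the `q`-state Potts model on the infinite `b`-ary tree: the
probability measures that satisfy the Dobrushin–Lanford–Ruelle equations for every finite
region `Λ`. -/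
def IsGibbsMeasure {b q : ℕ} (β : ℝ) (P : MeasureTheory.Measure (Vertex b → Fin q)) : Prop :=
  MeasureTheory.IsProbabilityMeasure P ∧
    ∀ (Λ : Finset (Vertex b)) (B : Set (Vertex b → Fin q)), MeasurableSet B →
      P B = ∫⁻ η, ∑ ξ : Λ → Fin q,
        ENNReal.ofReal (gibbs β Λ (fun v => some (η v)) ξ) *
          B.indicator (fun _ => 1) (glue Λ ξ η) ∂P

/-- There is more than one infinite-volume Gibbs measure. -/
def MultiplePhases (b q : ℕ) (β : ℝ) : Prop :=
  ∃ P P' : MeasureTheory.Measure (Vertex b → Fin q),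
    IsGibbsMeasure β P ∧ IsGibbsMeasure β P' ∧ P ≠ P'

/-- The critical inverse temperature `β₀` for uniqueness of the infinite-volume Gibbs measure. -/
def betaZero (b q : ℕ) : ℝ := sInf {β : ℝ | 0 ≤ β ∧ MultiplePhases b q β}

/-- The equation that determines `β₁`. -/
def BetaOneEquation (b q : ℕ) (β₁ : ℝ) : Prop :=
  (Real.exp (2 * β₁) - 1) / (Real.exp (2 * β₁) + q - 1) *
    ((Real.exp (2 * β₁) - 1) / (Real.exp (2 * β₁) + 1)) = 1 / b

end

end PottsTree

namespace PottsTree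

noncomputable section

/-! ### Entropy inequalities for finitely supported probability weights -/

section FiniteEntropy

/-! Put `θ = exp (2β)`. The influence of a spin travels along an edge at one of two rates. Towards
the root, the law of a parent given the spin of one child is a Potts kernel with an unknown field,
and it contracts oscillations by `γ = (θ - 1)/(θ + 1)` for every field (`contracts_kernel`). Away
from the root, the law of a child given its parent depends on the boundary condition through `msg`,
and contracts by some `κ`. If `b κ γ < 1` at all sites of height at least a fixed `K`, the bounds
are uniform in the depth (`exists_le_of_contracts`): each of the about `b ^ n` sites at distance `n`
sees the root through `κ ^ n` and acts on it through `γ ^ n`.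

The entropy form of this is `entropy_mixing`. Given the level just below the top block of the
subtree at `x`, the spin at `x` is `s` with a probability `p` of mean `π`. The covariance of a
positive function `F` with the indicator of that spin splits into a part inside the block, handled
by Pinsker, and the covariance of `F` with `p - π`. The latter is small by the variational formula
for entropy once the exponential moments of `p - π` are. Under the density `exp (c (p - π))` the
drift of `p - π` is computed by comparing the average of the density given the spin `s` at `x` with
its full average. One spin of the level changes the density by a factor `1 + O(|c| γ ^ n)`, and each
generation passed on the way up multiplies this excess by about `b κ` (`ratioBound_cE`), so the
drift is of order `|c| (b κ γ) ^ n`.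

The total entropy is at most the sum over sites of `rootEnt` (`cEnt_le_sum_rootEnt`). Mixing bounds
each summand by the entropy in a bounded block plus a small multiple of the summands on the next `n
+ 2` levels. Summed over all sites, this error is absorbed in the left-hand side, and bounded blocks
satisfy a crude logarithmic Sobolev inequality. The logarithmic Sobolev inequality gives the
spectral gap with the same constant.

It remains to find `κ`. The universal choice `κ = γ` gives the square-root threshold, and a free
boundary gives `κ = (θ - 1)/(θ + q - 1)`, hence `β₁`. For a constant boundary the likelihood ratios
decrease to a fixed point `R` of their recursion, and `κ` tends to the logarithmic derivative of one
edge map at `R`. Approach from above forces `b κ ≤ 1` in the limit, and `γ < 1` supplies the strict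
inequality. Below `β₀` there is no fixed point above `1`, since it would produce distinct Gibbs
measures. As the constant boundary is extremal, all messages then become flat, and the same bound
holds for every boundary condition. -/

theorem add_sub_le_mul_log {x y : ℝ} (hx : 0 < x) (hy : 0 < y) :
    x * Real.log y + x - y ≤ x * Real.log x := by
  have h := Real.log_le_sub_one_of_pos (div_pos hy hx)
  rw [Real.log_div hy.ne' hx.ne'] at h
  have h2 := mul_le_mul_of_nonneg_left h hx.le
  have h3 : x * (y / x - 1) = y - x := by field_simp
  nlinarith

/-- This is `log t ≤ t - 1` at `t = √m / √x`; taking the square root first is what produces a square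
on the left. -/
theorem sq_sqrt_sub_le {x m : ℝ} (hx : 0 < x) (hm : 0 < m) :
    (√x - √m) ^ 2 ≤ x * Real.log x - x * Real.log m - x + m := by
  have hsx := Real.sqrt_pos.2 hx
  have hsm := Real.sqrt_pos.2 hm
  have h := Real.log_le_sub_one_of_pos (div_pos hsm hsx)
  rw [Real.log_div hsm.ne' hsx.ne', Real.log_sqrt hm.le, Real.log_sqrt hx.le] at h
  have h2 := mul_le_mul_of_nonneg_left h hx.le
  have h3 : x * (√m / √x - 1) = √m * √x - x := by
    nth_rw 1 [← Real.mul_self_sqrt hx.le]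
    have : √x * √x * (√m / √x - 1) = √m * √x - √x * √x := by field_simp
    rw [this, Real.mul_self_sqrt hx.le]
  have h4 := Real.mul_self_sqrt hx.le
  have h5 := Real.mul_self_sqrt hm.le
  nlinarith

variable {Ω : Type} [Fintype Ω]

/-- The entropy of `F` under the weights `p`. -/
def finEnt (p F : Ω → ℝ) : ℝ :=
  ∑ ω, p ω * (F ω * Real.log (F ω)) - (∑ ω, p ω * F ω) * Real.log (∑ ω, p ω * F ω)

variable {p F : Ω → ℝ}

theorem finMean_pos (hp : ∀ ω, 0 ≤ p ω) (h1 : ∑ ω, p ω = 1) (hF : ∀ ω, 0 < F ω) :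
    0 < ∑ ω, p ω * F ω := by
  have hne : ∃ ω ∈ Finset.univ, p ω ≠ 0 := by
    by_contra! h
    rw [Finset.sum_eq_zero h] at h1
    exact zero_ne_one h1
  obtain ⟨ω, -, hω⟩ := hne
  exact Finset.sum_pos' (fun ω _ => mul_nonneg (hp ω) (hF ω).le)
    ⟨ω, Finset.mem_univ _, mul_pos (lt_of_le_of_ne (hp ω) hω.symm) (hF ω)⟩

theorem finEnt_eq (h1 : ∑ ω, p ω = 1) (m : ℝ) (hm : m = ∑ ω, p ω * F ω) :
    finEnt p F = ∑ ω, p ω * (F ω * Real.log (F ω) - F ω * Real.log m - F ω + m) := by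
  have : ∀ ω, p ω * (F ω * Real.log (F ω) - F ω * Real.log m - F ω + m) =
      p ω * (F ω * Real.log (F ω)) - p ω * F ω * Real.log m - p ω * F ω + p ω * m :=
    fun ω => by ring
  simp_rw [this, Finset.sum_add_distrib, Finset.sum_sub_distrib, ← Finset.sum_mul, h1, ← hm]
  rw [finEnt, ← hm]
  ring

theorem sq_sqrt_le_finEnt (hp : ∀ ω, 0 ≤ p ω) (h1 : ∑ ω, p ω = 1) (hF : ∀ ω, 0 < F ω) :
    ∑ ω, p ω * (√(F ω) - √(∑ ω, p ω * F ω)) ^ 2 ≤ finEnt p F := by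
  rw [finEnt_eq h1 _ rfl]
  exact Finset.sum_le_sum fun ω _ => mul_le_mul_of_nonneg_left
    (sq_sqrt_sub_le (hF ω) (finMean_pos hp h1 hF)) (hp ω)

theorem finEnt_nonneg (hp : ∀ ω, 0 ≤ p ω) (h1 : ∑ ω, p ω = 1) (hF : ∀ ω, 0 < F ω) :
    0 ≤ finEnt p F :=
  (Finset.sum_nonneg fun ω _ => mul_nonneg (hp ω) (sq_nonneg _)).trans
    (sq_sqrt_le_finEnt hp h1 hF)

/-- A Pinsker inequality. -/
theorem sq_sum_abs_le_finEnt (hp : ∀ ω, 0 ≤ p ω) (h1 : ∑ ω, p ω = 1) (hF : ∀ ω, 0 < F ω)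
    (m : ℝ) (hm : m = ∑ ω, p ω * F ω) :
    (∑ ω, p ω * |F ω - m|) ^ 2 ≤ 4 * m * finEnt p F := by
  have hm0 : 0 < m := hm ▸ finMean_pos hp h1 hF
  -- Factor `|F - m| = |√F - √m| (√F + √m)`: the first factor is controlled by the entropy, the
  -- second has second moment at most `4m`.
  have hcs := Finset.sum_mul_sq_le_sq_mul_sq Finset.univ
    (fun ω => √(p ω) * |√(F ω) - √m|) (fun ω => √(p ω) * (√(F ω) + √m))
  have e1 : ∀ ω, √(p ω) * |√(F ω) - √m| * (√(p ω) * (√(F ω) + √m)) = p ω * |F ω - m| := by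
    intro ω
    have hs : 0 ≤ √(F ω) + √m := by positivity
    have : |F ω - m| = |√(F ω) - √m| * (√(F ω) + √m) := by
      have e : F ω - m = (√(F ω) - √m) * (√(F ω) + √m) := by
        nlinarith [Real.mul_self_sqrt (hF ω).le, Real.mul_self_sqrt hm0.le]
      rw [e, abs_mul, abs_of_nonneg hs]
    rw [this]
    nth_rw 3 [← Real.mul_self_sqrt (hp ω)]
    ring
  have e2 : ∀ ω, (√(p ω) * |√(F ω) - √m|) ^ 2 = p ω * (√(F ω) - √m) ^ 2 := by
    intro ω
    rw [mul_pow, Real.sq_sqrt (hp ω), sq_abs]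
  have e3 : ∑ ω, (√(p ω) * (√(F ω) + √m)) ^ 2 ≤ 4 * m := by
    have : ∀ ω, (√(p ω) * (√(F ω) + √m)) ^ 2 ≤ 2 * (p ω * F ω) + 2 * (p ω * m) := by
      intro ω
      rw [mul_pow, Real.sq_sqrt (hp ω)]
      have := Real.sq_sqrt (hF ω).le
      have := Real.sq_sqrt hm0.le
      nlinarith [hp ω, mul_nonneg (hp ω) (sq_nonneg (√(F ω) - √m))]
    refine (Finset.sum_le_sum fun ω _ => this ω).trans ?_
    rw [Finset.sum_add_distrib, ← Finset.mul_sum, ← Finset.mul_sum, ← Finset.sum_mul, h1, ← hm]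
    linarith
  simp_rw [e1, e2] at hcs
  refine hcs.trans ?_
  have h2 := sq_sqrt_le_finEnt hp h1 hF
  rw [← hm] at h2
  calc _ ≤ finEnt p F * (4 * m) := mul_le_mul h2 e3
        (Finset.sum_nonneg fun ω _ => sq_nonneg _) (finEnt_nonneg hp h1 hF)
    _ = _ := by ring

/-- The converse of Pinsker: `log t ≤ t - 1` at `t = F / m` bounds the entropy by a chi-square
distance. -/
theorem mul_finEnt_le (hp : ∀ ω, 0 ≤ p ω) (h1 : ∑ ω, p ω = 1) (hF : ∀ ω, 0 < F ω)
    (m : ℝ) (hm : m = ∑ ω, p ω * F ω) :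
    m * finEnt p F ≤ ∑ ω, p ω * (F ω - m) ^ 2 := by
  have hm0 : 0 < m := hm ▸ finMean_pos hp h1 hF
  rw [finEnt_eq h1 m hm, Finset.mul_sum]
  refine Finset.sum_le_sum fun ω _ => ?_
  have h := Real.log_le_sub_one_of_pos (div_pos (hF ω) hm0)
  rw [Real.log_div (hF ω).ne' hm0.ne'] at h
  have h2 := mul_le_mul_of_nonneg_left h (mul_pos (hF ω) hm0).le
  have h3 : F ω * m * (F ω / m - 1) = F ω * (F ω - m) := by field_simp
  have h4 : m * (F ω * Real.log (F ω) - F ω * Real.log m - F ω + m) ≤ (F ω - m) ^ 2 := by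
    nlinarith
  nlinarith [mul_le_mul_of_nonneg_left h4 (hp ω)]

/-- The variational bound for the entropy. -/
theorem finMean_mul_le_finEnt (hp : ∀ ω, 0 ≤ p ω) (h1 : ∑ ω, p ω = 1) (hF : ∀ ω, 0 < F ω)
    (h : Ω → ℝ) :
    ∑ ω, p ω * (F ω * h ω) ≤
      finEnt p F + (∑ ω, p ω * F ω) * Real.log (∑ ω, p ω * Real.exp (h ω)) := by
  set m := ∑ ω, p ω * F ω with hm
  have hm0 : 0 < m := finMean_pos hp h1 hF
  set Z := ∑ ω, p ω * Real.exp (h ω) with hZ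
  have hZ0 : 0 < Z := finMean_pos hp h1 fun ω => Real.exp_pos _
  have key : ∀ ω, p ω * (F ω * (Real.log m + h ω - Real.log Z) + F ω - m * Real.exp (h ω) / Z) ≤
      p ω * (F ω * Real.log (F ω)) := by
    intro ω
    refine mul_le_mul_of_nonneg_left ?_ (hp ω)
    have := add_sub_le_mul_log (hF ω) (div_pos (mul_pos hm0 (Real.exp_pos (h ω))) hZ0)
    rwa [Real.log_div (mul_pos hm0 (Real.exp_pos (h ω))).ne' hZ0.ne',
      Real.log_mul hm0.ne' (Real.exp_pos _).ne', Real.log_exp] at this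
  have hsum := Finset.sum_le_sum fun ω (_ : ω ∈ Finset.univ) => key ω
  have e : ∀ ω, p ω * (F ω * (Real.log m + h ω - Real.log Z) + F ω - m * Real.exp (h ω) / Z) =
      p ω * F ω * (Real.log m - Real.log Z + 1) + p ω * (F ω * h ω)
        - p ω * Real.exp (h ω) * (m / Z) := fun ω => by ring
  simp_rw [e, Finset.sum_sub_distrib, Finset.sum_add_distrib, ← Finset.sum_mul] at hsum
  rw [← hm, ← hZ] at hsum
  have : Z * (m / Z) = m := by field_simp
  rw [finEnt, ← hm]
  nlinarith

theorem finVar_eq (h1 : ∑ ω, p ω = 1) (g : Ω → ℝ) :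
    ∑ ω, p ω * g ω ^ 2 - (∑ ω, p ω * g ω) ^ 2 =
      ∑ ω, p ω * (g ω - ∑ ω, p ω * g ω) ^ 2 := by
  set m := ∑ ω, p ω * g ω with hm
  have : ∀ ω, p ω * (g ω - m) ^ 2 = p ω * g ω ^ 2 - p ω * g ω * (2 * m) + p ω * m ^ 2 :=
    fun ω => by ring
  simp_rw [this, Finset.sum_add_distrib, Finset.sum_sub_distrib, ← Finset.sum_mul, h1, ← hm]
  ring

theorem finVar_le_sq_sub (h1 : ∑ ω, p ω = 1) (g : Ω → ℝ) (c : ℝ) :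
    ∑ ω, p ω * g ω ^ 2 - (∑ ω, p ω * g ω) ^ 2 ≤ ∑ ω, p ω * (g ω - c) ^ 2 := by
  set m := ∑ ω, p ω * g ω with hm
  have : ∀ ω, p ω * (g ω - c) ^ 2 = p ω * g ω ^ 2 - p ω * g ω * (2 * c) + p ω * c ^ 2 :=
    fun ω => by ring
  simp_rw [this, Finset.sum_add_distrib, Finset.sum_sub_distrib, ← Finset.sum_mul, h1, ← hm]
  nlinarith [sq_nonneg (m - c)]

/-- The variance is at most the second moment about any constant; the constant `√(∑ p g²)` is the
one appearing in `sq_sqrt_le_finEnt`. -/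
theorem finVar_le_finEnt_sq (hp : ∀ ω, 0 ≤ p ω) (h1 : ∑ ω, p ω = 1) {g : Ω → ℝ}
    (hg : ∀ ω, 0 < g ω) :
    ∑ ω, p ω * g ω ^ 2 - (∑ ω, p ω * g ω) ^ 2 ≤ finEnt p fun ω => g ω ^ 2 := by
  have h := sq_sqrt_le_finEnt hp h1 (F := fun ω => g ω ^ 2) fun ω => by have := hg ω; positivity
  simp only [Real.sqrt_sq (hg _).le] at h
  exact (finVar_le_sq_sub h1 g _).trans h

/-- A crude logarithmic Sobolev inequality. -/
theorem finEnt_sq_le (hp : ∀ ω, 0 ≤ p ω) (h1 : ∑ ω, p ω = 1) {C : ℝ} {g : Ω → ℝ}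
    (hg : ∀ ω, 0 < g ω) (hC : ∀ ω, g ω ^ 2 ≤ C * ∑ ω, p ω * g ω ^ 2) (c : ℝ)
    (hgc : ∀ ω ω', (g ω - g ω') ^ 2 ≤ c) :
    finEnt p (fun ω => g ω ^ 2) ≤ 4 * C * c := by
  have hF : ∀ ω, 0 < g ω ^ 2 := fun ω => by have := hg ω; positivity
  set m := ∑ ω, p ω * g ω ^ 2 with hm
  have hm0 : 0 < m := finMean_pos hp h1 hF
  have hne : Nonempty Ω := by
    by_contra h
    rw [not_nonempty_iff] at h
    simp at h1
  obtain ⟨ω₀⟩ := hne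
  have h2 := mul_finEnt_le hp h1 hF m hm
  have h3 := finVar_le_sq_sub h1 (fun ω => g ω ^ 2) (g ω₀ ^ 2)
  rw [finVar_eq h1, ← hm] at h3
  have hCm : 0 ≤ C * m := (hF ω₀).le.trans (hC ω₀)
  have h4 : ∑ ω, p ω * (g ω ^ 2 - g ω₀ ^ 2) ^ 2 ≤ ∑ ω, p ω * (4 * (C * m) * c) := by
    refine Finset.sum_le_sum fun ω _ => mul_le_mul_of_nonneg_left ?_ (hp ω)
    have e : (g ω ^ 2 - g ω₀ ^ 2) ^ 2 = (g ω + g ω₀) ^ 2 * (g ω - g ω₀) ^ 2 := by ring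
    rw [e]
    refine mul_le_mul ?_ (hgc ω ω₀) (sq_nonneg _) (by positivity)
    nlinarith [hC ω, hC ω₀, sq_nonneg (g ω - g ω₀)]
  rw [← Finset.sum_mul, h1, one_mul] at h4
  have h5 : m * finEnt p (fun ω => g ω ^ 2) ≤ m * (4 * C * c) :=
    (h2.trans (h3.trans h4)).trans (le_of_eq (by ring))
  exact le_of_mul_le_mul_left h5 hm0

end FiniteEntropy

end

end PottsTree

namespace PottsTree

noncomputable section

/-! ### Conditional expectations on finite product spaces -/

set_option linter.unusedSectionVars false

section Conditional

variable {ι S : Type} [Fintype ι] [DecidableEq ι] [Fintype S]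

/-- `f` does not depend on the coordinates in `A`. -/
def FreeOf (f : (ι → S) → ℝ) (A : Finset ι) : Prop :=
  ∀ σ τ : ι → S, (∀ i, i ∉ A → σ i = τ i) → f σ = f τ

/-- The average of `f` over uniformly distributed spins in `A`. -/
def avg (A : Finset ι) (f : (ι → S) → ℝ) (σ : ι → S) : ℝ :=
  (∑ τ : ι → S, f (A.piecewise τ σ)) / Fintype.card (ι → S)

/-- The conditional expectation of `f` given the spins outside `A`. -/
def cE (μ : (ι → S) → ℝ) (A : Finset ι) (f : (ι → S) → ℝ) (σ : ι → S) : ℝ :=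
  avg A (fun τ => μ τ * f τ) σ / avg A μ σ

/-- The conditional entropy of `f` given the spins outside `A`. -/
def cEnt (μ : (ι → S) → ℝ) (A : Finset ι) (f : (ι → S) → ℝ) (σ : ι → S) : ℝ :=
  cE μ A (fun τ => f τ * Real.log (f τ)) σ - cE μ A f σ * Real.log (cE μ A f σ)

variable {f g h μ : (ι → S) → ℝ} {A B : Finset ι}

theorem FreeOf.mono (hf : FreeOf f A) (hBA : B ⊆ A) : FreeOf f B :=
  fun σ τ hστ => hf σ τ fun i hi => hστ i fun hB => hi (hBA hB)

theorem freeOf_const (c : ℝ) : FreeOf (fun _ : ι → S => c) A := fun _ _ _ => rfl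

theorem FreeOf.comp (hf : FreeOf f A) (φ : ℝ → ℝ) : FreeOf (fun σ => φ (f σ)) A :=
  fun σ τ hστ => congrArg φ (hf σ τ hστ)

theorem FreeOf.mul (hf : FreeOf f A) (hg : FreeOf g A) : FreeOf (fun σ => f σ * g σ) A :=
  fun σ τ hστ => congrArg₂ _ (hf σ τ hστ) (hg σ τ hστ)

theorem FreeOf.sub (hf : FreeOf f A) (hg : FreeOf g A) : FreeOf (fun σ => f σ - g σ) A :=
  fun σ τ hστ => congrArg₂ _ (hf σ τ hστ) (hg σ τ hστ)

theorem FreeOf.div (hf : FreeOf f A) (hg : FreeOf g A) : FreeOf (fun σ => f σ / g σ) A :=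
  fun σ τ hστ => congrArg₂ _ (hf σ τ hστ) (hg σ τ hστ)

theorem FreeOf.prod {κ : Type} {s : Finset κ} {F : κ → (ι → S) → ℝ}
    (hF : ∀ k ∈ s, FreeOf (F k) A) : FreeOf (fun σ => ∏ k ∈ s, F k σ) A :=
  fun σ τ hστ => Finset.prod_congr rfl fun k hk => hF k hk σ τ hστ

theorem FreeOf.piecewise (hf : FreeOf f A) (τ σ : ι → S) : f (A.piecewise τ σ) = f σ :=
  hf _ _ fun i hi => by simp [hi]

theorem FreeOf.update (hf : FreeOf f A) {i : ι} (hi : i ∈ A) (σ : ι → S) (s : S) :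
    f (Function.update σ i s) = f σ :=
  hf _ _ fun j hj => by rw [Function.update_of_ne]; rintro rfl; exact hj hi

theorem FreeOf.union (hf : FreeOf f A) (hg : FreeOf f B) : FreeOf f (A ∪ B) := by
  intro σ τ hστ
  rw [← hf.piecewise τ σ]
  refine hg _ _ fun i hi => ?_
  by_cases hA : i ∈ A
  · simp [hA]
  · simp [hA, hστ i (by simp [hA, hi])]

theorem freeOf_empty : FreeOf f (∅ : Finset ι) := fun σ τ hστ =>
  congrArg f (funext fun i => hστ i (by simp))

theorem freeOf_of_update (hf : ∀ i ∈ A, ∀ σ s, f (Function.update σ i s) = f σ) : FreeOf f A := by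
  induction A using Finset.induction_on with
  | empty => exact freeOf_empty
  | insert a A _ ih =>
    rw [Finset.insert_eq]
    refine FreeOf.union (fun σ τ hστ => ?_) (ih fun i hi => hf i (Finset.mem_insert_of_mem hi))
    rw [← hf a (Finset.mem_insert_self a A) σ (τ a)]
    congr 1
    funext i
    by_cases hi : i = a
    · subst hi; simp
    · rw [Function.update_of_ne hi]; exact hστ i (by simpa using hi)

theorem avg_freeOf : FreeOf (avg A f) A := by
  intro σ τ hστ
  have : ∀ ξ : ι → S, A.piecewise ξ σ = A.piecewise ξ τ := fun ξ => by
    funext i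
    by_cases hi : i ∈ A
    · simp [hi]
    · simp [hi, hστ i hi]
  simp [avg, this]

theorem FreeOf.avg (hf : FreeOf f B) : FreeOf (avg A f) B := by
  intro σ τ hστ
  simp only [PottsTree.avg]
  congr 1
  refine Finset.sum_congr rfl fun ξ _ => hf _ _ fun i hi => ?_
  by_cases hA : i ∈ A
  · simp [hA]
  · simp [hA, hστ i hi]

theorem avg_mul_left (hg : FreeOf g A) (σ : ι → S) :
    avg A (fun τ => g τ * f τ) σ = g σ * avg A f σ := by
  simp only [avg, hg.piecewise, ← Finset.mul_sum, mul_div_assoc]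

theorem avg_avg (A B : Finset ι) (f : (ι → S) → ℝ) (σ : ι → S) :
    avg A (avg B f) σ = avg (A ∪ B) f σ := by
  simp only [avg]
  have hpt : ∀ τ τ' : ι → S, B.piecewise τ' (A.piecewise τ σ) =
      (A ∪ B).piecewise (B.piecewise τ' τ) σ := fun τ τ' => by
    funext i
    by_cases hB : i ∈ B <;> by_cases hA : i ∈ A <;> simp [hA, hB]
  simp_rw [hpt, ← Finset.sum_div]
  rcases isEmpty_or_nonempty (ι → S) with hE | hN
  · simp
  have hN0 : (Fintype.card (ι → S) : ℝ) ≠ 0 := by exact_mod_cast Fintype.card_ne_zero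
  -- Two independent configurations that exchange their spins in `B` remain independent and uniform,
  -- so the mixture of the two may be replaced by a single one.
  have hswap : Function.Involutive fun x : (ι → S) × (ι → S) =>
      (B.piecewise x.2 x.1, B.piecewise x.1 x.2) := fun x => by
    refine Prod.ext (funext fun i => ?_) (funext fun i => ?_) <;>
      by_cases hB : i ∈ B <;> simp [hB]
  have := Equiv.sum_comp hswap.toPerm fun x : (ι → S) × (ι → S) => f ((A ∪ B).piecewise x.1 σ)
  simp only [Function.Involutive.coe_toPerm, Fintype.sum_prod_type, Finset.sum_const,
    Finset.card_univ, nsmul_eq_mul] at this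
  rw [this, ← Finset.mul_sum]
  field_simp

theorem avg_eq_self [Nonempty S] (hf : FreeOf f A) (σ : ι → S) : avg A f σ = f σ := by
  have hN0 : (Fintype.card (ι → S) : ℝ) ≠ 0 := by exact_mod_cast Fintype.card_ne_zero
  simp only [avg, hf.piecewise, Finset.sum_const, Finset.card_univ, nsmul_eq_mul]
  field_simp

theorem avg_pos (hf : ∀ σ, 0 < f σ) (σ : ι → S) : 0 < avg A f σ := by
  have : Nonempty (ι → S) := ⟨σ⟩
  exact div_pos (Finset.sum_pos (fun _ _ => hf _) Finset.univ_nonempty)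
    (by exact_mod_cast Fintype.card_pos)

theorem avg_singleton [Nonempty S] (x : ι) (σ : ι → S) :
    avg {x} f σ = (∑ s, f (Function.update σ x s)) / Fintype.card S := by
  have hpt : ∀ τ : ι → S, ({x} : Finset ι).piecewise τ σ = Function.update σ x (τ x) := fun τ => by
    funext i
    by_cases hi : i = x
    · subst hi; simp
    · simp [hi]
  simp only [avg, hpt]
  have := Equiv.sum_comp (Equiv.funSplitAt x S) fun y => f (Function.update σ x y.1)
  simp only [Equiv.funSplitAt_apply, Fintype.sum_prod_type, Finset.sum_const, Finset.card_univ,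
    nsmul_eq_mul] at this
  rw [this, Fintype.card_congr (Equiv.funSplitAt x S), Fintype.card_prod]
  have h1 : (Fintype.card S : ℝ) ≠ 0 := by exact_mod_cast Fintype.card_ne_zero
  have h2 : (Fintype.card ({j // j ≠ x} → S) : ℝ) ≠ 0 := by exact_mod_cast Fintype.card_ne_zero
  rw [← Finset.mul_sum]
  push_cast
  rw [mul_comm (Fintype.card S : ℝ), mul_div_mul_left _ _ h2]

/-- The conditional weights given the spins of `σ` outside `A`. -/
def cw (μ : (ι → S) → ℝ) (A : Finset ι) (σ τ : ι → S) : ℝ :=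
  μ (A.piecewise τ σ) / ∑ τ, μ (A.piecewise τ σ)

theorem cE_eq_sum (σ : ι → S) : cE μ A f σ = ∑ τ, cw μ A σ τ * f (A.piecewise τ σ) := by
  have : Nonempty (ι → S) := ⟨σ⟩
  have hN0 : (Fintype.card (ι → S) : ℝ) ≠ 0 := by exact_mod_cast Fintype.card_ne_zero
  simp only [cE, avg, cw, div_mul_eq_mul_div, ← Finset.sum_div]
  rw [div_div_div_cancel_right₀ hN0]

theorem cw_pos (hμ : ∀ σ, 0 < μ σ) (σ τ : ι → S) : 0 < cw μ A σ τ :=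
  div_pos (hμ _) (Finset.sum_pos (fun _ _ => hμ _) ⟨σ, Finset.mem_univ _⟩)

theorem sum_cw (hμ : ∀ σ, 0 < μ σ) (σ : ι → S) : ∑ τ, cw μ A σ τ = 1 := by
  simp only [cw, ← Finset.sum_div]
  exact div_self (Finset.sum_pos (fun _ _ => hμ _) ⟨σ, Finset.mem_univ _⟩).ne'

theorem cEnt_eq_finEnt (σ : ι → S) :
    cEnt μ A f σ = finEnt (cw μ A σ) fun τ => f (A.piecewise τ σ) := by
  simp only [cEnt, finEnt, cE_eq_sum]

theorem cE_freeOf : FreeOf (cE μ A f) A := avg_freeOf.div avg_freeOf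

theorem cE_mul_left (hg : FreeOf g A) (σ : ι → S) :
    cE μ A (fun τ => g τ * f τ) σ = g σ * cE μ A f σ := by
  simp only [cE_eq_sum, hg.piecewise, Finset.mul_sum]
  exact Finset.sum_congr rfl fun _ _ => by ring

theorem cE_add (σ : ι → S) :
    cE μ A (fun τ => f τ + g τ) σ = cE μ A f σ + cE μ A g σ := by
  simp only [cE_eq_sum, mul_add, Finset.sum_add_distrib]

theorem cE_sub (σ : ι → S) :
    cE μ A (fun τ => f τ - g τ) σ = cE μ A f σ - cE μ A g σ := by
  simp only [cE_eq_sum, mul_sub, Finset.sum_sub_distrib]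

theorem cE_const_mul (c : ℝ) (σ : ι → S) :
    cE μ A (fun τ => c * f τ) σ = c * cE μ A f σ :=
  cE_mul_left (freeOf_const c) σ

theorem cE_sum {κ : Type} (s : Finset κ) (F : κ → (ι → S) → ℝ) (σ : ι → S) :
    cE μ A (fun τ => ∑ k ∈ s, F k τ) σ = ∑ k ∈ s, cE μ A (F k) σ := by
  simp only [cE_eq_sum, Finset.mul_sum]
  exact Finset.sum_comm

theorem cE_mono (hμ : ∀ σ, 0 < μ σ) (hfg : ∀ σ, f σ ≤ g σ) (σ : ι → S) :
    cE μ A f σ ≤ cE μ A g σ := by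
  simp only [cE_eq_sum]
  exact Finset.sum_le_sum fun τ _ => mul_le_mul_of_nonneg_left (hfg _) (cw_pos hμ σ τ).le

theorem cE_nonneg (hμ : ∀ σ, 0 < μ σ) (hf : ∀ σ, 0 ≤ f σ) (σ : ι → S) : 0 ≤ cE μ A f σ := by
  simp only [cE_eq_sum]
  exact Finset.sum_nonneg fun τ _ => mul_nonneg (cw_pos hμ σ τ).le (hf _)

theorem cE_pos (hμ : ∀ σ, 0 < μ σ) (hf : ∀ σ, 0 < f σ) (σ : ι → S) : 0 < cE μ A f σ := by
  simp only [cE_eq_sum]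
  exact finMean_pos (fun τ => (cw_pos hμ σ τ).le) (sum_cw hμ σ) fun _ => hf _

theorem cE_eq_self (hμ : ∀ σ, 0 < μ σ) (hf : FreeOf f A) (σ : ι → S) : cE μ A f σ = f σ := by
  simp only [cE_eq_sum, hf.piecewise, ← Finset.sum_mul, sum_cw hμ, one_mul]

theorem cE_const (hμ : ∀ σ, 0 < μ σ) (c : ℝ) (σ : ι → S) : cE μ A (fun _ => c) σ = c :=
  cE_eq_self hμ (freeOf_const c) σ

theorem cE_empty (hμ : ∀ σ, 0 < μ σ) : cE μ ∅ f = f := funext (cE_eq_self hμ freeOf_empty)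

theorem cE_mul_avg (hμ : ∀ σ, 0 < μ σ) (σ : ι → S) :
    cE μ A f σ * avg A μ σ = avg A (fun τ => μ τ * f τ) σ :=
  div_mul_cancel₀ _ (avg_pos hμ σ).ne'

theorem avg_mul_cE (hμ : ∀ σ, 0 < μ σ) (hBA : B ⊆ A) (σ : ι → S) :
    avg A (fun τ => μ τ * cE μ B f τ) σ = avg A (fun τ => μ τ * f τ) σ := by
  have hU : A ∪ B = A := Finset.union_eq_left.2 hBA
  rw [← hU, ← avg_avg, ← avg_avg]
  congr 1
  funext τ
  simp_rw [mul_comm (μ _) (cE μ B f _)]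
  rw [avg_mul_left cE_freeOf, cE_mul_avg hμ]

/-- The tower property. -/
theorem cE_cE (hμ : ∀ σ, 0 < μ σ) (hBA : B ⊆ A) (f : (ι → S) → ℝ) (σ : ι → S) :
    cE μ A (cE μ B f) σ = cE μ A f σ := by
  rw [cE, avg_mul_cE hμ hBA, cE]

theorem cE_univ [Nonempty S] (hμ1 : ∑ σ, μ σ = 1) (σ : ι → S) :
    cE μ Finset.univ f σ = mean μ f := by
  have hN0 : (Fintype.card (ι → S) : ℝ) ≠ 0 := by exact_mod_cast Fintype.card_ne_zero
  simp only [cE, avg, Finset.piecewise_univ, hμ1, mean]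
  rw [div_div_div_cancel_right₀ hN0, div_one]

theorem mean_cE [Nonempty S] (hμ : ∀ σ, 0 < μ σ) (hμ1 : ∑ σ, μ σ = 1) :
    mean μ (cE μ A f) = mean μ f := by
  obtain ⟨σ⟩ : Nonempty (ι → S) := inferInstance
  rw [← cE_univ hμ1 σ, cE_cE hμ (Finset.subset_univ _), cE_univ hμ1]

/-- Conditional Cauchy–Schwarz, in the form that aggregates squared bounds on a small region into
one on a larger region. -/
theorem cE_sq_le (hμ : ∀ σ, 0 < μ σ) (hf : ∀ σ, 0 ≤ f σ) (hg : ∀ σ, 0 ≤ g σ)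
    (hh : ∀ σ, h σ ^ 2 ≤ f σ * g σ) (σ : ι → S) :
    cE μ A h σ ^ 2 ≤ cE μ A f σ * cE μ A g σ := by
  simp only [cE_eq_sum]
  exact Finset.sum_sq_le_sum_mul_sum_of_sq_le_mul _
    (fun τ _ => mul_nonneg (cw_pos hμ σ τ).le (hf _))
    (fun τ _ => mul_nonneg (cw_pos hμ σ τ).le (hg _)) fun τ _ => by
      have := mul_le_mul_of_nonneg_left (hh (A.piecewise τ σ)) (sq_nonneg (cw μ A σ τ))
      nlinarith

/-! ### Conditional entropy -/

theorem cEnt_nonneg (hμ : ∀ σ, 0 < μ σ) (hf : ∀ σ, 0 < f σ) (σ : ι → S) : 0 ≤ cEnt μ A f σ := by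
  rw [cEnt_eq_finEnt]
  exact finEnt_nonneg (fun τ => (cw_pos hμ σ τ).le) (sum_cw hμ σ) fun _ => hf _

theorem cEnt_freeOf : FreeOf (cEnt μ A f) A :=
  cE_freeOf.sub (cE_freeOf.mul (cE_freeOf.comp Real.log))

theorem cEnt_eq_zero (hμ : ∀ σ, 0 < μ σ) (hf : FreeOf f A) (σ : ι → S) : cEnt μ A f σ = 0 := by
  rw [cEnt, cE_eq_self hμ hf, cE_eq_self hμ (hf.mul (hf.comp Real.log)), sub_self]

/-- The chain rule for the entropy. -/
theorem cEnt_chain (hμ : ∀ σ, 0 < μ σ) (hBA : B ⊆ A) (f : (ι → S) → ℝ) (σ : ι → S) :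
    cEnt μ A f σ = cE μ A (cEnt μ B f) σ + cEnt μ A (cE μ B f) σ := by
  have : cEnt μ B f = fun τ => cE μ B (fun τ => f τ * Real.log (f τ)) τ -
      cE μ B f τ * Real.log (cE μ B f τ) := rfl
  rw [this, cE_sub, cE_cE hμ hBA, cEnt, cEnt, cE_cE hμ hBA]
  ring

theorem cEnt_cE_le (hμ : ∀ σ, 0 < μ σ) (hBA : B ⊆ A) (hf : ∀ σ, 0 < f σ) (σ : ι → S) :
    cEnt μ A (cE μ B f) σ ≤ cEnt μ A f σ := by
  rw [cEnt_chain hμ hBA f]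
  linarith [cE_nonneg (A := A) hμ (cEnt_nonneg (A := B) hμ hf) σ]

theorem cE_mul_le_cEnt (hμ : ∀ σ, 0 < μ σ) (hf : ∀ σ, 0 < f σ) (h : (ι → S) → ℝ) (σ : ι → S) :
    cE μ A (fun τ => f τ * h τ) σ ≤
      cEnt μ A f σ + cE μ A f σ * Real.log (cE μ A (fun τ => Real.exp (h τ)) σ) := by
  rw [cEnt_eq_finEnt]
  simp only [cE_eq_sum]
  exact finMean_mul_le_finEnt (fun τ => (cw_pos hμ σ τ).le) (sum_cw hμ σ) (fun _ => hf _) _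

/-! ### Separated sets of sites -/

/-- `μ` is the product of a function that does not depend on the spins in `A` and one that does not
depend on the spins in `B`. -/
def Sep (μ : (ι → S) → ℝ) (A B : Finset ι) : Prop :=
  ∃ W₁ W₂ : (ι → S) → ℝ, (∀ σ, μ σ = W₁ σ * W₂ σ) ∧ FreeOf W₁ A ∧ FreeOf W₂ B

theorem Sep.symm (hS : Sep μ A B) : Sep μ B A := by
  obtain ⟨W₁, W₂, h, h1, h2⟩ := hS
  exact ⟨W₂, W₁, fun σ => by rw [h, mul_comm], h2, h1⟩

/-- The factor of `μ` that is free of `A` cancels between numerator and denominator, and nothing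
that remains depends on `B`. -/
theorem FreeOf.cE (hμ : ∀ σ, 0 < μ σ) (hS : Sep μ A B) (hf : FreeOf f B) :
    FreeOf (cE μ A f) B := by
  obtain ⟨W₁, W₂, h, h1, h2⟩ := hS
  have h0 : ∀ σ, W₁ σ ≠ 0 := fun σ h0 => (hμ σ).ne' (by rw [h, h0, zero_mul])
  have e : PottsTree.cE μ A f = fun σ =>
      PottsTree.avg A (fun τ => W₂ τ * f τ) σ / PottsTree.avg A W₂ σ := by
    funext σ
    simp only [PottsTree.cE]
    have e1 : μ = fun τ => W₁ τ * W₂ τ := funext h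
    have e2 : (fun τ => μ τ * f τ) = fun τ => W₁ τ * (W₂ τ * f τ) := by
      funext τ; rw [h]; ring
    rw [e2, e1, avg_mul_left h1, avg_mul_left h1, mul_div_mul_left _ _ (h0 σ)]
  rw [e]
  exact (h2.mul hf).avg.div h2.avg

/-- The iterated expectation depends on no spin of `A ∪ B`, so it equals its own conditional
expectation, which the tower property evaluates. -/
theorem cE_union (hμ : ∀ σ, 0 < μ σ) (hS : Sep μ A B) (f : (ι → S) → ℝ) (σ : ι → S) :
    cE μ (A ∪ B) f σ = cE μ A (cE μ B f) σ := by
  have hfree : FreeOf (cE μ A (cE μ B f)) (A ∪ B) :=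
    cE_freeOf.union (FreeOf.cE hμ hS cE_freeOf)
  rw [← cE_eq_self hμ hfree, cE_cE hμ Finset.subset_union_left, cE_cE hμ Finset.subset_union_right]

theorem cE_comm (hμ : ∀ σ, 0 < μ σ) (hS : Sep μ A B) (f : (ι → S) → ℝ) (σ : ι → S) :
    cE μ A (cE μ B f) σ = cE μ B (cE μ A f) σ := by
  rw [← cE_union hμ hS, Finset.union_comm, cE_union hμ hS.symm]

/-- Averaging over a separated region decreases the entropy. -/
theorem cEnt_cE_le_cE_cEnt (hμ : ∀ σ, 0 < μ σ) (hS : Sep μ A B) (hf : ∀ σ, 0 < f σ) (σ : ι → S) :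
    cEnt μ A (cE μ B f) σ ≤ cE μ B (cEnt μ A f) σ := by
  set g := cE μ B f with hg
  have hg0 : ∀ σ, 0 < g σ := cE_pos hμ hf
  have hgB : FreeOf g B := cE_freeOf
  have hAg0 : ∀ σ, 0 < cE μ A g σ := cE_pos hμ hg0
  have hAgB : FreeOf (cE μ A g) B := FreeOf.cE hμ hS hgB
  -- The logarithm of the normalised density of `g` on `A`. Since `exp k` has conditional mean `1`,
  -- the variational bound carries no logarithmic term, and since `k` is free of `B`, it commutes
  -- with averaging over `B`.
  set k : (ι → S) → ℝ := fun τ => Real.log (g τ) - Real.log (cE μ A g τ) with hk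
  have hkB : FreeOf k B := (hgB.comp Real.log).sub (hAgB.comp Real.log)
  have hexp : ∀ τ, cE μ A (fun τ => Real.exp (k τ)) τ = 1 := by
    intro τ
    have e : (fun τ => Real.exp (k τ)) = fun τ => (cE μ A g τ)⁻¹ * g τ := by
      funext τ
      rw [hk, Real.exp_sub, Real.exp_log (hg0 τ), Real.exp_log (hAg0 τ)]
      field_simp
    rw [e, cE_mul_left (cE_freeOf.comp fun x => x⁻¹)]
    exact inv_mul_cancel₀ (hAg0 τ).ne'
  have h1 : cEnt μ A g σ = cE μ A (fun τ => g τ * k τ) σ := by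
    have e : (fun τ => g τ * k τ) = fun τ => g τ * Real.log (g τ) -
        Real.log (cE μ A g τ) * g τ := by funext τ; rw [hk]; ring
    rw [e, cE_sub, cE_mul_left (cE_freeOf.comp Real.log), cEnt]
    ring
  have h2 : (fun τ => g τ * k τ) = cE μ B fun τ => f τ * k τ := by
    funext τ
    simp_rw [mul_comm _ (k _)]
    rw [cE_mul_left hkB]
  rw [h1, h2, cE_comm hμ hS]
  refine cE_mono hμ (fun τ => ?_) σ
  have := cE_mul_le_cEnt (A := A) hμ hf k τ
  rwa [hexp, Real.log_one, mul_zero, add_zero] at this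

end Conditional

end

end PottsTree

namespace PottsTree

noncomputable section

/-! ### A logarithmic Sobolev inequality for bounded blocks -/

set_option linter.unusedSectionVars false

section Block

variable {ι S : Type} [Fintype ι] [DecidableEq ι] [Fintype S] [Nonempty S]
  {f g μ : (ι → S) → ℝ} {A B : Finset ι}

theorem siteMean_eq_cE (x : ι) (f : (ι → S) → ℝ) (σ : ι → S) :
    siteMean μ x f σ = cE μ {x} f σ := by
  have h1 : (Fintype.card S : ℝ) ≠ 0 := by exact_mod_cast Fintype.card_ne_zero
  simp only [siteMean, siteProb, cE, avg_singleton, div_mul_eq_mul_div, ← Finset.sum_div]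
  rw [div_div_div_cancel_right₀ h1]

theorem siteVariance_eq_cE (hμ : ∀ σ, 0 < μ σ) (x : ι) (g : (ι → S) → ℝ) (σ : ι → S) :
    siteVariance μ x g σ = cE μ {x} (fun τ => (g τ - cE μ {x} g σ) ^ 2) σ := by
  have e : (fun τ => (g τ - cE μ {x} g σ) ^ 2) = fun τ => (g τ ^ 2 -
    (2 * cE μ {x} g σ) * g τ) + cE μ {x} g σ ^ 2 := by funext τ; ring
  rw [e, cE_add, cE_sub, cE_const_mul, cE_const hμ, siteVariance, siteMean_eq_cE, siteMean_eq_cE]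
  ring

theorem siteVariance_nonneg (hμ : ∀ σ, 0 < μ σ) (x : ι) (σ : ι → S) :
    0 ≤ siteVariance μ x g σ := by
  rw [siteVariance_eq_cE hμ]
  exact cE_nonneg hμ (fun _ => sq_nonneg _) σ

/-- Changing one spin changes `μ` by a factor of at most `Q`. -/
def FlipBound (μ : (ι → S) → ℝ) (Q : ℝ) : Prop :=
  ∀ σ x s, μ (Function.update σ x s) ≤ Q * μ σ

variable {Q : ℝ}

theorem FlipBound.piecewise (hQ0 : 0 ≤ Q) (hQ : FlipBound μ Q) (A : Finset ι) (τ σ : ι → S) :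
    μ (A.piecewise τ σ) ≤ Q ^ A.card * μ σ := by
  induction A using Finset.induction_on with
  | empty => simp
  | insert x A hx ih =>
    rw [Finset.piecewise_insert, Finset.card_insert_of_notMem hx, pow_succ', mul_assoc]
    exact (hQ _ _ _).trans (mul_le_mul_of_nonneg_left ih hQ0)

theorem le_avg (hf : ∀ σ, 0 ≤ f σ) (A : Finset ι) (σ : ι → S) :
    f σ ≤ (Fintype.card S : ℝ) ^ A.card * avg A f σ := by
  have h1 : (0 : ℝ) < Fintype.card S := by exact_mod_cast Fintype.card_pos
  have h0 : ∀ (A : Finset ι) σ, 0 ≤ avg A f σ := fun A σ =>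
    div_nonneg (Finset.sum_nonneg fun _ _ => hf _) (Nat.cast_nonneg _)
  induction A using Finset.induction_on with
  | empty => rw [avg_eq_self freeOf_empty]; simp
  | insert x A hx ih =>
    rw [Finset.card_insert_of_notMem hx, pow_succ, Finset.insert_eq, ← avg_avg, mul_assoc]
    refine ih.trans (mul_le_mul_of_nonneg_left ?_ (by positivity))
    rw [avg_singleton, mul_div_cancel₀ _ h1.ne']
    have := Finset.single_le_sum (f := fun s => avg A f (Function.update σ x s))
      (fun s _ => h0 A _) (Finset.mem_univ (σ x))
    simpa using this

/-- Given the outside, every configuration on `A` has probability at least `(Q |S|) ^ (-|A|)`. -/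
theorem le_cE (hμ : ∀ σ, 0 < μ σ) (hQ0 : 0 ≤ Q) (hQ : FlipBound μ Q) (hf : ∀ σ, 0 ≤ f σ)
    (A : Finset ι) (σ : ι → S) :
    f σ ≤ (Q * Fintype.card S) ^ A.card * cE μ A f σ := by
  have h1 : (0 : ℝ) < Fintype.card S := by exact_mod_cast Fintype.card_pos
  have hav : avg A μ σ ≤ Q ^ A.card * μ σ := by
    have hN0 : (0 : ℝ) < Fintype.card (ι → S) := by exact_mod_cast Fintype.card_pos
    rw [avg, div_le_iff₀ hN0]
    refine (Finset.sum_le_sum fun τ _ => hQ.piecewise hQ0 A τ σ).trans ?_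
    rw [Finset.sum_const, Finset.card_univ, nsmul_eq_mul, mul_comm]
  have h2 := le_avg (f := fun τ => μ τ * f τ) (fun τ => mul_nonneg (hμ τ).le (hf τ)) A σ
  simp only [← cE_mul_avg hμ] at h2
  have h3 : 0 ≤ cE μ A f σ := cE_nonneg hμ hf σ
  have h4 : μ σ * f σ ≤ μ σ * ((Q * Fintype.card S) ^ A.card * cE μ A f σ) := by
    refine h2.trans ?_
    calc _ ≤ (Fintype.card S : ℝ) ^ A.card * (cE μ A f σ * (Q ^ A.card * μ σ)) := by gcongr
      _ = _ := by rw [mul_pow]; ring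
  exact le_of_mul_le_mul_left h4 (hμ σ)

/-- Both values deviate from the same conditional mean `c`, and each squared deviation costs at most
`Q |S|` times the conditional variance. -/
theorem sq_sub_update_le (hμ : ∀ σ, 0 < μ σ) (hQ0 : 0 ≤ Q) (hQ : FlipBound μ Q) (x : ι)
    (σ : ι → S) (s : S) :
    (g σ - g (Function.update σ x s)) ^ 2 ≤ 4 * (Q * Fintype.card S) * siteVariance μ x g σ := by
  set c := cE μ {x} g σ with hc
  have h1 := le_cE (f := fun τ => (g τ - c) ^ 2) hμ hQ0 hQ (fun _ => sq_nonneg _) {x} σ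
  have h2 := le_cE (f := fun τ => (g τ - c) ^ 2) hμ hQ0 hQ (fun _ => sq_nonneg _) {x}
    (Function.update σ x s)
  rw [(cE_freeOf (A := {x})).update (Finset.mem_singleton_self x)] at h2
  rw [← siteVariance_eq_cE hμ, Finset.card_singleton, pow_one] at h1 h2
  nlinarith [sq_nonneg (g σ - c + (g (Function.update σ x s) - c))]

/-- The constant in the logarithmic Sobolev inequality for blocks of at most `N` sites. -/
def blockConst (R : ℝ) (N : ℕ) : ℝ :=
  4 * R ^ N * (4 * N ^ 2 * (4 * R * R ^ N))

/-- Any two configurations in the block are joined to `σ` by at most `N` single flips. Each flip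
changes `√f` by an amount controlled by the averaged local variances, so the oscillation of `√f` is
controlled as well and `finEnt_sq_le` applies. The constant is exponential in `N`, which is harmless
for blocks of bounded size. -/
theorem cEnt_le_block (hμ : ∀ σ, 0 < μ σ) (hQ1 : 1 ≤ Q) (hQ : FlipBound μ Q) (B : Finset ι)
    {N : ℕ} (hN : B.card ≤ N) (hf : ∀ σ, 0 < f σ) (σ : ι → S) :
    cEnt μ B f σ ≤ blockConst (Q * Fintype.card S) N *
      cE μ B (fun τ => ∑ y ∈ B, siteVariance μ y (fun τ => √(f τ)) τ) σ := by
  have hQ0 : 0 ≤ Q := zero_le_one.trans hQ1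
  set R := Q * Fintype.card S with hR
  have hR1 : 1 ≤ R := by
    have : (1 : ℝ) ≤ Fintype.card S := by exact_mod_cast Fintype.card_pos
    nlinarith
  set g : (ι → S) → ℝ := fun τ => √(f τ) with hg
  set V := cE μ B (fun τ => ∑ y ∈ B, siteVariance μ y g τ) σ with hV
  have hV0 : 0 ≤ V := cE_nonneg hμ
    (fun τ => Finset.sum_nonneg fun y _ => siteVariance_nonneg hμ y τ) σ
  have hRpow : R ^ B.card ≤ R ^ N := pow_le_pow_right₀ hR1 hN
  set M := 4 * R * R ^ N * V with hM
  have hM0 : 0 ≤ M := by positivity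
  have hstep : ∀ (τ : ι → S), (∀ i, i ∉ B → τ i = σ i) → ∀ y ∈ B, ∀ s,
      |g τ - g (Function.update τ y s)| ≤ √M := by
    intro τ hτ y hy s
    refine Real.abs_le_sqrt ((sq_sub_update_le hμ hQ0 hQ y τ s).trans ?_)
    have h1 : siteVariance μ y g τ ≤ R ^ N * V := by
      have h2 := le_cE (f := fun τ => ∑ y ∈ B, siteVariance μ y g τ) hμ hQ0 hQ
        (fun τ => Finset.sum_nonneg fun y _ => siteVariance_nonneg hμ y τ) B τ
      rw [cE_freeOf τ σ hτ, ← hV] at h2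
      have h3 := Finset.single_le_sum (f := fun y => siteVariance μ y g τ)
        (fun y _ => siteVariance_nonneg hμ y τ) hy
      exact (h3.trans h2).trans (mul_le_mul_of_nonneg_right hRpow hV0)
    calc _ ≤ 4 * R * (R ^ N * V) := by gcongr
      _ = M := by rw [hM]; ring
  have hpath : ∀ (A : Finset ι), A ⊆ B → ∀ τ : ι → S,
      |g σ - g (A.piecewise τ σ)| ≤ A.card * √M := by
    intro A
    induction A using Finset.induction_on with
    | empty => intro _ τ; simp
    | insert x A hx ih =>
      intro hAB τ
      rw [Finset.piecewise_insert, Finset.card_insert_of_notMem hx]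
      have h1 := ih ((Finset.subset_insert x A).trans hAB) τ
      have h2 := hstep (A.piecewise τ σ) (fun i hi => by
        have : i ∉ A := fun h => hi (hAB (Finset.mem_insert_of_mem h))
        simp [this]) x (hAB (Finset.mem_insert_self x A)) (τ x)
      push_cast
      have := abs_sub_le (g σ) (g (A.piecewise τ σ))
        (g (Function.update (A.piecewise τ σ) x (τ x)))
      linarith
  have hosc : ∀ τ τ' : ι → S, (g (B.piecewise τ σ) - g (B.piecewise τ' σ)) ^ 2 ≤
      4 * N ^ 2 * M := by
    intro τ τ'
    have h1 := hpath B subset_rfl τ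
    have h2 := hpath B subset_rfl τ'
    have h3 : |g (B.piecewise τ σ) - g (B.piecewise τ' σ)| ≤ 2 * N * √M := by
      have := abs_sub_le (g (B.piecewise τ σ)) (g σ) (g (B.piecewise τ' σ))
      rw [abs_sub_comm] at h1
      have h4 : (B.card : ℝ) * √M ≤ N * √M :=
        mul_le_mul_of_nonneg_right (by exact_mod_cast hN) (Real.sqrt_nonneg _)
      linarith
    rw [← sq_abs]
    calc _ ≤ (2 * N * √M) ^ 2 := by gcongr
      _ = 4 * N ^ 2 * M := by rw [mul_pow, Real.sq_sqrt hM0]; ring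
  have hfg : f = fun τ => g τ ^ 2 := by
    funext τ
    rw [hg, Real.sq_sqrt (hf τ).le]
  rw [cEnt_eq_finEnt, hfg]
  refine (finEnt_sq_le (C := R ^ N) (fun τ => (cw_pos hμ σ τ).le) (sum_cw hμ σ)
    (fun τ => Real.sqrt_pos.2 (hf _)) (fun τ => ?_) _ hosc).trans (le_of_eq ?_)
  · have h2 := le_cE (f := fun τ => g τ ^ 2) hμ hQ0 hQ (fun _ => sq_nonneg _) B
      (B.piecewise τ σ)
    rw [cE_freeOf.piecewise, cE_eq_sum] at h2
    refine h2.trans (mul_le_mul_of_nonneg_right hRpow ?_)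
    exact Finset.sum_nonneg fun τ _ => mul_nonneg (cw_pos hμ σ τ).le (sq_nonneg _)
  · rw [blockConst, hM]
    ring

end Block

end

end PottsTree

namespace PottsTree

noncomputable section

/-! ### The Gibbs distribution on a complete tree as a product of edge factors -/

section TreeField

variable {b q m : ℕ} {θ : ℝ} {τ : BoundaryCondition b q}

/-- The sites of the complete tree of depth `m`. -/
abbrev Site (b m : ℕ) : Type := {v : Vertex b // v ∈ completeTree b m}

theorem Site.length_le (v : Site b m) : v.1.length ≤ m := mem_completeTree.1 v.2

/-- The factor of the edge between `w` and its parent in the Boltzmann weight. -/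
def edgeFactor (θ : ℝ) (τ : BoundaryCondition b q) (w : Vertex b) (σ : Site b m → Fin q) : ℝ :=
  if extend (completeTree b m) τ σ w = extend (completeTree b m) τ σ w.tail ∧
    extend (completeTree b m) τ σ w ≠ none then θ else 1

/-- The edges meeting the complete tree. -/
abbrev treeEdges (b m : ℕ) : Finset (Vertex b) := edgesMeeting (completeTree b m)

/-- The Gibbs distribution, parametrized by the factor `θ` of an agreeing edge. -/
def field (θ : ℝ) (τ : BoundaryCondition b q) (m : ℕ) (σ : Site b m → Fin q) : ℝ :=
  (∏ w ∈ treeEdges b m, edgeFactor θ τ w σ) /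
    ∑ σ' : Site b m → Fin q, ∏ w ∈ treeEdges b m, edgeFactor θ τ w σ'

theorem treeGibbs_eq_field (β : ℝ) (τ : BoundaryCondition b q) (m : ℕ) :
    treeGibbs β τ m = field (Real.exp (2 * β)) τ m := by
  have hw : ∀ σ : Site b m → Fin q, weight β (completeTree b m) τ σ =
      ∏ w ∈ treeEdges b m, edgeFactor (Real.exp (2 * β)) τ w σ := by
    intro σ
    simp only [edgeFactor, Finset.prod_ite, Finset.prod_const, one_pow, mul_one]
    rw [weight, agreeingEdges, mul_comm (2 * β), Real.exp_nat_mul]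
  funext σ
  simp only [treeGibbs, gibbs, field]
  rw [hw]
  congr 1
  exact Finset.sum_congr rfl fun σ' _ => hw σ'

theorem edgeFactor_pos (hθ : 0 < θ) (w : Vertex b) (σ : Site b m → Fin q) :
    0 < edgeFactor θ τ w σ := by
  unfold edgeFactor
  split_ifs
  exacts [hθ, one_pos]

theorem prod_edgeFactor_pos (hθ : 0 < θ) (E : Finset (Vertex b)) (σ : Site b m → Fin q) :
    0 < ∏ w ∈ E, edgeFactor θ τ w σ :=
  Finset.prod_pos fun w _ => edgeFactor_pos hθ w σ

theorem partition_pos [Nonempty (Fin q)] (hθ : 0 < θ) :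
    0 < ∑ σ : Site b m → Fin q, ∏ w ∈ treeEdges b m, edgeFactor θ τ w σ :=
  Finset.sum_pos (fun σ _ => prod_edgeFactor_pos hθ _ σ) Finset.univ_nonempty

theorem field_pos (hθ : 0 < θ) (σ : Site b m → Fin q) : 0 < field θ τ m σ :=
  have : Nonempty (Fin q) := ⟨σ ⟨[], by simp [mem_completeTree]⟩⟩
  div_pos (prod_edgeFactor_pos hθ _ σ) (partition_pos hθ)

theorem sum_field [Nonempty (Fin q)] (hθ : 0 < θ) :
    ∑ σ : Site b m → Fin q, field θ τ m σ = 1 := by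
  simp only [field, ← Finset.sum_div]
  exact div_self (partition_pos hθ).ne'

theorem edgeFactor_freeOf {A : Finset (Site b m)} {w : Vertex b}
    (h : ∀ x ∈ A, x.1 ≠ w ∧ x.1 ≠ w.tail) : FreeOf (edgeFactor θ τ w) A := by
  intro σ σ' hσ
  have key : ∀ v : Vertex b, (∀ x ∈ A, x.1 ≠ v) →
      extend (completeTree b m) τ σ v = extend (completeTree b m) τ σ' v := by
    intro v hv
    unfold extend
    split_ifs with hmem
    · rw [hσ ⟨v, hmem⟩ fun hA => hv _ hA rfl]
    · rfl
  unfold edgeFactor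
  rw [key w fun x hx => (h x hx).1, key w.tail fun x hx => (h x hx).2]

/-- Sort the edge factors by whether they ignore `A`; those that do not must ignore `B`. -/
theorem sep_of_edges {A B : Finset (Site b m)}
    (h : ∀ w ∈ treeEdges b m, FreeOf (edgeFactor (m := m) θ τ w) A ∨
      FreeOf (edgeFactor (m := m) θ τ w) B) :
    Sep (field θ τ m) A B := by
  classical
  set Z := ∑ σ : Site b m → Fin q, ∏ w ∈ treeEdges b m, edgeFactor θ τ w σ
  refine ⟨fun σ => (∏ w ∈ (treeEdges b m).filter fun w => FreeOf (edgeFactor (m := m) θ τ w) A,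
      edgeFactor θ τ w σ) / Z,
    fun σ => ∏ w ∈ (treeEdges b m).filter fun w => ¬ FreeOf (edgeFactor (m := m) θ τ w) A,
      edgeFactor θ τ w σ, fun σ => ?_, ?_, ?_⟩
  · rw [div_mul_eq_mul_div, Finset.prod_filter_mul_prod_filter_not]
    rfl
  · exact (FreeOf.prod fun w hw => (Finset.mem_filter.1 hw).2).comp fun x => x / Z
  · refine FreeOf.prod fun w hw => ?_
    rw [Finset.mem_filter] at hw
    exact (h w hw.1).resolve_left hw.2

theorem sep_of_nonadjacent {A B : Finset (Site b m)}
    (h : ∀ x ∈ A, ∀ y ∈ B, x.1 ≠ y.1 ∧ x.1.tail ≠ y.1 ∧ y.1.tail ≠ x.1) :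
    Sep (field θ τ m) A B := by
  refine sep_of_edges fun w _ => ?_
  by_contra! hcon
  have h1 : ∃ x ∈ A, x.1 = w ∨ x.1 = w.tail := by
    by_contra! hA
    exact hcon.1 (edgeFactor_freeOf hA)
  have h2 : ∃ x ∈ B, x.1 = w ∨ x.1 = w.tail := by
    by_contra! hB
    exact hcon.2 (edgeFactor_freeOf hB)
  obtain ⟨x, hx, hxw⟩ := h1
  obtain ⟨y, hy, hyw⟩ := h2
  obtain ⟨n1, n2, n3⟩ := h x hx y hy
  rcases hxw with hxw | hxw <;> rcases hyw with hyw | hyw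
  · exact n1 (hxw.trans hyw.symm)
  · exact n2 (by rw [hxw, hyw])
  · exact n3 (by rw [hxw, hyw])
  · exact n1 (hxw.trans hyw.symm)

/-- A site touches at most `b + 1` edges, and each factor lies between `1` and `θ`. -/
theorem flipBound_field (hθ : 1 ≤ θ) : FlipBound (field θ τ m) (θ ^ (b + 1)) := by
  classical
  intro σ x s
  have hθ0 : 0 < θ := one_pos.trans_le hθ
  have : Nonempty (Fin q) := ⟨s⟩
  simp only [field]
  rw [← mul_div_assoc]
  refine div_le_div_of_nonneg_right ?_ (partition_pos hθ0).le
  have hpt : ∀ w ∈ treeEdges b m, edgeFactor θ τ w (Function.update σ x s) ≤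
      (if x.1 = w ∨ x.1 = w.tail then θ else 1) * edgeFactor θ τ w σ := by
    intro w _
    split_ifs with h
    · have h1 : edgeFactor θ τ w (Function.update σ x s) ≤ θ := by
        unfold edgeFactor; split_ifs; exacts [le_rfl, hθ]
      have h2 : 1 ≤ edgeFactor θ τ w σ := by
        unfold edgeFactor; split_ifs; exacts [hθ, le_rfl]
      nlinarith
    · rw [one_mul]
      refine le_of_eq ((edgeFactor_freeOf (A := {x}) ?_).update (Finset.mem_singleton_self x) σ s)
      intro y hy
      rw [Finset.mem_singleton] at hy
      subst hy
      push Not at h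
      exact h
  refine (Finset.prod_le_prod (fun w _ => (edgeFactor_pos hθ0 w _).le) hpt).trans ?_
  rw [Finset.prod_mul_distrib]
  refine mul_le_mul_of_nonneg_right ?_ (prod_edgeFactor_pos hθ0 _ σ).le
  rw [Finset.prod_ite, Finset.prod_const, Finset.prod_const_one, mul_one]
  refine pow_le_pow_right₀ hθ ?_
  have hsub : ((treeEdges b m).filter fun w => x.1 = w ∨ x.1 = w.tail) ⊆
      insert x.1 (Finset.univ.image fun i : Fin b => i :: x.1) := by
    intro w hw
    rw [Finset.mem_filter, mem_edgesMeeting] at hw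
    obtain ⟨⟨hne, -⟩, rfl | h⟩ := hw
    · simp
    · cases w with
      | nil => exact absurd rfl hne
      | cons i v =>
        simp only [List.tail_cons] at h
        subst h
        simp
  refine (Finset.card_le_card hsub).trans ((Finset.card_insert_le _ _).trans ?_)
  gcongr
  exact Finset.card_image_le.trans (by simp)

/-! ### Subtrees -/

/-- The descendants of `v` in the complete tree, with `v` itself. -/
def subtree (v : Vertex b) : Finset (Site b m) := Finset.univ.filter fun w => v <:+ w.1

theorem mem_subtree {v : Vertex b} {w : Site b m} : w ∈ subtree v ↔ v <:+ w.1 := by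
  simp [subtree]

theorem self_mem_subtree (v : Site b m) : v ∈ subtree v.1 := mem_subtree.2 List.suffix_rfl

/-- `D` contains the descendants of its elements. -/
def DescClosed (D : Finset (Site b m)) : Prop := ∀ v ∈ D, ∀ w : Site b m, v.1 <:+ w.1 → w ∈ D

theorem descClosed_subtree (v : Vertex b) : DescClosed (subtree (m := m) v) := fun _ hu _ hw =>
  mem_subtree.2 ((mem_subtree.1 hu).trans hw)

theorem DescClosed.subtree_subset {D : Finset (Site b m)} (hD : DescClosed D) {v : Site b m}
    (hv : v ∈ D) : subtree v.1 ⊆ D := fun w hw => hD v hv w (mem_subtree.1 hw)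

theorem suffix_tail {v w : Vertex b} (h : v <:+ w) (hne : v ≠ w) : v <:+ w.tail := by
  cases w with
  | nil => exact absurd (List.suffix_nil.1 h) hne
  | cons i w => exact (List.suffix_cons_iff.1 h).resolve_left hne

theorem DescClosed.erase {D : Finset (Site b m)} (hD : DescClosed D) {y : Site b m}
    (hy : ∀ v ∈ D, v.1 <:+ y.1 → v = y) : DescClosed (D.erase y) := by
  intro v hv w hvw
  rw [Finset.mem_erase] at hv ⊢
  refine ⟨?_, hD v hv.2 w hvw⟩
  rintro rfl
  exact hv.1 (hy v hv.2 hvw)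

/-- The hypothesis keeps the parent of `y` out of `D`. The exception `v = y` allows for the root,
since `[].tail = []` makes it its own parent. -/
theorem sep_subtree {D : Finset (Site b m)} {y : Site b m}
    (hp : ∀ v ∈ D, v.1 = y.1.tail → v = y) :
    Sep (field θ τ m) (subtree y.1) (D \ subtree y.1) := by
  refine sep_of_nonadjacent fun x hx z hz => ?_
  rw [Finset.mem_sdiff, mem_subtree] at hz
  rw [mem_subtree] at hx
  refine ⟨fun h => hz.2 (h ▸ hx), fun h => ?_, fun h => ?_⟩
  · by_cases hxy : y.1 = x.1
    · have := hp z hz.1 (by rw [hxy, h])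
      exact hz.2 (this ▸ List.suffix_rfl)
    · exact hz.2 (h ▸ suffix_tail hx hxy)
  · exact hz.2 (hx.trans (h ▸ List.tail_suffix _))

theorem Sep.mono {ι S : Type} {μ : (ι → S) → ℝ} {A B A' B' : Finset ι} [Fintype ι]
    [DecidableEq ι] [Fintype S] (h : Sep μ A B) (hA : A' ⊆ A) (hB : B' ⊆ B) : Sep μ A' B' := by
  obtain ⟨W₁, W₂, h, h1, h2⟩ := h
  exact ⟨W₁, W₂, h, h1.mono hA, h2.mono hB⟩

/-- The entropy of the conditional expectation on a subtree given the spin at its root. -/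
def rootEnt (μ : (Site b m → Fin q) → ℝ) (f : (Site b m → Fin q) → ℝ) (v : Site b m) :
    (Site b m → Fin q) → ℝ :=
  cEnt μ (subtree v.1) (cE μ ((subtree v.1).erase v) f)

/-- Peel `D` from the top. For a site `v` of least depth in `D \ D'`, the chain rule splits the
entropy into that of `D` without `v` and that of the expectation given the spin at `v`. The rest of
`D` is separated from the subtree at `v`, and averaging over it only lowers entropy, which leaves
`rootEnt` at `v`. Averaging over `D'` beforehand keeps the sites of `D'` out of the sum. -/
theorem cEnt_le_sum_rootEnt (hθ : 0 < θ) {f : (Site b m → Fin q) → ℝ} (hf : ∀ σ, 0 < f σ)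
    {D' : Finset (Site b m)} (hD' : DescClosed D') (n : ℕ) :
    ∀ D : Finset (Site b m), DescClosed D → D' ⊆ D → (D \ D').card = n → ∀ σ,
      cEnt (field θ τ m) D (cE (field θ τ m) D' f) σ ≤
        ∑ v ∈ D \ D', cE (field θ τ m) D (rootEnt (field θ τ m) f v) σ := by
  set μ := field θ τ m with hμdef
  have hμ : ∀ σ, 0 < μ σ := field_pos hθ
  induction n with
  | zero =>
    intro D _ hsub hn σ
    rw [Finset.card_eq_zero] at hn
    have : D = D' := Finset.Subset.antisymm (Finset.sdiff_eq_empty_iff_subset.1 hn) hsub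
    subst this
    rw [cEnt_eq_zero hμ cE_freeOf, hn, Finset.sum_empty]
  | succ n ih =>
    intro D hD hsub hn σ
    have hne : (D \ D').Nonempty := by
      rw [← Finset.card_pos]; omega
    obtain ⟨v, hv, hmin⟩ := Finset.exists_min_image (D \ D') (fun v => v.1.length) hne
    rw [Finset.mem_sdiff] at hv
    have hsuf : ∀ u ∈ D, u.1 <:+ v.1 → u = v := by
      intro u hu huv
      have hu' : u ∉ D' := fun h => hv.2 (hD' u h v huv)
      have := hmin u (Finset.mem_sdiff.2 ⟨hu, hu'⟩)
      exact Subtype.ext (huv.eq_of_length_le this)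
    have hsep : Sep μ (subtree v.1) (D \ subtree v.1) :=
      sep_subtree fun u hu h => hsuf u hu (h ▸ List.tail_suffix _)
    have hTD : subtree v.1 ⊆ D := hD.subtree_subset hv.1
    set T := subtree (m := m) v.1 with hT
    have hvT : v ∈ T := self_mem_subtree v
    set R := D \ T with hR
    have hDU : T ∪ R = D := Finset.union_sdiff_of_subset hTD
    have hD1U : T.erase v ∪ R = D.erase v := by
      ext w
      simp only [hR, Finset.mem_union, Finset.mem_erase, Finset.mem_sdiff]
      constructor
      · rintro (⟨h1, h2⟩ | ⟨h1, h2⟩)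
        · exact ⟨h1, hTD h2⟩
        · exact ⟨fun h => h2 (h ▸ hvT), h1⟩
      · rintro ⟨h1, h2⟩
        by_cases h : w ∈ T
        · exact Or.inl ⟨h1, h⟩
        · exact Or.inr ⟨h2, h⟩
    have hsub1 : D' ⊆ D.erase v := fun w hw =>
      Finset.mem_erase.2 ⟨fun h => hv.2 (h ▸ hw), hsub hw⟩
    have hcard : (D.erase v \ D').card = n := by
      rw [Finset.erase_sdiff_comm, Finset.card_erase_of_mem (Finset.mem_sdiff.2 hv), hn]
      rfl
    have hE : D.erase v ⊆ D := Finset.erase_subset _ _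
    rw [cEnt_chain hμ hE]
    have hfirst : cE μ D (cEnt μ (D.erase v) (cE μ D' f)) σ ≤
        ∑ w ∈ D.erase v \ D', cE μ D (rootEnt μ f w) σ := by
      refine (cE_mono hμ (ih (D.erase v) (hD.erase hsuf) hsub1 hcard) σ).trans (le_of_eq ?_)
      rw [cE_sum]
      exact Finset.sum_congr rfl fun w _ => cE_cE hμ hE _ σ
    have hsecond : cEnt μ D (cE μ (D.erase v) (cE μ D' f)) σ ≤ cE μ D (rootEnt μ f v) σ := by
      have e1 : cE μ (D.erase v) (cE μ D' f) = cE μ R (cE μ (T.erase v) f) := by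
        funext ρ
        rw [cE_cE hμ hsub1, ← hD1U, cE_union hμ (hsep.mono (Finset.erase_subset _ _) subset_rfl),
          cE_comm hμ (hsep.mono (Finset.erase_subset _ _) subset_rfl)]
      set g := cE μ (T.erase v) f with hg
      have hg0 : ∀ σ, 0 < g σ := cE_pos hμ hf
      have hfree : FreeOf (cE μ R g) R := cE_freeOf
      have hTD' : ∀ h, FreeOf h R → cE μ D h σ = cE μ T h σ := fun h hh => by
        rw [← hDU, cE_union hμ hsep, show cE μ R h = h from funext (cE_eq_self hμ hh)]
      rw [e1, cEnt, hTD' _ hfree, hTD' _ (hfree.mul (hfree.comp Real.log)), ← cEnt]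
      refine (cEnt_cE_le_cE_cEnt hμ hsep hg0 σ).trans (le_of_eq ?_)
      rw [← hDU, cE_union hμ hsep, cE_comm hμ hsep]
      congr 1
      funext ρ
      exact (cE_eq_self hμ cEnt_freeOf ρ).symm
    have hins : D \ D' = insert v (D.erase v \ D') := by
      rw [Finset.erase_sdiff_comm, Finset.insert_erase (Finset.mem_sdiff.2 hv)]
    rw [hins, Finset.sum_insert (by simp)]
    linarith

end TreeField

end

end PottsTree

namespace PottsTree

noncomputable section

/-! ### Kernels of the Potts interaction -/

section Kernel

variable {q : ℕ} {θ κ u : ℝ} {h : Fin q → ℝ}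

/-- The weight of an edge with end spins `a` and `s`. -/
def pairWeight (θ : ℝ) (a s : Fin q) : ℝ := if a = s then θ else 1

/-- The law of the spin at a site with prior weights `h`, given the spin `a` at a neighbour. -/
def kernel (θ : ℝ) (h : Fin q → ℝ) (a s : Fin q) : ℝ :=
  pairWeight θ a s * h s / ∑ t, pairWeight θ a t * h t

/-- The kernel `k` contracts oscillations by a factor `κ`. -/
def Contracts (k : Fin q → Fin q → ℝ) (κ : ℝ) : Prop :=
  ∀ (a a' : Fin q) (F : Fin q → ℝ) (lo hi : ℝ), (∀ s, lo ≤ F s) → (∀ s, F s ≤ hi) →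
    ∑ s, k a s * F s - ∑ s, k a' s * F s ≤ κ * (hi - lo)

theorem pairWeight_pos (hθ : 0 < θ) (a s : Fin q) : 0 < pairWeight θ a s := by
  unfold pairWeight; split_ifs; exacts [hθ, one_pos]

theorem pairWeight_comm (a s : Fin q) : pairWeight θ a s = pairWeight θ s a := by
  simp [pairWeight, eq_comm]

theorem sum_pairWeight_mul (a : Fin q) :
    ∑ t, pairWeight θ a t * h t = (θ - 1) * h a + ∑ t, h t := by
  have : ∀ t, pairWeight θ a t * h t = (if a = t then (θ - 1) * h t else 0) + h t := by
    intro t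
    unfold pairWeight
    split_ifs <;> ring
  simp_rw [this, Finset.sum_add_distrib]
  simp

theorem sum_pairWeight_mul_pos (hθ : 0 < θ) (hh : ∀ s, 0 < h s) (a : Fin q) :
    0 < ∑ t, pairWeight θ a t * h t :=
  Finset.sum_pos (fun t _ => mul_pos (pairWeight_pos hθ a t) (hh t)) ⟨a, Finset.mem_univ a⟩

theorem kernel_pos (hθ : 0 < θ) (hh : ∀ s, 0 < h s) (a s : Fin q) : 0 < kernel θ h a s :=
  div_pos (mul_pos (pairWeight_pos hθ a s) (hh s)) (sum_pairWeight_mul_pos hθ hh a)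

theorem sum_kernel (hθ : 0 < θ) (hh : ∀ s, 0 < h s) (a : Fin q) : ∑ s, kernel θ h a s = 1 := by
  simp only [kernel, ← Finset.sum_div]
  exact div_self (sum_pairWeight_mul_pos hθ hh a).ne'

theorem kernel_const_mul {c : ℝ} (hc : c ≠ 0) (a s : Fin q) :
    kernel θ (fun s => c * h s) a s = kernel θ h a s := by
  simp only [kernel, mul_left_comm _ c, ← Finset.mul_sum]
  exact mul_div_mul_left _ _ hc

theorem kernel_self (a : Fin q) : kernel θ h a a = θ * h a / ((θ - 1) * h a + ∑ t, h t) := by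
  rw [kernel, sum_pairWeight_mul]
  simp [pairWeight]

theorem kernel_of_ne {a s : Fin q} (has : a ≠ s) :
    kernel θ h a s = h s / ((θ - 1) * h a + ∑ t, h t) := by
  rw [kernel, sum_pairWeight_mul]
  simp [pairWeight, has]

/-- If `h a' ≤ h a`, the kernel started at `a` favours only the spin `a` in comparison with the
kernel started at `a'`. -/
theorem kernel_le_kernel (hθ : 1 ≤ θ) (hh : ∀ s, 0 < h s) {a a' s : Fin q} (haa : h a' ≤ h a)
    (hs : s ≠ a) : kernel θ h a s ≤ kernel θ h a' s := by
  have hθ0 : 0 < θ := one_pos.trans_le hθ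
  rw [kernel, kernel]
  have e : pairWeight θ a s = 1 := by simp [pairWeight, hs.symm]
  have e' : 1 ≤ pairWeight θ a' s := by unfold pairWeight; split_ifs; exacts [hθ, le_rfl]
  rw [e]
  have hpos := sum_pairWeight_mul_pos hθ0 hh a'
  refine div_le_div₀ (mul_pos (pairWeight_pos hθ0 a' s) (hh s)).le
    (mul_le_mul_of_nonneg_right e' (hh s).le) hpos ?_
  rw [sum_pairWeight_mul, sum_pairWeight_mul]
  nlinarith

/-- By `kernel_le_kernel`, the difference of the two laws is positive at one spin only, so their
total variation distance is the difference there. -/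
theorem contracts_of_diag (hθ : 1 ≤ θ) (hh : ∀ s, 0 < h s)
    (hd : ∀ a a', h a' ≤ h a → kernel θ h a a - kernel θ h a' a ≤ κ) :
    Contracts (kernel θ h) κ := by
  have hθ0 : 0 < θ := one_pos.trans_le hθ
  have main : ∀ (a a' : Fin q) (F : Fin q → ℝ) (D : ℝ), h a' ≤ h a → (∀ s, 0 ≤ F s) →
      (∀ s, F s ≤ D) → ∑ s, kernel θ h a s * F s - ∑ s, kernel θ h a' s * F s ≤ κ * D := by
    intro a a' F D haa hF0 hFD
    rw [← Finset.sum_sub_distrib]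
    have hle : ∑ s, (kernel θ h a s * F s - kernel θ h a' s * F s) ≤
        ∑ s, if s = a then kernel θ h a a * F a - kernel θ h a' a * F a else 0 := by
      refine Finset.sum_le_sum fun s _ => ?_
      split_ifs with hs
      · rw [hs]
      · rw [← sub_mul]
        exact mul_nonpos_of_nonpos_of_nonneg
          (sub_nonpos.2 (kernel_le_kernel hθ hh haa hs)) (hF0 s)
    refine hle.trans ?_
    rw [Finset.sum_ite_eq' Finset.univ a, if_pos (Finset.mem_univ a), ← sub_mul]
    have hk : 0 ≤ kernel θ h a a - kernel θ h a' a := by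
      have h1 := sum_kernel hθ0 hh a
      have h2 := sum_kernel hθ0 hh a'
      have h3 : ∑ s, (kernel θ h a s - kernel θ h a' s) = 0 := by
        rw [Finset.sum_sub_distrib, h1, h2, sub_self]
      rw [← Finset.add_sum_erase _ _ (Finset.mem_univ a)] at h3
      have h4 : ∑ s ∈ Finset.univ.erase a, (kernel θ h a s - kernel θ h a' s) ≤ 0 :=
        Finset.sum_nonpos fun s hs =>
          sub_nonpos.2 (kernel_le_kernel hθ hh haa (Finset.ne_of_mem_erase hs))
      linarith
    exact mul_le_mul (hd a a' haa) (hFD a) (hF0 a) (hk.trans (hd a a' haa))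
  intro a a' F lo hi hlo hhi
  have hs : ∀ (a : Fin q) (c : ℝ), ∑ s, kernel θ h a s * (F s - c) =
      ∑ s, kernel θ h a s * F s - c := by
    intro a c
    simp_rw [mul_sub, Finset.sum_sub_distrib, ← Finset.sum_mul, sum_kernel hθ0 hh, one_mul]
  have hs' : ∀ (a : Fin q) (c : ℝ), ∑ s, kernel θ h a s * (c - F s) =
      c - ∑ s, kernel θ h a s * F s := by
    intro a c
    simp_rw [mul_sub, Finset.sum_sub_distrib, ← Finset.sum_mul, sum_kernel hθ0 hh, one_mul]
  rcases le_total (h a') (h a) with haa | haa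
  · have := main a a' (fun s => F s - lo) (hi - lo) haa (fun s => sub_nonneg.2 (hlo s))
      (fun s => sub_le_sub_right (hhi s) lo)
    rw [hs, hs] at this
    linarith
  · have := main a' a (fun s => hi - F s) (hi - lo) haa (fun s => sub_nonneg.2 (hhi s))
      (fun s => sub_le_sub_left (hlo s) hi)
    rw [hs', hs'] at this
    linarith

theorem contracts_kernel (hθ : 1 ≤ θ) (hh : ∀ s, 0 < h s) :
    Contracts (kernel θ h) ((θ - 1) / (θ + 1)) := by
  have hθ0 : 0 < θ := one_pos.trans_le hθ
  refine contracts_of_diag hθ hh fun a a' haa => ?_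
  rcases eq_or_ne a' a with rfl | hne
  · rw [sub_self]
    exact div_nonneg (by linarith) (by linarith)
  rw [kernel_self, kernel_of_ne hne, ← Finset.add_sum_erase _ _ (Finset.mem_univ a)]
  set X := ∑ t ∈ Finset.univ.erase a, h t with hX
  have hX' : h a' ≤ X := Finset.single_le_sum (f := h) (fun t _ => (hh t).le)
    (Finset.mem_erase.2 ⟨hne, Finset.mem_univ a'⟩)
  have ha := hh a
  have ha' := hh a'
  have hX0 : 0 < X := ha'.trans_le hX'
  have h1 : (θ - 1) * h a + (h a + X) = θ * h a + X := by ring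
  -- Replacing `h a'` by the whole remaining mass `X` reduces to two spins with weights `h a` and
  -- `X`; the worst case is then `h a = X`.
  have h2 : h a / (h a + θ * X) ≤ h a / ((θ - 1) * h a' + (h a + X)) := by
    refine div_le_div_of_nonneg_left ha.le (by nlinarith) (by nlinarith)
  rw [h1]
  refine (sub_le_sub_left h2 _).trans ?_
  rw [div_sub_div _ _ (by positivity) (by positivity), div_le_div_iff₀ (by positivity)
    (by positivity)]
  have h3 : 0 ≤ (θ - 1) * θ * (h a - X) ^ 2 := by
    have : 0 ≤ θ - 1 := by linarith
    positivity
  nlinarith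

/-- The oscillation of `F` is at most `u` times its minimum, and the minimum is below every average.
Thus contraction of differences becomes contraction of the excess of a ratio over `1`. -/
theorem Contracts.ratio_le {k : Fin q → Fin q → ℝ} (hk : Contracts k κ) (hκ : 0 ≤ κ)
    (hu : 0 ≤ u) (hk0 : ∀ a s, 0 ≤ k a s) (hk1 : ∀ a, ∑ s, k a s = 1) {F : Fin q → ℝ}
    (hF : ∀ s s', F s ≤ (1 + u) * F s') (a a' : Fin q) :
    ∑ s, k a s * F s ≤ (1 + κ * u) * ∑ s, k a' s * F s := by
  obtain ⟨s₀, -, hs₀⟩ := Finset.exists_min_image Finset.univ F ⟨a, Finset.mem_univ a⟩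
  have h1 := hk a a' F (F s₀) ((1 + u) * F s₀) (fun s => hs₀ s (Finset.mem_univ s))
    (fun s => hF s s₀)
  have h2 : F s₀ ≤ ∑ s, k a' s * F s := by
    calc F s₀ = ∑ s, k a' s * F s₀ := by rw [← Finset.sum_mul, hk1, one_mul]
      _ ≤ _ := Finset.sum_le_sum fun s _ =>
        mul_le_mul_of_nonneg_left (hs₀ s (Finset.mem_univ s)) (hk0 a' s)
  nlinarith [mul_le_mul_of_nonneg_left h2 (mul_nonneg hκ hu)]

theorem kernel_le_sq_mul (hθ : 1 ≤ θ) (hh : ∀ s, 0 < h s) (a a' s : Fin q) :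
    kernel θ h a s ≤ θ ^ 2 * kernel θ h a' s := by
  have hθ0 : 0 < θ := one_pos.trans_le hθ
  have hle : ∀ a t : Fin q, pairWeight θ a t ≤ θ := fun a t => by
    unfold pairWeight; split_ifs; exacts [le_rfl, hθ]
  have hge : ∀ a t : Fin q, 1 ≤ pairWeight θ a t := fun a t => by
    unfold pairWeight; split_ifs; exacts [hθ, le_rfl]
  have hZ : ∀ t, pairWeight θ a' t * h t ≤ θ * (pairWeight θ a t * h t) := fun t => by
    have := mul_le_mul_of_nonneg_right (hle a' t) (hh t).le
    have := mul_le_mul_of_nonneg_right (hge a t) (hh t).le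
    nlinarith
  have hZ' := Finset.sum_le_sum fun t (_ : t ∈ Finset.univ) => hZ t
  rw [← Finset.mul_sum] at hZ'
  have hpa := sum_pairWeight_mul_pos hθ0 hh a
  have hpa' := sum_pairWeight_mul_pos hθ0 hh a'
  rw [kernel, kernel, ← mul_div_assoc, div_le_div_iff₀ hpa hpa']
  have h1 : pairWeight θ a s * h s ≤ θ * (pairWeight θ a' s * h s) := by
    have := mul_le_mul_of_nonneg_right (hle a s) (hh s).le
    have := mul_le_mul_of_nonneg_right (hge a' s) (hh s).le
    nlinarith
  have h2 : 0 < pairWeight θ a' s * h s := mul_pos (pairWeight_pos hθ0 _ _) (hh s)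
  calc _ ≤ (θ * (pairWeight θ a' s * h s)) * (θ * ∑ t, pairWeight θ a t * h t) :=
        mul_le_mul h1 hZ' hpa'.le (by positivity)
    _ = _ := by ring

end Kernel

/-! ### Messages and conditional laws along the edges -/

section Messages

variable {b q m : ℕ} {θ : ℝ} {τ : BoundaryCondition b q}

/-- The partition function, up to a constant, of the subtree at a site of height `k`, as a
function of the spin of that site. -/
def msg (θ : ℝ) (τ : BoundaryCondition b q) : ℕ → Vertex b → Fin q → ℝ
  | 0, v, s => ∏ i, if τ (i :: v) = some s then θ else 1
  | k + 1, v, s => ∏ i, ∑ t, pairWeight θ s t * msg θ τ k (i :: v) t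

theorem msg_pos (hθ : 0 < θ) (k : ℕ) (v : Vertex b) (s : Fin q) : 0 < msg θ τ k v s := by
  induction k generalizing v s with
  | zero => exact Finset.prod_pos fun i _ => by split_ifs; exacts [hθ, one_pos]
  | succ k ih => exact Finset.prod_pos fun i _ => sum_pairWeight_mul_pos hθ (fun t => ih _ t) s

/-- The indicator of the event that the spin at `x` is `s`. -/
def spinInd (x : Site b m) (s : Fin q) (σ : Site b m → Fin q) : ℝ := if σ x = s then 1 else 0

theorem spinInd_freeOf {x : Site b m} {s : Fin q} {A : Finset (Site b m)} (hx : x ∉ A) :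
    FreeOf (spinInd x s) A := fun σ σ' h => by rw [spinInd, spinInd, h x hx]

theorem sum_spinInd (x : Site b m) (σ : Site b m → Fin q) : ∑ s, spinInd x s σ = 1 := by
  simp [spinInd]

theorem eq_sum_spinInd_mul (x : Site b m) (f : (Site b m → Fin q) → ℝ) (σ : Site b m → Fin q) :
    f σ = ∑ s, spinInd x s σ * f (Function.update σ x s) := by
  simp [spinInd]

theorem edgeFactor_eq_pairWeight {y p : Site b m} (hp : y.1.tail = p.1)
    (σ : Site b m → Fin q) : edgeFactor θ τ y.1 σ = pairWeight θ (σ p) (σ y) := by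
  have h1 : extend (completeTree b m) τ σ y.1 = some (σ y) := by simp [extend]
  have h2 : extend (completeTree b m) τ σ y.1.tail = some (σ p) := by rw [hp]; simp [extend]
  rw [edgeFactor, h1, h2, pairWeight]
  simp [eq_comm]

/-- Independence of the branches: each factor sees only its own region, so the average of the
product factorises. -/
theorem avg_biUnion_prod {ι S κ : Type} [Fintype ι] [DecidableEq ι] [Fintype S] [Nonempty S]
    [DecidableEq κ] (s : Finset κ) (T : κ → Finset ι) (F : κ → (ι → S) → ℝ)
    (hF : ∀ i j, i ≠ j → FreeOf (F i) (T j)) (σ : ι → S) :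
    avg (s.biUnion T) (fun τ => ∏ i ∈ s, F i τ) σ = ∏ i ∈ s, avg (T i) (F i) σ := by
  induction s using Finset.induction_on generalizing σ with
  | empty => simp [avg_eq_self freeOf_empty]
  | insert a s ha ih =>
    rw [Finset.biUnion_insert, Finset.prod_insert ha, Finset.union_comm, ← avg_avg]
    have e : avg (T a) (fun τ => ∏ i ∈ insert a s, F i τ) =
        fun τ => avg (T a) (F a) τ * ∏ i ∈ s, F i τ := by
      funext ρ
      have : (fun τ => ∏ i ∈ insert a s, F i τ) = fun τ => (∏ i ∈ s, F i τ) * F a τ := by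
        funext τ; rw [Finset.prod_insert ha, mul_comm]
      rw [this, avg_mul_left, mul_comm]
      exact FreeOf.prod fun i hi => hF i a fun h => ha (h ▸ hi)
    have hfree : FreeOf (avg (T a) (F a)) (s.biUnion T) := by
      intro σ σ' h
      refine (FreeOf.avg (A := T a) (f := F a) (B := s.biUnion T) ?_) σ σ' h
      refine freeOf_of_update fun x hx ρ t => ?_
      obtain ⟨j, hj, hxj⟩ := Finset.mem_biUnion.1 hx
      exact (hF a j fun h => ha (h ▸ hj)).update hxj ρ t
    rw [e, avg_mul_left hfree, ih]

/-- The edges in and below the subtree at `v`, without the edge from `v` to its parent. -/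
def edgesBelow (m : ℕ) (v : Vertex b) : Finset (Vertex b) :=
  (treeEdges b m).filter fun w => v <:+ w ∧ w ≠ v

/-- The edges in and below the subtree at `v`, with the edge from `v` to its parent. -/
def edgesFrom (m : ℕ) (v : Vertex b) : Finset (Vertex b) :=
  (treeEdges b m).filter fun w => v <:+ w

theorem edgesFrom_eq_insert {v : Site b m} (hv : v.1 ≠ []) :
    edgesFrom m v.1 = insert v.1 (edgesBelow m v.1) := by
  ext w
  simp only [edgesFrom, edgesBelow, Finset.mem_insert, Finset.mem_filter]
  constructor
  · rintro ⟨h1, h2⟩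
    by_cases h : w = v.1
    · exact Or.inl h
    · exact Or.inr ⟨h1, h2, h⟩
  · rintro (rfl | ⟨h1, h2, -⟩)
    · exact ⟨mem_edgesMeeting.2 ⟨hv, Or.inl v.2⟩, List.suffix_rfl⟩
    · exact ⟨h1, h2⟩

theorem subtree_eq_insert (v : Site b m) :
    subtree v.1 = {v} ∪ (subtree v.1).erase v := by
  rw [← Finset.insert_eq, Finset.insert_erase (self_mem_subtree v)]

/-- One step of the message recursion: averaging below `v` leaves `c * h (σ v)`, and averaging over
`v` then sums against the edge to the parent. The test function `g` lets the same computation give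
both the partition function and the law of the spin at `v`. -/
theorem avg_subtree_mul {v p : Site b m} (hv : v.1 ≠ []) (hp : v.1.tail = p.1) {c : ℝ}
    {h : Fin q → ℝ} [Nonempty (Fin q)]
    (hc : ∀ σ : Site b m → Fin q, avg ((subtree v.1).erase v)
      (fun σ => ∏ w ∈ edgesBelow m v.1, edgeFactor θ τ w σ) σ = c * h (σ v))
    (g : Fin q → ℝ) (σ : Site b m → Fin q) :
    avg (subtree v.1) (fun σ => g (σ v) * ∏ w ∈ edgesFrom m v.1, edgeFactor θ τ w σ) σ =
      c / q * ∑ t, g t * (pairWeight θ (σ p) t * h t) := by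
  have hpv : p ≠ v := by
    rintro rfl
    cases hv' : p.1 with
    | nil => exact hv hv'
    | cons i l =>
      rw [hv', List.tail_cons] at hp
      have := congrArg List.length hp
      simp at this
  have hpT : p ∉ (subtree v.1).erase v := by
    rw [Finset.mem_erase, mem_subtree]
    rintro ⟨-, h⟩
    have h1 := h.length_le
    have h2 := congrArg List.length hp
    have h3 := List.length_pos_of_ne_nil hv
    rw [List.length_tail] at h2
    omega
  have e : (fun σ : Site b m → Fin q => g (σ v) * ∏ w ∈ edgesFrom m v.1, edgeFactor θ τ w σ) =
      fun σ => (g (σ v) * pairWeight θ (σ p) (σ v)) *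
        ∏ w ∈ edgesBelow m v.1, edgeFactor θ τ w σ := by
    funext σ
    rw [edgesFrom_eq_insert hv, Finset.prod_insert (by simp [edgesBelow]),
      edgeFactor_eq_pairWeight hp]
    ring
  have hfree : FreeOf (fun σ : Site b m → Fin q => g (σ v) * pairWeight θ (σ p) (σ v))
      ((subtree v.1).erase v) := fun σ σ' h => by
    dsimp only
    rw [h v (by simp), h p hpT]
  have e2 : avg ((subtree v.1).erase v) (fun σ : Site b m → Fin q =>
      g (σ v) * ∏ w ∈ edgesFrom m v.1, edgeFactor θ τ w σ) =
      fun σ => (g (σ v) * pairWeight θ (σ p) (σ v)) * (c * h (σ v)) := by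
    funext ρ
    rw [e, avg_mul_left hfree, hc]
  rw [subtree_eq_insert v, ← avg_avg, e2, avg_singleton, Fintype.card_fin, Finset.mul_sum,
    Finset.sum_div]
  refine Finset.sum_congr rfl fun t _ => ?_
  rw [Function.update_self, Function.update_of_ne hpv]
  ring

/-- Below `v` the sites and the edges split into the branches at the children, so the average is a
product to which the induction applies branch by branch. The constant collects the normalisations of
the uniform averages. -/
theorem exists_avg_eq_msg [Nonempty (Fin q)] (k : ℕ) :
    ∀ v : Site b m, k + v.1.length = m → ∃ c : ℝ, 0 < c ∧ ∀ σ : Site b m → Fin q,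
      avg ((subtree v.1).erase v) (fun σ => ∏ w ∈ edgesBelow m v.1, edgeFactor θ τ w σ) σ =
        c * msg θ τ k v.1 (σ v) := by
  have hq : (0 : ℝ) < q := by
    have : 0 < Fintype.card (Fin q) := Fintype.card_pos
    rw [Fintype.card_fin] at this
    exact_mod_cast this
  have hcons : ∀ {v w : Vertex b}, v <:+ w → w ≠ v → ∃ i : Fin b, i :: v <:+ w := by
    intro v w h hne
    obtain ⟨l, rfl⟩ := h
    rcases List.eq_nil_or_concat l with rfl | ⟨l, i, rfl⟩
    · simp at hne
    · exact ⟨i, l, by simp⟩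
  have hdisj : ∀ {v w : Vertex b} {i j : Fin b}, i :: v <:+ w → j :: v <:+ w → i = j := by
    intro v w i j h1 h2
    have := (List.suffix_of_suffix_length_le h1 h2 (by simp)).eq_of_length (by simp)
    exact (List.cons.inj this).1
  have hnot : ∀ {v : Vertex b} {i : Fin b}, ¬ i :: v <:+ v := fun h => by
    have := h.length_le; simp at this
  induction k with
  | zero =>
    intro v hk
    have h1 : (subtree v.1).erase v = ∅ := by
      ext w
      simp only [Finset.mem_erase, mem_subtree, Finset.notMem_empty, iff_false, not_and]
      intro hne hsuf
      exact hne (Subtype.ext (hsuf.eq_of_length_le (by have := w.length_le; omega)).symm)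
    have h2 : edgesBelow m v.1 = Finset.univ.image fun i : Fin b => i :: v.1 := by
      ext w
      simp only [edgesBelow, Finset.mem_filter, mem_edgesMeeting, Finset.mem_image,
        Finset.mem_univ, true_and, mem_completeTree]
      constructor
      · rintro ⟨⟨hne, hw⟩, hsuf, hwv⟩
        obtain ⟨i, hi⟩ := hcons hsuf hwv
        refine ⟨i, hi.eq_of_length_le ?_⟩
        have := hi.length_le
        rw [List.length_tail] at hw
        simp only [List.length_cons] at this ⊢
        omega
      · rintro ⟨i, rfl⟩
        exact ⟨⟨by simp, Or.inr (by simp; omega)⟩, List.suffix_cons _ _,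
          fun h => by simp at h⟩
    refine ⟨1, one_pos, fun σ => ?_⟩
    rw [h1, avg_eq_self freeOf_empty, h2, Finset.prod_image (by intro i _ j _ h; simpa using h),
      one_mul, msg]
    refine Finset.prod_congr rfl fun i _ => ?_
    have h3 : extend (completeTree b m) τ σ (i :: v.1) = τ (i :: v.1) := by
      rw [extend, dif_neg]
      rw [mem_completeTree]
      simp
      omega
    have h4 : extend (completeTree b m) τ σ v.1 = some (σ v) := by simp [extend]
    rw [edgeFactor, h3, List.tail_cons, h4]
    refine if_congr ⟨fun h => h.1, fun h => ⟨h, by simp [h]⟩⟩ rfl rfl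
  | succ k ih =>
    intro v hk
    have hmem : ∀ i : Fin b, i :: v.1 ∈ completeTree b m := fun i => by
      rw [mem_completeTree, List.length_cons]; omega
    choose c hc0 hc using fun i : Fin b => ih ⟨i :: v.1, hmem i⟩ (by simp; omega)
    have h1 : (subtree v.1).erase v =
        (Finset.univ : Finset (Fin b)).biUnion fun i => subtree (m := m) (i :: v.1) := by
      ext w
      simp only [Finset.mem_erase, mem_subtree, Finset.mem_biUnion, Finset.mem_univ, true_and]
      constructor
      · rintro ⟨hne, hsuf⟩
        exact hcons hsuf fun h => hne (Subtype.ext h)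
      · rintro ⟨i, hi⟩
        exact ⟨fun h => hnot (h ▸ hi), (List.suffix_cons _ _).trans hi⟩
    have h2 : edgesBelow m v.1 =
        (Finset.univ : Finset (Fin b)).biUnion fun i => edgesFrom m (i :: v.1) := by
      ext w
      simp only [edgesBelow, edgesFrom, Finset.mem_filter, Finset.mem_biUnion, Finset.mem_univ,
        true_and]
      constructor
      · rintro ⟨hw, hsuf, hne⟩
        obtain ⟨i, hi⟩ := hcons hsuf hne
        exact ⟨i, hw, hi⟩
      · rintro ⟨i, hw, hi⟩
        exact ⟨hw, (List.suffix_cons _ _).trans hi, fun h => hnot (h ▸ hi)⟩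
    have hpd : Set.PairwiseDisjoint (↑(Finset.univ : Finset (Fin b)))
        fun i => edgesFrom m (i :: v.1) := by
      intro i _ j _ hij
      refine Finset.disjoint_left.2 fun w hw hw' => hij ?_
      exact hdisj (Finset.mem_filter.1 hw).2 (Finset.mem_filter.1 hw').2
    refine ⟨∏ i, c i / q, Finset.prod_pos fun i _ => div_pos (hc0 i) hq, fun σ => ?_⟩
    have e : (fun σ : Site b m → Fin q => ∏ w ∈ edgesBelow m v.1, edgeFactor θ τ w σ) =
        fun σ => ∏ i : Fin b, ∏ w ∈ edgesFrom m (i :: v.1), edgeFactor θ τ w σ := by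
      funext σ
      rw [h2, Finset.prod_biUnion hpd]
    rw [h1, e, avg_biUnion_prod, msg, ← Finset.prod_mul_distrib]
    · refine Finset.prod_congr rfl fun i _ => ?_
      have := avg_subtree_mul (v := ⟨i :: v.1, hmem i⟩) (p := v) (by simp) (by simp) (hc i)
        (fun _ => 1) σ
      simpa only [one_mul] using this
    · intro i j hij
      refine FreeOf.prod fun w hw => edgeFactor_freeOf fun x hx => ?_
      rw [mem_subtree] at hx
      have hw' := (Finset.mem_filter.1 hw).2
      refine ⟨fun h => hij (hdisj hw' (h ▸ hx)), fun h => ?_⟩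
      by_cases hwi : i :: v.1 = w
      · rw [← hwi, List.tail_cons] at h
        exact hnot (h ▸ hx)
      · exact hij (hdisj (suffix_tail hw' hwi) (h ▸ hx))

/-- The law of the spin at `y`, given the spins outside the subtree at `y`. -/
theorem cE_subtree_spinInd (hθ : 0 < θ) {k : ℕ} {y p : Site b m} (hk : k + y.1.length = m)
    (hy : y.1 ≠ []) (hp : y.1.tail = p.1) (a : Fin q) (σ : Site b m → Fin q) :
    cE (field θ τ m) (subtree y.1) (spinInd y a) σ = kernel θ (msg θ τ k y.1) (σ p) a := by
  have : Nonempty (Fin q) := ⟨a⟩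
  have hq : (0 : ℝ) < q := by
    have : 0 < Fintype.card (Fin q) := Fintype.card_pos
    rw [Fintype.card_fin] at this
    exact_mod_cast this
  obtain ⟨c, hc0, hc⟩ := exists_avg_eq_msg (θ := θ) (τ := τ) k y hk
  set Z := ∑ σ : Site b m → Fin q, ∏ w ∈ treeEdges b m, edgeFactor θ τ w σ with hZ
  set W₁ : (Site b m → Fin q) → ℝ := fun σ =>
    (∏ w ∈ (treeEdges b m).filter fun w => ¬ y.1 <:+ w, edgeFactor θ τ w σ) / Z with hW₁
  have hW₁free : FreeOf W₁ (subtree y.1) := by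
    refine FreeOf.comp (FreeOf.prod fun w hw => edgeFactor_freeOf fun x hx => ?_) fun x => x / Z
    rw [Finset.mem_filter] at hw
    rw [mem_subtree] at hx
    exact ⟨fun h => hw.2 (h ▸ hx), fun h => hw.2 ((h ▸ hx).trans (List.tail_suffix _))⟩
  have hμ : ∀ σ, field θ τ m σ = W₁ σ * ∏ w ∈ edgesFrom m y.1, edgeFactor θ τ w σ := by
    intro σ
    rw [hW₁, edgesFrom, div_mul_eq_mul_div, mul_comm, Finset.prod_filter_mul_prod_filter_not]
    rfl
  have hW₁0 : W₁ σ ≠ 0 := fun h => (field_pos (τ := τ) hθ σ).ne' (by rw [hμ, h, zero_mul])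
  have e1 : (fun σ => field θ τ m σ * spinInd y a σ) = fun σ => W₁ σ *
      ((if σ y = a then 1 else 0) * ∏ w ∈ edgesFrom m y.1, edgeFactor θ τ w σ) := by
    funext σ
    rw [hμ, spinInd]
    ring
  have e2 : field θ τ m = fun σ => W₁ σ * (1 * ∏ w ∈ edgesFrom m y.1, edgeFactor θ τ w σ) := by
    funext σ
    rw [hμ, one_mul]
  rw [cE, e1, e2, avg_mul_left hW₁free, avg_mul_left hW₁free, mul_div_mul_left _ _ hW₁0,
    avg_subtree_mul hy hp hc (fun t => if t = a then 1 else 0),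
    avg_subtree_mul hy hp hc (fun _ => 1), mul_div_mul_left _ _ (div_pos hc0 hq).ne', kernel]
  simp

/-- The law of the spin at a site `v` of the region `A`, as a function of the spin at a site `u`
that is adjacent to `v` and to no other site of `A`. -/
theorem exists_cE_eq_kernel (hθ : 0 < θ) {A : Finset (Site b m)} {u v : Site b m} (hv : v ∈ A)
    (hu : u ∉ A) {w₀ : Vertex b} (hw₀ : w₀ ∈ treeEdges b m)
    (he : ∀ σ : Site b m → Fin q, edgeFactor θ τ w₀ σ = pairWeight θ (σ u) (σ v))
    (hfree : ∀ w ∈ treeEdges b m, w ≠ w₀ → FreeOf (edgeFactor (m := m) θ τ w) A ∨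
      FreeOf (edgeFactor (m := m) θ τ w) {u}) (σ : Site b m → Fin q) :
    ∃ h : Fin q → ℝ, (∀ s, 0 < h s) ∧ ∀ a s,
      cE (field θ τ m) A (spinInd v s) (Function.update σ u a) = kernel θ h a s := by
  classical
  have huv : v ≠ u := fun h => hu (h ▸ hv)
  set Z := ∑ σ : Site b m → Fin q, ∏ w ∈ treeEdges b m, edgeFactor θ τ w σ with hZ
  set E := (treeEdges b m).erase w₀ with hE
  set W₁ : (Site b m → Fin q) → ℝ := fun σ =>
    (∏ w ∈ E.filter fun w => FreeOf (edgeFactor (m := m) θ τ w) A, edgeFactor θ τ w σ) / Z with hW₁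
  set W₂ : (Site b m → Fin q) → ℝ := fun σ =>
    ∏ w ∈ E.filter fun w => ¬ FreeOf (edgeFactor (m := m) θ τ w) A, edgeFactor θ τ w σ with hW₂
  have hW₂0 : ∀ σ, 0 < W₂ σ := fun σ => prod_edgeFactor_pos hθ _ σ
  have hW₁free : FreeOf W₁ A :=
    (FreeOf.prod fun w hw => (Finset.mem_filter.1 hw).2).comp fun x => x / Z
  have hW₂free : FreeOf W₂ {u} := by
    refine FreeOf.prod fun w hw => ?_
    rw [Finset.mem_filter, hE, Finset.mem_erase] at hw
    exact (hfree w hw.1.2 hw.1.1).resolve_left hw.2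
  have hμ : ∀ σ, field θ τ m σ = W₁ σ * (pairWeight θ (σ u) (σ v) * W₂ σ) := by
    intro σ
    rw [← he, mul_left_comm, hW₁, hW₂, div_mul_eq_mul_div, Finset.prod_filter_mul_prod_filter_not,
      mul_div_assoc', hE,
      Finset.mul_prod_erase (treeEdges b m) (fun w => edgeFactor θ τ w σ) hw₀]
    rfl
  -- The field at `v` is the weight of all other edges touching `A`, averaged subject to the spin of
  -- `v`. None of these edges sees `u`, so it does not depend on `a`.
  refine ⟨fun s => avg A (fun ρ => spinInd v s ρ * W₂ ρ) σ, fun s => ?_, fun a s => ?_⟩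
  · have : Nonempty (Fin q) := ⟨s⟩
    refine div_pos (Finset.sum_pos' (fun ρ _ => ?_) ⟨fun _ => s, Finset.mem_univ _, ?_⟩)
      (by exact_mod_cast Fintype.card_pos)
    · refine mul_nonneg ?_ (hW₂0 _).le
      unfold spinInd; split_ifs <;> norm_num
    · simp [spinInd, hv, hW₂0]
  · have : Nonempty (Fin q) := ⟨s⟩
    set ρ := Function.update σ u a with hρ
    have hW₁0 : W₁ ρ ≠ 0 := fun h => (field_pos (τ := τ) hθ ρ).ne' (by rw [hμ, h, zero_mul])
    have hfu : FreeOf (fun ξ : Site b m → Fin q => pairWeight θ (ξ u) s) A := fun ξ ξ' h => by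
      dsimp only; rw [h u hu]
    have key : ∀ s, avg A (fun ξ => spinInd v s ξ * (pairWeight θ (ξ u) (ξ v) * W₂ ξ)) ρ =
        pairWeight θ a s * avg A (fun ξ => spinInd v s ξ * W₂ ξ) σ := by
      intro s
      have hfu : FreeOf (fun ξ : Site b m → Fin q => pairWeight θ (ξ u) s) A := fun ξ ξ' h => by
        dsimp only; rw [h u hu]
      have e : (fun ξ : Site b m → Fin q => spinInd v s ξ * (pairWeight θ (ξ u) (ξ v) * W₂ ξ)) =
          fun ξ => pairWeight θ (ξ u) s * (spinInd v s ξ * W₂ ξ) := by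
        funext ξ
        unfold spinInd
        split_ifs with h
        · rw [h]; ring
        · ring
      have hfr : FreeOf (avg A fun ξ => spinInd v s ξ * W₂ ξ) {u} :=
        FreeOf.avg ((spinInd_freeOf (by simpa using huv)).mul hW₂free)
      rw [e, avg_mul_left hfu, hρ, Function.update_self,
        hfr.update (Finset.mem_singleton_self u)]
    have e1 : (fun ξ => field θ τ m ξ * spinInd v s ξ) = fun ξ => W₁ ξ *
        (spinInd v s ξ * (pairWeight θ (ξ u) (ξ v) * W₂ ξ)) := by
      funext ξ
      rw [hμ]
      ring
    have e2 : field θ τ m = fun ξ => W₁ ξ * (pairWeight θ (ξ u) (ξ v) * W₂ ξ) := funext hμ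
    have e3 : avg A (fun ξ => pairWeight θ (ξ u) (ξ v) * W₂ ξ) ρ =
        ∑ s, avg A (fun ξ => spinInd v s ξ * (pairWeight θ (ξ u) (ξ v) * W₂ ξ)) ρ := by
      simp only [avg, ← Finset.sum_div]
      rw [Finset.sum_comm]
      simp_rw [← Finset.sum_mul, sum_spinInd, one_mul]
    rw [cE, e1, e2, avg_mul_left hW₁free, avg_mul_left hW₁free, mul_div_mul_left _ _ hW₁0, e3,
      kernel]
    simp_rw [key]

end Messages

end

end PottsTree

namespace PottsTree

noncomputable section

section Influence

variable {b q m : ℕ} {θ κ : ℝ} {τ : BoundaryCondition b q}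

/-! ### Propagation of the influence of a spin -/

/-- Changing the spin at `z` changes `f` by a factor of at most `ρ`. -/
def RatioBound (f : (Site b m → Fin q) → ℝ) (z : Site b m) (ρ : ℝ) : Prop :=
  ∀ σ s, f (Function.update σ z s) ≤ ρ * f σ

theorem RatioBound.mono {f : (Site b m → Fin q) → ℝ} {z : Site b m} {ρ ρ' : ℝ}
    (h : RatioBound f z ρ) (hf : ∀ σ, 0 ≤ f σ) (hρ : ρ ≤ ρ') : RatioBound f z ρ' :=
  fun σ s => (h σ s).trans (mul_le_mul_of_nonneg_right hρ (hf σ))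

theorem RatioBound.le_of_update {f : (Site b m → Fin q) → ℝ} {z : Site b m} {ρ : ℝ}
    (h : RatioBound f z ρ) (σ : Site b m → Fin q) (s s' : Fin q) :
    f (Function.update σ z s) ≤ ρ * f (Function.update σ z s') := by
  simpa using h (Function.update σ z s') s

theorem cE_eq_sum_spin {A : Finset (Site b m)} {v : Site b m} (μ : (Site b m → Fin q) → ℝ)
    {H : (Site b m → Fin q) → ℝ} (hH : FreeOf H (A.erase v)) (σ : Site b m → Fin q) :
    cE μ A H σ = ∑ a, cE μ A (spinInd v a) σ * H (Function.update σ v a) := by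
  have e : H = fun ρ => ∑ a, H (Function.update ρ v a) * spinInd v a ρ := by
    funext ρ
    rw [eq_sum_spinInd_mul v H ρ]
    exact Finset.sum_congr rfl fun a _ => mul_comm _ _
  conv_lhs => rw [e]
  rw [cE_sum]
  refine Finset.sum_congr rfl fun a _ => ?_
  rw [cE_mul_left, mul_comm]
  intro ρ ρ' h
  refine hH _ _ fun i hi => ?_
  rcases eq_or_ne i v with rfl | hiv
  · simp
  · rw [Function.update_of_ne hiv, Function.update_of_ne hiv]
    exact h i fun hA => hi (Finset.mem_erase.2 ⟨hiv, hA⟩)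

/-- The first `n` levels of the subtree at `x`. -/
def block (x : Site b m) (n : ℕ) : Finset (Site b m) :=
  (subtree x.1).filter fun w => w.1.length < x.1.length + n

theorem mem_block {x w : Site b m} {n : ℕ} :
    w ∈ block x n ↔ x.1 <:+ w.1 ∧ w.1.length < x.1.length + n := by
  rw [block, Finset.mem_filter, mem_subtree]

/-- The parent of a site. -/
def Site.parent (y : Site b m) : Site b m :=
  ⟨y.1.tail, mem_completeTree.2 (by
    have := y.length_le; have := (List.tail_suffix y.1).length_le; omega)⟩

/-- Influence travelling up the path from `z` to `x`. Removing the subtree at `z` from the block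
leaves the edge to the parent as the only link between `z` and the region, so the law of the parent
given `z` is a kernel, which contracts by `γ` whatever its field. The last step, from a child of `x`
to `x`, costs at most `θ ^ 2`, hence the exponent `j` for distance `j + 1`. -/
theorem ratioBound_root (hθ : 1 ≤ θ) (x : Site b m) (s : Fin q) (n j : ℕ) :
    ∀ z : Site b m, z ∈ subtree x.1 → z.1.length = x.1.length + (j + 1) → j < n →
      RatioBound (cE (field θ τ m) (block x n \ subtree z.1) (spinInd x s)) z
        (1 + ((θ - 1) / (θ + 1)) ^ j * (θ ^ 2 - 1)) := by
  have hθ0 : 0 < θ := one_pos.trans_le hθ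
  have hμ : ∀ σ, 0 < field θ τ m σ := field_pos hθ0
  have hγ0 : 0 ≤ (θ - 1) / (θ + 1) := div_nonneg (by linarith) (by linarith)
  -- Edges from `z` to its children ignore the region, whose sites are not below `z`; every
  -- remaining edge except the one to the parent ignores `z`.
  have hker : ∀ z : Site b m, z ∈ subtree x.1 → ∀ j, z.1.length = x.1.length + (j + 1) → j < n →
      ∀ σ : Site b m → Fin q, ∃ h : Fin q → ℝ, (∀ s, 0 < h s) ∧ ∀ a s,
        cE (field θ τ m) (block x n \ subtree z.1) (spinInd z.parent s) (Function.update σ z a) =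
          kernel θ h a s := by
    intro z hz j hj hjn σ
    rw [mem_subtree] at hz
    have hzne : x.1 ≠ z.1 := fun h => by rw [h] at hj; omega
    refine exists_cE_eq_kernel hθ0 (w₀ := z.1) ?_ ?_ ?_ ?_ ?_ σ
    · rw [Finset.mem_sdiff, mem_block, mem_subtree]
      refine ⟨⟨suffix_tail hz hzne, ?_⟩, fun h => ?_⟩
      · rw [Site.parent, List.length_tail]; omega
      · have := h.length_le
        rw [Site.parent, List.length_tail] at this
        omega
    · simp [self_mem_subtree]
    · rw [mem_edgesMeeting]
      refine ⟨fun h => ?_, Or.inl z.2⟩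
      rw [h] at hj
      simp at hj
    · intro σ
      rw [edgeFactor_eq_pairWeight (p := z.parent) rfl, pairWeight_comm]
    · intro w _ hw
      by_cases hwz : z.1 = w.tail
      · left
        refine edgeFactor_freeOf fun v hv => ?_
        rw [Finset.mem_sdiff, mem_subtree] at hv
        refine ⟨fun h => hv.2 ?_, fun h => hv.2 ?_⟩
        · rw [hwz, h]; exact List.tail_suffix w
        · rw [hwz, h]
      · right
        refine edgeFactor_freeOf fun v hv => ?_
        rw [Finset.mem_singleton] at hv
        rw [hv]
        exact ⟨hw.symm, hwz⟩
  induction j with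
  | zero =>
    intro z hz hj hjn σ a
    have hzx : z.parent = x := by
      have hzne : x.1 ≠ z.1 := fun h => by rw [h] at hj; omega
      refine Subtype.ext ((suffix_tail (mem_subtree.1 hz) hzne).eq_of_length ?_).symm
      rw [List.length_tail]; omega
    obtain ⟨h, hh0, hh⟩ := hker z hz 0 hj hjn σ
    rw [hzx] at hh
    have h2 := hh (σ z) s
    rw [Function.update_eq_self] at h2
    rw [hh, h2, pow_zero, one_mul, add_sub_cancel]
    exact kernel_le_sq_mul hθ hh0 _ _ _
  | succ j ih =>
    intro z hz hj hjn σ a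
    have hzne : x.1 ≠ z.1 := fun h => by rw [h] at hj; omega
    set p := z.parent with hp
    have hpz : p.1 = z.1.tail := rfl
    have hpl : p.1.length = x.1.length + (j + 1) := by rw [hpz, List.length_tail]; omega
    have hpx : p ∈ subtree x.1 := mem_subtree.2 (suffix_tail (mem_subtree.1 hz) hzne)
    have hpne : p ≠ z := fun h => by rw [h] at hpl; omega
    obtain ⟨h, hh0, hh⟩ := hker z hz (j + 1) hj hjn σ
    set H := cE (field θ τ m) (block x n \ subtree p.1) (spinInd x s) with hH
    have hsub : block x n \ subtree p.1 ⊆ block x n \ subtree z.1 := by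
      refine Finset.sdiff_subset_sdiff subset_rfl fun w hw => ?_
      rw [mem_subtree] at hw ⊢
      exact (List.tail_suffix z.1).trans hw
    have hsep : Sep (field θ τ m) (block x n \ subtree p.1) ((subtree p.1).erase p) := by
      refine sep_of_nonadjacent fun v hv w hw => ?_
      rw [Finset.mem_sdiff, mem_subtree] at hv
      rw [Finset.mem_erase, mem_subtree] at hw
      refine ⟨fun h => hv.2 (h ▸ hw.2), fun h => ?_, fun h => ?_⟩
      · exact hv.2 ((h ▸ hw.2).trans (List.tail_suffix v.1))
      · exact hv.2 (h ▸ suffix_tail hw.2 fun h => hw.1 (Subtype.ext h.symm))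
    have hHfree : FreeOf H ((subtree p.1).erase p) := by
      refine FreeOf.cE hμ hsep (spinInd_freeOf fun hx => ?_)
      have := (mem_subtree.1 (Finset.mem_of_mem_erase hx)).length_le
      omega
    have hHA : FreeOf H ((block x n \ subtree z.1).erase p) := by
      refine ((cE_freeOf (A := block x n \ subtree p.1)).union hHfree).mono fun w hw => ?_
      rw [Finset.mem_erase, Finset.mem_sdiff] at hw
      rw [Finset.mem_union, Finset.mem_sdiff, Finset.mem_erase]
      by_cases hwp : w ∈ subtree p.1
      · exact Or.inr ⟨hw.1, hwp⟩
      · exact Or.inl ⟨hw.2.1, hwp⟩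
    have hval : ∀ a, cE (field θ τ m) (block x n \ subtree z.1) (spinInd x s)
        (Function.update σ z a) = ∑ c, kernel θ h a c * H (Function.update σ p c) := by
      intro a
      rw [← cE_cE hμ hsub, ← hH, cE_eq_sum_spin _ hHA]
      refine Finset.sum_congr rfl fun c _ => ?_
      rw [hh, Function.update_comm hpne.symm,
        hHfree.update (i := z) (Finset.mem_erase.2 ⟨hpne.symm, mem_subtree.2
          (List.tail_suffix z.1)⟩)]
    have h2 := hval (σ z)
    rw [Function.update_eq_self] at h2
    rw [hval, h2, pow_succ', mul_assoc]
    refine (contracts_kernel hθ hh0).ratio_le hγ0 ?_ (fun a s => (kernel_pos hθ0 hh0 a s).le)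
      (sum_kernel hθ0 hh0) (fun s s' => (ih p hpx hpl (by omega)).le_of_update σ s s') a (σ z)
    have : 0 ≤ θ ^ 2 - 1 := by nlinarith
    positivity

theorem ratioBound_root_block (hθ : 1 ≤ θ) (x : Site b m) (s : Fin q) (n : ℕ) (z : Site b m)
    (hz : z ∈ subtree x.1) (hzl : z.1.length = x.1.length + (n + 1)) :
    RatioBound (cE (field θ τ m) (block x (n + 1)) (spinInd x s)) z
        (1 + ((θ - 1) / (θ + 1)) ^ n * (θ ^ 2 - 1)) := by
  have h := ratioBound_root (τ := τ) hθ x s (n + 1) n z hz hzl (Nat.lt_succ_self n)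
  rwa [Finset.sdiff_eq_self_of_disjoint] at h
  refine Finset.disjoint_left.2 fun w hw hw' => ?_
  have h1 := (mem_block.1 hw).2
  have h2 := (mem_subtree.1 hw').length_le
  omega

/-- The root satisfies `[].tail = []`, so it would count among its own children; `z ∉ D` excludes
this. -/
theorem card_children_le {D : Finset (Site b m)} {z : Site b m} (hz : z ∉ D) :
    (D.filter fun w => w.1.tail = z.1).card ≤ b := by
  have hsub : (D.filter fun w => w.1.tail = z.1).image Subtype.val ⊆
      Finset.univ.image fun i : Fin b => i :: z.1 := by
    intro v hv
    obtain ⟨w, hw, rfl⟩ := Finset.mem_image.1 hv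
    obtain ⟨hwD, hwz⟩ := Finset.mem_filter.1 hw
    cases hw' : w.1 with
    | nil =>
      rw [hw', List.tail_nil] at hwz
      exact absurd ((Subtype.ext (hw'.trans hwz) : w = z) ▸ hwD) hz
    | cons i v =>
      rw [hw', List.tail_cons] at hwz
      simp [hwz]
  rw [← Finset.card_image_of_injective _ Subtype.val_injective]
  exact (Finset.card_le_card hsub).trans (Finset.card_image_le.trans (by simp))

/-- Influence on `G` accumulated while its spins are averaged out. `B j` bounds the direct effect of
a spin at relative depth `j`, and each child already averaged contributes a factor `1 + κ * u (j +
1)`; with all `b` children the total is at most `1 + u j`. The alternative `u = 0` in the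
contraction hypothesis covers sites so deep that `G` no longer depends on anything there, and no
contraction is then needed. -/
theorem ratioBound_cE (hθ : 1 ≤ θ) (hκ : 0 ≤ κ) {x : Site b m} {G : (Site b m → Fin q) → ℝ}
    (hG0 : ∀ σ, 0 < G σ) {B u : ℕ → ℝ} (hB : ∀ j, 0 ≤ B j) (hu0 : ∀ j, 0 ≤ u j)
    (hu : ∀ j, B j * (1 + κ * u (j + 1)) ^ b ≤ 1 + u j)
    (hG : ∀ z ∈ subtree x.1, RatioBound G z (B (z.1.length - x.1.length)))
    (hk : ∀ y ∈ subtree x.1, y ≠ x → ∀ k, k + y.1.length = m →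
      Contracts (kernel θ (msg θ τ k y.1)) κ ∨ u (y.1.length - x.1.length) = 0) (n : ℕ) :
    ∀ D : Finset (Site b m), DescClosed D → D ⊆ subtree x.1 → D.card = n →
      ∀ z ∈ subtree x.1, z ∉ D → RatioBound (cE (field θ τ m) D G) z
        (B (z.1.length - x.1.length) * (1 + κ * u (z.1.length - x.1.length + 1)) ^
          (D.filter fun w => w.1.tail = z.1).card) := by
  have hθ0 : 0 < θ := one_pos.trans_le hθ
  set μ := field θ τ m with hμdef
  have hμ : ∀ σ, 0 < μ σ := field_pos hθ0
  have h1u : ∀ j, 1 ≤ 1 + κ * u j := fun j => le_add_of_nonneg_right (mul_nonneg hκ (hu0 j))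
  induction n with
  | zero =>
    intro D _ _ hn z hz _
    rw [Finset.card_eq_zero] at hn
    subst hn
    rw [cE_empty hμ, Finset.filter_empty, Finset.card_empty, pow_zero, mul_one]
    exact hG z hz
  | succ n ih =>
    intro D hD hDx hn z hz hzD
    obtain ⟨y, hyD, hmin⟩ := Finset.exists_min_image D (fun v => v.1.length)
      (Finset.card_pos.1 (by omega))
    have hsuf : ∀ v ∈ D, v.1 <:+ y.1 → v = y := fun v hv h =>
      Subtype.ext (h.eq_of_length_le (hmin v hv))
    have hyx : y ≠ x := by
      rintro rfl
      exact hzD (hD _ hyD _ (mem_subtree.1 hz))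
    have hxy : x.1 <:+ y.1 := mem_subtree.1 (hDx hyD)
    have hyx' : x.1 ≠ y.1 := fun h => hyx (Subtype.ext h.symm)
    have hxlt : x.1.length < y.1.length :=
      lt_of_le_of_ne hxy.length_le fun h => hyx' (hxy.eq_of_length h)
    have hyne : y.1 ≠ [] := fun h => by rw [h] at hxlt; simp at hxlt
    set p := y.parent with hp
    have hpy : y.1.tail = p.1 := rfl
    have hpl : p.1.length + 1 = y.1.length := by
      rw [← hpy, List.length_tail]; omega
    have hpD : p ∉ D := fun h => by have := hmin p h; omega
    have hpx : p ∈ subtree x.1 := mem_subtree.2 (suffix_tail hxy hyx')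
    have hD'c : DescClosed (D.erase y) := hD.erase hsuf
    have hD'x : D.erase y ⊆ subtree x.1 := (Finset.erase_subset _ _).trans hDx
    have hD'n : (D.erase y).card = n := by rw [Finset.card_erase_of_mem hyD, hn]; rfl
    have IH := ih (D.erase y) hD'c hD'x hD'n
    set H := cE μ (D.erase y) G with hH
    have hH0 : ∀ σ, 0 < H σ := cE_pos hμ hG0
    have hHfree : FreeOf H (D.erase y) := cE_freeOf
    have hTD : subtree y.1 ⊆ D := hD.subtree_subset hyD
    have hsep : Sep μ (subtree y.1) (D \ subtree y.1) :=
      sep_subtree fun v hv h => hsuf v hv (h ▸ List.tail_suffix _)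
    have hRD' : D \ subtree y.1 ⊆ D.erase y := fun w hw => by
      rw [Finset.mem_sdiff] at hw
      exact Finset.mem_erase.2 ⟨fun h => hw.2 (h ▸ self_mem_subtree y), hw.1⟩
    obtain ⟨k, hk'⟩ : ∃ k, k + y.1.length = m := ⟨m - y.1.length, by
      have := y.length_le; omega⟩
    set K := kernel θ (msg θ τ k y.1) with hK
    have hmsg : ∀ s, 0 < msg θ τ k y.1 s := msg_pos hθ0 k y.1
    have hK0 : ∀ a s, 0 ≤ K a s := fun a s => (kernel_pos hθ0 hmsg a s).le
    have hval : ∀ σ, cE μ D G σ = ∑ a, K (σ p) a * H (Function.update σ y a) := by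
      intro σ
      rw [← cE_cE hμ (Finset.erase_subset y D), ← hH, ← Finset.union_sdiff_of_subset hTD,
        cE_union hμ hsep, show cE μ (D \ subtree y.1) H = H from
          funext (cE_eq_self hμ (hHfree.mono hRD')),
        cE_eq_sum_spin μ (v := y) (hHfree.mono (Finset.erase_subset_erase y hTD))]
      exact Finset.sum_congr rfl fun a _ => by
        rw [hμdef, cE_subtree_spinInd hθ0 hk' hyne hpy]
    have hzD' : z ∉ D.erase y := fun h => hzD (Finset.mem_of_mem_erase h)
    have hyz : y ≠ z := fun h => hzD (h ▸ hyD)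
    have IHz := IH z hz hzD'
    intro σ s
    rw [hval, hval]
    -- The parent of `y` acts on `H` directly and also through the law of `y`; any other site acts
    -- on `H` only.
    by_cases hzp : z = p
    · subst hzp
      have hcount : (D.filter fun w => w.1.tail = p.1).card =
          ((D.erase y).filter fun w => w.1.tail = p.1).card + 1 := by
        rw [Finset.filter_erase, Finset.card_erase_add_one]
        exact Finset.mem_filter.2 ⟨hyD, hpy⟩
      rw [hcount, pow_succ, Function.update_self]
      set ρ := B (p.1.length - x.1.length) * (1 + κ * u (p.1.length - x.1.length + 1)) ^
          ((D.erase y).filter fun w => w.1.tail = p.1).card with hρ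
      have hρ0 : 0 ≤ ρ := mul_nonneg (hB _) (pow_nonneg (zero_le_one.trans (h1u _)) _)
      have hlev : p.1.length - x.1.length + 1 = y.1.length - x.1.length := by
        have := (mem_subtree.1 hpx).length_le; omega
      have hIHy : RatioBound H y (1 + u (y.1.length - x.1.length)) := by
        refine (IH y (hDx hyD) (Finset.notMem_erase y D)).mono (fun σ => (hH0 σ).le) ?_
        refine le_trans ?_ (hu (y.1.length - x.1.length))
        exact mul_le_mul_of_nonneg_left (pow_le_pow_right₀ (h1u _)
          (card_children_le (Finset.notMem_erase y D))) (hB _)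
      have h1 : ∑ a, K s a * H (Function.update (Function.update σ p s) y a) ≤
          ρ * ∑ a, K s a * H (Function.update σ y a) := by
        rw [Finset.mul_sum]
        refine Finset.sum_le_sum fun a _ => ?_
        rw [Function.update_comm hyz.symm, mul_left_comm]
        exact mul_le_mul_of_nonneg_left (IHz _ _) (hK0 _ _)
      have h2 : ∑ a, K s a * H (Function.update σ y a) ≤
          (1 + κ * u (y.1.length - x.1.length)) *
            ∑ a, K (σ p) a * H (Function.update σ y a) := by
        rcases hk y (hDx hyD) hyx k hk' with hc | hc
        · exact hc.ratio_le hκ (hu0 _) hK0 (sum_kernel hθ0 hmsg)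
            (fun s s' => hIHy.le_of_update σ s s') _ _
        · have := (contracts_kernel hθ hmsg).ratio_le
            (div_nonneg (by linarith) (by linarith)) le_rfl hK0 (sum_kernel hθ0 hmsg)
            (fun s s' => by have := hIHy.le_of_update σ s s'; rwa [hc] at this) s (σ p)
          rw [hc]
          simpa using this
      calc _ ≤ _ := h1
        _ ≤ _ := mul_le_mul_of_nonneg_left h2 hρ0
        _ = _ := by rw [hρ, hlev]; ring
    · have hcount : (D.filter fun w => w.1.tail = z.1) =
          ((D.erase y).filter fun w => w.1.tail = z.1) := by
        rw [Finset.filter_erase, Finset.erase_eq_of_notMem]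
        rw [Finset.mem_filter]
        rintro ⟨-, h⟩
        exact hzp (Subtype.ext (h.symm.trans hpy))
      rw [hcount, Function.update_of_ne (Ne.symm hzp), Finset.mul_sum]
      refine Finset.sum_le_sum fun a _ => ?_
      rw [Function.update_comm hyz.symm, mul_left_comm]
      exact mul_le_mul_of_nonneg_left (IHz _ _) (hK0 _ _)

end Influence

end

end PottsTree

namespace PottsTree

noncomputable section

set_option linter.unusedSectionVars false

/-! ### Conditional Pinsker inequalities and an optimisation in one parameter -/

section ConditionalPinsker

variable {ι S : Type} [Fintype ι] [DecidableEq ι] [Fintype S] {f g k μ : (ι → S) → ℝ}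
  {A B : Finset ι}

/-- Since `k` has conditional mean zero, `f` may be replaced by `f` minus its conditional mean, and
Pinsker applies. -/
theorem sq_cE_mul_le (hμ : ∀ σ, 0 < μ σ) (hf : ∀ σ, 0 < f σ) (hk : ∀ σ, |k σ| ≤ 1)
    (hk0 : ∀ σ, cE μ A k σ = 0) (σ : ι → S) :
    cE μ A (fun τ => k τ * f τ) σ ^ 2 ≤ 4 * cE μ A f σ * cEnt μ A f σ := by
  have hP := sq_sum_abs_le_finEnt (fun τ => (cw_pos hμ σ τ).le) (sum_cw (A := A) hμ σ)
    (fun τ => hf (A.piecewise τ σ)) (cE μ A f σ) (cE_eq_sum σ)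
  rw [← cEnt_eq_finEnt] at hP
  refine le_trans ?_ hP
  set c := cE μ A f σ with hc
  have e : cE μ A (fun τ => k τ * f τ) σ = cE μ A (fun τ => k τ * (f τ - c)) σ := by
    have : (fun τ => k τ * (f τ - c)) = fun τ => k τ * f τ - c * k τ := by funext τ; ring
    rw [this, cE_sub, cE_const_mul, hk0, mul_zero, sub_zero]
  rw [e, ← sq_abs]
  have h1 : |cE μ A (fun τ => k τ * (f τ - c)) σ| ≤
      ∑ τ, cw μ A σ τ * |f (A.piecewise τ σ) - c| := by
    rw [cE_eq_sum]
    refine (Finset.abs_sum_le_sum_abs _ _).trans (Finset.sum_le_sum fun τ _ => ?_)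
    rw [abs_mul, abs_mul, abs_of_pos (cw_pos hμ σ τ)]
    refine mul_le_mul_of_nonneg_left ?_ (cw_pos hμ σ τ).le
    calc _ ≤ 1 * |f (A.piecewise τ σ) - c| :=
          mul_le_mul_of_nonneg_right (hk _) (abs_nonneg _)
      _ = _ := one_mul _
  gcongr

theorem cE_mul_cEnt_le (hμ : ∀ σ, 0 < μ σ) (hf : ∀ σ, 0 < f σ) (σ : ι → S) :
    cE μ A f σ * cEnt μ A f σ ≤ cE μ A (fun τ => (f τ - cE μ A f σ) ^ 2) σ := by
  have := mul_finEnt_le (fun τ => (cw_pos hμ σ τ).le) (sum_cw (A := A) hμ σ)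
    (fun τ => hf (A.piecewise τ σ)) (cE μ A f σ) (cE_eq_sum σ)
  rw [← cEnt_eq_finEnt] at this
  rwa [cE_eq_sum (f := fun τ => (f τ - cE μ A f σ) ^ 2)]

end ConditionalPinsker

/-- Take `t = X / (2c)` when it is admissible and `t = t₀` otherwise; the two alternatives
correspond. -/
theorem sq_le_of_forall_le_div_add_mul {X a c t₀ : ℝ} (ha : 0 ≤ a) (hc : 0 < c) (ht₀ : 0 < t₀)
    (hX : 0 ≤ X) (h : ∀ t, 0 < t → t ≤ t₀ → X ≤ a / t + c * t) :
    X ^ 2 ≤ 4 * a * c ∨ X ≤ 2 * a / t₀ := by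
  rcases hX.eq_or_lt with rfl | hX
  · left
    rw [zero_pow two_ne_zero]
    positivity
  · rcases le_or_gt (X / (2 * c)) t₀ with hle | hlt
    · left
      have h1 := h (X / (2 * c)) (by positivity) hle
      have h2 : a / (X / (2 * c)) + c * (X / (2 * c)) = (2 * a * c) / X + X / 2 := by
        field_simp
      rw [h2] at h1
      have h3 : X / 2 ≤ 2 * a * c / X := by linarith
      rw [le_div_iff₀ hX] at h3
      nlinarith
    · right
      have h1 := h t₀ ht₀ le_rfl
      rw [lt_div_iff₀ (by positivity)] at hlt
      have : a / t₀ * 2 = 2 * a / t₀ := by ring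
      nlinarith

/-! ### Entropy mixing in a subtree -/

section EntropyMixing

variable {b q m : ℕ} {θ κ κ' δ r : ℝ} {τ : BoundaryCondition b q}

theorem block_subset_subtree (x : Site b m) (n : ℕ) : block x n ⊆ subtree x.1 :=
  Finset.filter_subset _ _

theorem spinInd_nonneg (x : Site b m) (s : Fin q) (σ : Site b m → Fin q) : 0 ≤ spinInd x s σ := by
  unfold spinInd; split_ifs <;> norm_num

theorem spinInd_le_one (x : Site b m) (s : Fin q) (σ : Site b m → Fin q) :
    spinInd x s σ ≤ 1 := by
  unfold spinInd; split_ifs <;> norm_num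

/-- Inside the subtree at `x`, the block is adjacent only to the level just below it. -/
theorem block_law_freeOf (hθ : 0 < θ) (x : Site b m) (s : Fin q) (n : ℕ) {z : Site b m}
    (hz : z ∈ subtree x.1) (hzl : z.1.length ≠ x.1.length + n) (hn : 0 < n) :
    FreeOf (cE (field θ τ m) (block x n) (spinInd x s)) {z} := by
  by_cases hzB : z ∈ block x n
  · exact cE_freeOf.mono (by simpa using hzB)
  · have hlt : x.1.length + n < z.1.length := by
      rw [mem_block, not_and] at hzB
      have := hzB (mem_subtree.1 hz)
      omega
    refine FreeOf.cE (field_pos hθ) (sep_of_nonadjacent fun v hv w hw => ?_)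
      (spinInd_freeOf fun h => ?_)
    · rw [Finset.mem_singleton] at hw
      subst hw
      have h1 := (mem_block.1 hv).2
      refine ⟨fun h => ?_, fun h => ?_, fun h => ?_⟩
      · rw [h] at h1; omega
      · rw [← h, List.length_tail] at hlt; omega
      · rw [← h, List.length_tail] at h1; omega
    · rw [Finset.mem_singleton] at h
      rw [h] at hlt
      omega

/-- The conditional law of the spin at `x` given a distant level has small influence on average,
also under exponential tilting. -/
theorem tilted_root_bias (hθ : 1 ≤ θ) (hκ : 0 ≤ κ) (hκ' : 1 ≤ b * κ') (hδ1 : δ ≤ 1)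
    (hδ : ∀ u, 0 ≤ u → u ≤ δ → (1 + κ * u) ^ b ≤ 1 + b * κ' * u)
    (hr : b * κ' * ((θ - 1) / (θ + 1)) ≤ r) (n : ℕ) (x : Site b m)
    (hk : ∀ y ∈ subtree x.1, y ≠ x → ∀ k, k + y.1.length = m →
      y.1.length ≤ x.1.length + (n + 1) → Contracts (kernel θ (msg θ τ k y.1)) κ)
    (s : Fin q) {t c : ℝ} (ht : 0 ≤ t) (hc : c = t ∨ c = -t)
    (htδ : t * ((2 * (θ ^ 2 - 1) * (b * κ') + 1) * r ^ n) ≤ δ) (g : (Site b m → Fin q) → ℝ)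
    (hg : g = fun σ => cE (field θ τ m) (block x (n + 1)) (spinInd x s) σ -
      cE (field θ τ m) (subtree x.1) (spinInd x s) σ) (σ : Site b m → Fin q) :
    c * cE (field θ τ m) (subtree x.1) (fun σ => g σ * Real.exp (c * g σ)) σ ≤
      t * (t * ((2 * (θ ^ 2 - 1) * (b * κ') + 1) * r ^ n)) *
        cE (field θ τ m) (subtree x.1) (fun σ => Real.exp (c * g σ)) σ := by
  have hθ0 : 0 < θ := one_pos.trans_le hθ
  set μ := field θ τ m with hμdef
  have hμ : ∀ σ, 0 < μ σ := field_pos hθ0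
  set γ := (θ - 1) / (θ + 1) with hγ
  have hγ0 : 0 ≤ γ := div_nonneg (by linarith) (by linarith)
  have hθ2 : 0 ≤ θ ^ 2 - 1 := by nlinarith
  set T := subtree (m := m) x.1 with hT
  set p := cE μ (block x (n + 1)) (spinInd x s) with hp
  set π := cE μ T (spinInd x s) with hπ
  have hp0 : ∀ σ, 0 ≤ p σ := cE_nonneg hμ (spinInd_nonneg x s)
  have hp1 : ∀ σ, p σ ≤ 1 := fun σ =>
    (cE_mono hμ (spinInd_le_one x s) σ).trans (le_of_eq (cE_const hμ 1 σ))
  have hπ0 : ∀ σ, 0 ≤ π σ := cE_nonneg hμ (spinInd_nonneg x s)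
  have hπ1 : ∀ σ, π σ ≤ 1 := fun σ =>
    (cE_mono hμ (spinInd_le_one x s) σ).trans (le_of_eq (cE_const hμ 1 σ))
  have hπfree : FreeOf π T := cE_freeOf
  have hgp : ∀ σ, g σ = p σ - π σ := fun σ => by rw [hg]
  set G : (Site b m → Fin q) → ℝ := fun σ => Real.exp (c * g σ) with hG
  have hG0 : ∀ σ, 0 < G σ := fun σ => Real.exp_pos _
  have hcabs : |c| = t := by
    rcases hc with rfl | rfl
    · exact abs_of_nonneg ht
    · rw [abs_neg, abs_of_nonneg ht]
  -- One spin just below the block changes `p` by at most `w`, and hence multiplies `G` by at most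
  -- `exp (t * w) = 1 + U`.
  set w := γ ^ n * (θ ^ 2 - 1) with hw
  have hw0 : 0 ≤ w := by positivity
  set U := Real.exp (t * w) - 1 with hU
  have hU0 : 0 ≤ U := by
    have := Real.add_one_le_exp (t * w)
    have : 0 ≤ t * w := by positivity
    linarith
  set a := (b : ℝ) * κ' with ha
  have ha0 : 0 ≤ a := zero_le_one.trans hκ'
  set u₀ := t * ((2 * (θ ^ 2 - 1) * a + 1) * r ^ n) with hu₀
  have hr0 : 0 ≤ r := (by positivity : 0 ≤ a * γ).trans hr
  have hwa : w * a ^ (n + 1) ≤ (θ ^ 2 - 1) * a * r ^ n := by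
    calc w * a ^ (n + 1) = (θ ^ 2 - 1) * a * (a * γ) ^ n := by rw [hw, mul_pow a γ n]; ring
      _ ≤ _ := by gcongr
  have hrn : 0 ≤ r ^ n := by positivity
  have htw : t * w ≤ 1 := by
    have h1 : w ≤ w * a ^ (n + 1) := le_mul_of_one_le_right hw0 (one_le_pow₀ hκ')
    have h2 : t * w ≤ u₀ := by
      rw [hu₀]
      refine mul_le_mul_of_nonneg_left (h1.trans (hwa.trans ?_)) ht
      have : 0 ≤ (θ ^ 2 - 1) * a * r ^ n := by positivity
      linarith
    linarith
  have hU2 : U ≤ 2 * (t * w) := by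
    have h0 : 0 ≤ t * w := by positivity
    have h3 := Real.abs_exp_sub_one_le (x := t * w) (by rwa [abs_of_nonneg h0])
    rw [abs_of_nonneg h0] at h3
    exact (le_abs_self _).trans h3
  have hUa : U * a ^ (n + 1) ≤ u₀ := by
    calc U * a ^ (n + 1) ≤ 2 * (t * w) * a ^ (n + 1) := by gcongr
      _ = 2 * t * (w * a ^ (n + 1)) := by ring
      _ ≤ 2 * t * ((θ ^ 2 - 1) * a * r ^ n) := by gcongr
      _ ≤ u₀ := by
        rw [hu₀]
        have : 0 ≤ t * r ^ n := by positivity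
        linarith
  -- the ratio bounds for `G`
  set u : ℕ → ℝ := fun j => if j ≤ n + 1 then U * a ^ (n + 1 - j) else 0 with hu
  have hu_nonneg : ∀ j, 0 ≤ u j := fun j => by
    simp only [hu]; split_ifs <;> positivity
  have hu_le : ∀ j, u j ≤ δ := fun j => by
    refine le_trans ?_ (hUa.trans htδ)
    simp only [hu]
    split_ifs
    · exact mul_le_mul_of_nonneg_left (pow_le_pow_right₀ hκ' (Nat.sub_le _ _)) hU0
    · positivity
  set B : ℕ → ℝ := fun j => if j = n + 1 then 1 + U else 1 with hB
  have hB0 : ∀ j, 0 ≤ B j := fun j => by simp only [hB]; split_ifs <;> linarith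
  have hrec : ∀ j, B j * (1 + κ * u (j + 1)) ^ b ≤ 1 + u j := by
    intro j
    rcases lt_trichotomy j (n + 1) with hj | hj | hj
    · have h1 : B j = 1 := if_neg hj.ne
      have h2 : u j = a * u (j + 1) := by
        simp only [hu]
        rw [if_pos hj.le, if_pos (by omega), show n + 1 - j = (n + 1 - (j + 1)) + 1 by omega,
          pow_succ]
        ring
      rw [h1, one_mul, h2]
      exact hδ _ (hu_nonneg _) (hu_le _)
    · have h1 : B j = 1 + U := if_pos hj
      have h2 : u (j + 1) = 0 := if_neg (by omega)
      have h3 : u j = U := by simp [hu, hj]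
      rw [h1, h2, h3]
      simp
    · have h1 : B j = 1 := if_neg hj.ne'
      have h2 : u (j + 1) = 0 := if_neg (by omega)
      have h3 : u j = 0 := if_neg (by omega)
      rw [h1, h2, h3]
      simp
  have hGratio : ∀ z ∈ T, RatioBound G z (B (z.1.length - x.1.length)) := by
    intro z hz σ a
    have hxz := (mem_subtree.1 hz).length_le
    have hπz : π (Function.update σ z a) = π σ := hπfree.update hz σ a
    by_cases hl : z.1.length = x.1.length + (n + 1)
    · rw [show B (z.1.length - x.1.length) = 1 + U from if_pos (by omega)]
      have hR := ratioBound_root_block (τ := τ) hθ x s n z hz hl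
      have h1 := hR σ a
      have h2 := hR (Function.update σ z a) (σ z)
      rw [Function.update_idem, Function.update_eq_self] at h2
      rw [← hμdef, ← hp, ← hγ, ← hw] at h1 h2
      have h3 : |p (Function.update σ z a) - p σ| ≤ w := by
        rw [abs_le]
        constructor
        · nlinarith [hp1 (Function.update σ z a)]
        · nlinarith [hp1 σ]
      have h4 : c * g (Function.update σ z a) ≤ t * w + c * g σ := by
        rw [hgp, hgp, hπz]
        have h5 : c * (p (Function.update σ z a) - p σ) ≤ t * w := by
          calc _ ≤ |c * (p (Function.update σ z a) - p σ)| := le_abs_self _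
            _ = t * |p (Function.update σ z a) - p σ| := by rw [abs_mul, hcabs]
            _ ≤ t * w := by gcongr
        linarith
      calc G (Function.update σ z a) ≤ Real.exp (t * w + c * g σ) := Real.exp_le_exp.2 h4
        _ = (1 + U) * G σ := by rw [Real.exp_add, hU, hG]; ring
    · rw [show B (z.1.length - x.1.length) = 1 from if_neg (by omega), one_mul]
      refine le_of_eq ?_
      have h1 := (block_law_freeOf (τ := τ) hθ0 x s (n + 1) hz hl (Nat.succ_pos n)).update
        (Finset.mem_singleton_self z) σ a
      rw [← hμdef, ← hp] at h1
      simp only [hG, hgp, h1, hπz]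
  have hxT : x ∈ T := self_mem_subtree x
  have hratio : RatioBound (cE μ (T.erase x) G) x (1 + u₀) := by
    have h := ratioBound_cE (τ := τ) hθ hκ hG0 hB0 hu_nonneg hrec hGratio
      (fun y hy hyx k hky => ?_) (T.erase x).card (T.erase x)
      ((descClosed_subtree x.1).erase fun v hv h => Subtype.ext
        (h.eq_of_length_le (mem_subtree.1 hv).length_le)) (Finset.erase_subset _ _) rfl x hxT
      (Finset.notMem_erase x T)
    · refine h.mono (fun σ => (cE_pos hμ hG0 σ).le) ?_
      refine le_trans (mul_le_mul_of_nonneg_left (pow_le_pow_right₀ ?_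
        (card_children_le (Finset.notMem_erase x T))) (hB0 _)) ((hrec _).trans ?_)
      · exact le_add_of_nonneg_right (mul_nonneg hκ (hu_nonneg _))
      · have : u (x.1.length - x.1.length) = U * a ^ (n + 1) := by simp [hu]
        rw [this]
        linarith
    · by_cases hyl : y.1.length ≤ x.1.length + (n + 1)
      · exact Or.inl (hk y hy hyx k hky hyl)
      · exact Or.inr (if_neg (by omega))
  -- the bias of the tilted law
  set Gt := cE μ (T.erase x) G with hGt
  have hGt0 : ∀ σ, 0 < Gt σ := cE_pos hμ hG0
  set M := cE μ T G σ with hM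
  have hM0 : 0 < M := cE_pos hμ hG0 σ
  set K := Gt (Function.update σ x s) with hK
  have hKpos : 0 < K := hGt0 _
  have hMt : cE μ T Gt σ = M := cE_cE hμ (Finset.erase_subset x T) G σ
  have hGtfree : FreeOf Gt (T.erase x) := cE_freeOf
  have hKfree : FreeOf (fun ρ => Gt (Function.update ρ x s)) T := by
    intro ρ ρ' h
    refine hGtfree _ _ fun i hi => ?_
    rcases eq_or_ne i x with rfl | hix
    · simp
    · rw [Function.update_of_ne hix, Function.update_of_ne hix]
      exact h i fun hA => hi (Finset.mem_erase.2 ⟨hix, hA⟩)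
  have hKM : K ≤ (1 + u₀) * M := by
    rw [← hMt, ← cE_const_mul, hK,
      ← cE_eq_self hμ hKfree σ]
    exact cE_mono hμ (fun ρ => hratio ρ s) σ
  have hMK : M ≤ (1 + u₀) * K := by
    rw [← hMt, hK, ← cE_eq_self hμ hKfree σ, ← cE_const_mul]
    refine cE_mono hμ (fun ρ => ?_) σ
    have := hratio (Function.update ρ x s) (ρ x)
    rwa [Function.update_idem, Function.update_eq_self] at this
  have hBT := block_subset_subtree x (n + 1)
  have hGfreeB : FreeOf G (block x (n + 1)) := by
    have h1 : FreeOf g (block x (n + 1)) := by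
      rw [hg]; exact cE_freeOf.sub (hπfree.mono hBT)
    exact h1.comp fun y => Real.exp (c * y)
  -- `G` ignores the block, so `p` may be replaced by the indicator of the spin at `x`. Together
  -- with the full average of `G`, this expresses the tilted mean of `p - π` through `K - M`.
  have h1s : cE μ T (fun ρ => p ρ * G ρ) σ = π σ * K := by
    have e1 : (fun ρ => p ρ * G ρ) = cE μ (block x (n + 1)) fun ρ => G ρ * spinInd x s ρ := by
      funext ρ
      rw [cE_mul_left hGfreeB, mul_comm]
    have e2 : cE μ (T.erase x) (fun ρ => G ρ * spinInd x s ρ) =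
        fun ρ => spinInd x s ρ * Gt ρ := by
      funext ρ
      simp_rw [mul_comm (G _)]
      rw [cE_mul_left (spinInd_freeOf (Finset.notMem_erase x T))]
    have e3 : (fun ρ => spinInd x s ρ * Gt ρ) = fun ρ =>
        Gt (Function.update ρ x s) * spinInd x s ρ := by
      funext ρ
      unfold spinInd
      split_ifs with h
      · rw [← h, Function.update_eq_self, mul_comm]
      · ring
    rw [e1, cE_cE hμ hBT, ← cE_cE hμ (Finset.erase_subset x T), e2, e3, cE_mul_left hKfree,
      mul_comm]
  have hbias : cE μ T (fun ρ => g ρ * G ρ) σ = π σ * (K - M) := by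
    have e : (fun ρ => g ρ * G ρ) = fun ρ => p ρ * G ρ - π ρ * G ρ := by
      funext ρ; rw [hgp]; ring
    rw [e, cE_sub, h1s, cE_mul_left hπfree]
    ring
  have hπK : π σ * K ≤ M := by
    rw [← h1s]
    exact cE_mono hμ (fun ρ => by nlinarith [hp1 ρ, hG0 ρ]) σ
  have hu₀0 : 0 ≤ u₀ := (mul_nonneg hU0 (pow_nonneg ha0 _)).trans hUa
  rw [hbias]
  rcases hc with rfl | rfl
  · rw [mul_assoc]
    refine mul_le_mul_of_nonneg_left ?_ ht
    have h1 : K - M ≤ u₀ * M := by linarith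
    calc π σ * (K - M) ≤ π σ * (u₀ * M) := mul_le_mul_of_nonneg_left h1 (hπ0 σ)
      _ ≤ 1 * (u₀ * M) := mul_le_mul_of_nonneg_right (hπ1 σ) (by positivity)
      _ = _ := one_mul _
  · rw [mul_assoc, neg_mul_comm]
    refine mul_le_mul_of_nonneg_left ?_ ht
    have h1 : M - K ≤ u₀ * K := by linarith
    calc -(π σ * (K - M)) = π σ * (M - K) := by ring
      _ ≤ π σ * (u₀ * K) := mul_le_mul_of_nonneg_left h1 (hπ0 σ)
      _ = u₀ * (π σ * K) := by ring
      _ ≤ u₀ * M := mul_le_mul_of_nonneg_left hπK hu₀0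

/-- The entropy variational formula bounds `c * X` by the entropy of `F` and the logarithmic moment
`log M` of `exp (c g)`; `tilted_root_bias` bounds the latter by `t ^ 2 * C`. Both signs of `c` give
`|X|`, and optimising over `t ≤ δ / C` gives the square. If the optimum is out of range, `|X| ≤ mF`
supplies the missing factor. -/
theorem sq_root_bias_le (hθ : 1 ≤ θ) (hκ : 0 ≤ κ) (hκ' : 1 ≤ b * κ') (hδ0 : 0 < δ) (hδ1 : δ ≤ 1)
    (hδ : ∀ u, 0 ≤ u → u ≤ δ → (1 + κ * u) ^ b ≤ 1 + b * κ' * u)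
    (hr0 : 0 < r) (hr : b * κ' * ((θ - 1) / (θ + 1)) ≤ r) (n : ℕ) (x : Site b m)
    (hk : ∀ y ∈ subtree x.1, y ≠ x → ∀ k, k + y.1.length = m →
      y.1.length ≤ x.1.length + (n + 1) → Contracts (kernel θ (msg θ τ k y.1)) κ)
    (s : Fin q) (g : (Site b m → Fin q) → ℝ)
    (hg : g = fun σ => cE (field θ τ m) (block x (n + 1)) (spinInd x s) σ -
      cE (field θ τ m) (subtree x.1) (spinInd x s) σ) {F : (Site b m → Fin q) → ℝ}
    (hF : ∀ σ, 0 < F σ) (σ : Site b m → Fin q) :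
    cE (field θ τ m) (subtree x.1) (fun σ => g σ * F σ) σ ^ 2 ≤
      (4 + 2 / δ) * ((2 * (θ ^ 2 - 1) * (b * κ') + 1) * r ^ n) *
        (cE (field θ τ m) (subtree x.1) F σ * cEnt (field θ τ m) (subtree x.1) F σ) := by
  have hθ0 : 0 < θ := one_pos.trans_le hθ
  set μ := field θ τ m with hμdef
  have hμ : ∀ σ, 0 < μ σ := field_pos hθ0
  set T := subtree (m := m) x.1 with hT
  have hθ2 : 0 ≤ θ ^ 2 - 1 := by nlinarith
  have ha0 : 0 ≤ b * κ' := zero_le_one.trans hκ'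
  set C := (2 * (θ ^ 2 - 1) * (b * κ') + 1) * r ^ n with hC
  have hC0 : 0 < C := by positivity
  set X := cE μ T (fun σ => g σ * F σ) σ with hX
  set mF := cE μ T F σ with hmF
  have hmF0 : 0 < mF := cE_pos hμ hF σ
  set a := cEnt μ T F σ with ha
  have ha0 : 0 ≤ a := cEnt_nonneg hμ hF σ
  have hg1 : ∀ σ, |g σ| ≤ 1 := by
    intro σ
    have h1 : ∀ A, 0 ≤ cE μ A (spinInd x s) σ := fun A => cE_nonneg hμ (spinInd_nonneg x s) σ
    have h2 : ∀ A, cE μ A (spinInd x s) σ ≤ 1 := fun A =>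
      (cE_mono hμ (spinInd_le_one x s) σ).trans (le_of_eq (cE_const hμ 1 σ))
    rw [hg, abs_le]
    constructor
    · linarith [h1 (block x (n + 1)), h2 T]
    · linarith [h2 (block x (n + 1)), h1 T]
  have hXm : |X| ≤ mF := by
    rw [abs_le]
    constructor
    · rw [neg_le, ← neg_one_mul, ← cE_const_mul]
      refine cE_mono hμ (fun ρ => ?_) σ
      nlinarith [(abs_le.1 (hg1 ρ)).1, hF ρ]
    · refine cE_mono hμ (fun ρ => ?_) σ
      nlinarith [(abs_le.1 (hg1 ρ)).2, hF ρ]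
  have hmain : ∀ t c, 0 < t → t ≤ δ / C → (c = t ∨ c = -t) → c * X ≤ a + mF * (t * (t * C)) := by
    intro t c ht htC hc
    have h1 := tilted_root_bias (τ := τ) hθ hκ hκ' hδ1 hδ hr n x hk s ht.le hc
      (by rwa [le_div_iff₀ hC0] at htC) g hg σ
    rw [← hμdef, ← hT, ← hC] at h1
    set M := cE μ T (fun σ => Real.exp (c * g σ)) σ with hM
    have hM0 : 0 < M := cE_pos hμ (fun _ => Real.exp_pos _) σ
    -- Nonnegativity of the entropy of `exp (c g)` reads `M log M ≤ c E[g exp (c g)]`, so the tilted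
    -- mean at a single parameter bounds `log M`, with no integration over the parameter.
    have h2 := cEnt_nonneg (A := T) hμ (f := fun σ => Real.exp (c * g σ))
      (fun _ => Real.exp_pos _) σ
    rw [cEnt, ← hM] at h2
    have e : (fun σ => Real.exp (c * g σ) * Real.log (Real.exp (c * g σ))) =
        fun σ => c * (g σ * Real.exp (c * g σ)) := by
      funext ρ; rw [Real.log_exp]; ring
    rw [e, cE_const_mul] at h2
    have h3 : M * Real.log M ≤ M * (t * (t * C)) := by linarith
    have h4 := le_of_mul_le_mul_left h3 hM0
    have h5 := cE_mul_le_cEnt (A := T) hμ hF (fun σ => c * g σ) σ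
    have e2 : (fun τ => F τ * (c * g τ)) = fun τ => c * (g τ * F τ) := by funext ρ; ring
    rw [e2, cE_const_mul, ← hX, ← ha, ← hmF, ← hM] at h5
    have := mul_le_mul_of_nonneg_left h4 hmF0.le
    linarith
  have habs : ∀ t, 0 < t → t ≤ δ / C → |X| ≤ a / t + (mF * C) * t := by
    intro t ht htC
    have key : t * |X| ≤ a + mF * (t * (t * C)) := by
      rcases abs_choice X with h | h
      · rw [h]; exact hmain t t ht htC (Or.inl rfl)
      · rw [h, mul_neg, ← neg_mul]; exact hmain t (-t) ht htC (Or.inr rfl)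
    have : |X| = (t * |X|) / t := by field_simp
    rw [this, div_le_iff₀ ht]
    refine key.trans (le_of_eq ?_)
    field_simp
  rw [← sq_abs]
  have hma : 0 ≤ mF * a := by positivity
  rcases sq_le_of_forall_le_div_add_mul ha0 (by positivity) (div_pos hδ0 hC0) (abs_nonneg X) habs
    with h | h
  · refine h.trans ?_
    have : 0 ≤ 2 / δ * C * (mF * a) := by positivity
    nlinarith
  · have h6 : |X| ^ 2 ≤ mF * (2 * a / (δ / C)) := by
      rw [sq]; exact mul_le_mul hXm h (abs_nonneg _) hmF0.le
    refine h6.trans ?_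
    have : mF * (2 * a / (δ / C)) = 2 / δ * C * (mF * a) := by field_simp
    rw [this]
    have : 0 ≤ 4 * C * (mF * a) := by positivity
    nlinarith

/-- Entropy mixing: the entropy of the conditional expectation given the spin at the root of a
subtree is controlled by the entropy in the top block, up to a small multiple of the entropy in the
whole subtree. -/
theorem entropy_mixing (hθ : 1 ≤ θ) (hκ : 0 ≤ κ) (hκ' : 1 ≤ b * κ') (hδ0 : 0 < δ) (hδ1 : δ ≤ 1)
    (hδ : ∀ u, 0 ≤ u → u ≤ δ → (1 + κ * u) ^ b ≤ 1 + b * κ' * u)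
    (hr0 : 0 < r) (hr : b * κ' * ((θ - 1) / (θ + 1)) ≤ r) (n : ℕ) (x : Site b m)
    (hk : ∀ y ∈ subtree x.1, y ≠ x → ∀ k, k + y.1.length = m →
      y.1.length ≤ x.1.length + (n + 1) → Contracts (kernel θ (msg θ τ k y.1)) κ)
    {F : (Site b m → Fin q) → ℝ} (hF : ∀ σ, 0 < F σ) (σ : Site b m → Fin q) :
    rootEnt (field θ τ m) F x σ ≤ q * (θ ^ (b + 1) * q) *
      (8 * cE (field θ τ m) (subtree x.1) (cEnt (field θ τ m) (block x (n + 1)) F) σ +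
        2 * ((4 + 2 / δ) * ((2 * (θ ^ 2 - 1) * (b * κ') + 1) * r ^ n)) *
          cEnt (field θ τ m) (subtree x.1) F σ) := by
  have hθ0 : 0 < θ := one_pos.trans_le hθ
  have hne : Nonempty (Fin q) := ⟨σ x⟩
  rw [rootEnt]
  set μ := field θ τ m with hμdef
  have hμ : ∀ σ, 0 < μ σ := field_pos hθ0
  set T := subtree (m := m) x.1 with hT
  set Bl := block x (n + 1) with hBl
  set C := (4 + 2 / δ) * ((2 * (θ ^ 2 - 1) * (b * κ') + 1) * r ^ n) with hC
  set Φ := cE μ (T.erase x) F with hΦ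
  have hΦ0 : ∀ σ, 0 < Φ σ := cE_pos hμ hF
  have hΦfree : FreeOf Φ (T.erase x) := cE_freeOf
  have hET := Finset.erase_subset x T
  have hBT : Bl ⊆ T := block_subset_subtree x (n + 1)
  set M := cE μ T F σ with hM
  have hM0 : 0 < M := cE_pos hμ hF σ
  have hMΦ : cE μ T Φ σ = M := cE_cE hμ hET F σ
  set X₁ := cE μ T (cEnt μ Bl F) σ with hX₁
  set E := cEnt μ T F σ with hE
  -- Given the outside of the subtree, `Φ` is a function of the spin at `x` alone, so its variance
  -- is a sum of `q` terms.
  have h1 := cE_mul_cEnt_le (A := T) hμ hΦ0 σ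
  rw [hMΦ, cE_eq_sum_spin μ (v := x) ((hΦfree.sub (freeOf_const M)).comp fun y => y ^ 2)] at h1
  have hspin : ∀ s, cE μ T (spinInd x s) σ * (Φ (Function.update σ x s) - M) ^ 2 ≤
      (θ ^ (b + 1) * q) * (M * (8 * X₁ + 2 * C * E)) := by
    intro s
    set π := cE μ T (spinInd x s) σ with hπ
    set p := cE μ Bl (spinInd x s) with hp
    -- Every spin at `x` has probability bounded below, which turns `π * Δ ^ 2` into a multiple of
    -- `(π * Δ) ^ 2`, the square of a covariance.
    have hpi : 1 ≤ θ ^ (b + 1) * q * π := by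
      rw [hπ, ← cE_cE hμ (show {x} ⊆ T by simpa using self_mem_subtree x), ← cE_const_mul,
        ← cE_const (A := T) hμ 1 σ]
      refine cE_mono hμ (fun ρ => ?_) σ
      have := le_cE hμ (by positivity) (flipBound_field (τ := τ) (m := m) hθ)
        (spinInd_nonneg x s) {x} (Function.update ρ x s)
      rw [(cE_freeOf (A := {x})).update (Finset.mem_singleton_self x)] at this
      simpa [spinInd] using this
    have hπ0 : 0 < π := by
      by_contra! h
      have : θ ^ (b + 1) * q * π ≤ 0 := mul_nonpos_of_nonneg_of_nonpos (by positivity) h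
      linarith
    -- The covariance of `F` with the spin indicator, split through the conditional law given the
    -- outside of the block.
    have hΔ : π * (Φ (Function.update σ x s) - M) =
        cE μ T (fun ρ => (spinInd x s ρ - p ρ) * F ρ) σ +
          cE μ T (fun ρ => (p ρ - cE μ T (spinInd x s) ρ) * F ρ) σ := by
      rw [← cE_add]
      have e : (fun ρ => (spinInd x s ρ - p ρ) * F ρ +
          (p ρ - cE μ T (spinInd x s) ρ) * F ρ) = fun ρ => spinInd x s ρ * F ρ -
            cE μ T (spinInd x s) ρ * F ρ := by funext ρ; ring
      have e2 : cE μ (T.erase x) (fun ρ => spinInd x s ρ * F ρ) =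
          fun ρ => spinInd x s ρ * Φ ρ := by
        funext ρ
        rw [cE_mul_left (spinInd_freeOf (Finset.notMem_erase x T))]
      have e3 : cE μ T (fun ρ => spinInd x s ρ * Φ ρ) σ = π * Φ (Function.update σ x s) := by
        rw [cE_eq_sum_spin μ (v := x)
          ((spinInd_freeOf (Finset.notMem_erase x T)).mul hΦfree), Finset.sum_eq_single s]
        · simp [spinInd, hπ]
        · intro a _ has
          simp [spinInd, has]
        · simp
      rw [e, cE_sub, cE_mul_left cE_freeOf, ← cE_cE hμ hET, e2, e3]
      ring
    have hI1 : cE μ T (fun ρ => (spinInd x s ρ - p ρ) * F ρ) σ ^ 2 ≤ 4 * (M * X₁) := by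
      rw [← cE_cE hμ hBT]
      have hp0 : ∀ σ, 0 ≤ p σ := cE_nonneg hμ (spinInd_nonneg x s)
      have hp1 : ∀ σ, p σ ≤ 1 := fun σ =>
        (cE_mono hμ (spinInd_le_one x s) σ).trans (le_of_eq (cE_const hμ 1 σ))
      have h2 := cE_sq_le (A := T) hμ (f := fun ρ => 4 * cE μ Bl F ρ) (g := cEnt μ Bl F)
        (h := cE μ Bl fun ρ => (spinInd x s ρ - p ρ) * F ρ)
        (fun ρ => mul_nonneg zero_le_four (cE_pos hμ hF ρ).le) (cEnt_nonneg hμ hF)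
        (fun ρ => sq_cE_mul_le hμ hF (fun ρ => by
          rw [abs_le]
          constructor <;> linarith [hp0 ρ, hp1 ρ, spinInd_nonneg x s ρ, spinInd_le_one x s ρ])
          (fun ρ => by rw [cE_sub, cE_eq_self (f := p) hμ cE_freeOf, hp, sub_self]) ρ) σ
      refine h2.trans (le_of_eq ?_)
      rw [cE_const_mul, cE_cE hμ hBT]
      ring
    have hI2 : cE μ T (fun ρ => (p ρ - cE μ T (spinInd x s) ρ) * F ρ) σ ^ 2 ≤ C * (M * E) :=
      sq_root_bias_le (τ := τ) hθ hκ hκ' hδ0 hδ1 hδ hr0 hr n x hk s _ rfl hF σ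
    generalize cE μ T (fun ρ => (spinInd x s ρ - p ρ) * F ρ) σ = I₁ at hΔ hI1
    generalize cE μ T (fun ρ => (p ρ - cE μ T (spinInd x s) ρ) * F ρ) σ = I₂ at hΔ hI2
    generalize Φ (Function.update σ x s) - M = Δ at hΔ ⊢
    clear_value π M X₁ E C
    have hsq : (π * Δ) ^ 2 ≤ M * (8 * X₁ + 2 * C * E) := by
      rw [hΔ]
      calc (I₁ + I₂) ^ 2 ≤ 2 * (I₁ ^ 2 + I₂ ^ 2) := add_sq_le
        _ ≤ 2 * (4 * (M * X₁) + C * (M * E)) :=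
          mul_le_mul_of_nonneg_left (add_le_add hI1 hI2) two_pos.le
        _ = _ := by ring
    calc π * Δ ^ 2 ≤ (θ ^ (b + 1) * q * π) * (π * Δ ^ 2) :=
          le_mul_of_one_le_left (mul_nonneg hπ0.le (sq_nonneg _)) hpi
      _ = (θ ^ (b + 1) * q) * (π * Δ) ^ 2 := by ring
      _ ≤ _ := mul_le_mul_of_nonneg_left hsq (by positivity)
  have h2 := Finset.sum_le_sum fun s (_ : s ∈ Finset.univ) => hspin s
  rw [Finset.sum_const, Finset.card_univ, Fintype.card_fin, nsmul_eq_mul] at h2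
  refine le_of_mul_le_mul_left ((h1.trans h2).trans (le_of_eq ?_)) hM0
  ring

end EntropyMixing

end

end PottsTree

namespace PottsTree

noncomputable section

/-! ### From entropy mixing to the spectral gap and the logarithmic Sobolev constant -/

section Functional

variable {ι S : Type} [Fintype ι] [DecidableEq ι] [Fintype S] {μ : (ι → S) → ℝ}

theorem mean_nonneg (hμ : ∀ σ, 0 < μ σ) {f : (ι → S) → ℝ} (hf : ∀ σ, 0 ≤ f σ) :
    0 ≤ mean μ f := Finset.sum_nonneg fun σ _ => mul_nonneg (hμ σ).le (hf σ)

theorem mean_mono (hμ : ∀ σ, 0 < μ σ) {f g : (ι → S) → ℝ} (hfg : ∀ σ, f σ ≤ g σ) :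
    mean μ f ≤ mean μ g :=
  Finset.sum_le_sum fun σ _ => mul_le_mul_of_nonneg_left (hfg σ) (hμ σ).le

theorem mean_sum {κ : Type} (s : Finset κ) (F : κ → (ι → S) → ℝ) :
    mean μ (fun σ => ∑ k ∈ s, F k σ) = ∑ k ∈ s, mean μ (F k) := by
  simp only [mean, Finset.mul_sum]
  exact Finset.sum_comm

theorem mean_const_mul (c : ℝ) (f : (ι → S) → ℝ) :
    mean μ (fun σ => c * f σ) = c * mean μ f := by
  simp only [mean, Finset.mul_sum]
  exact Finset.sum_congr rfl fun _ _ => by ring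

theorem mean_add (f g : (ι → S) → ℝ) :
    mean μ (fun σ => f σ + g σ) = mean μ f + mean μ g := by
  simp only [mean, mul_add, Finset.sum_add_distrib]

theorem exists_ne_of_nonConstant {f : (ι → S) → ℝ} (hf : NonConstant f) (c : ℝ) :
    ∃ σ, f σ ≠ c := by
  obtain ⟨σ, σ', h⟩ := hf
  by_contra! hc
  exact h ((hc σ).trans (hc σ').symm)

theorem variance_pos (hμ : ∀ σ, 0 < μ σ) (hμ1 : ∑ σ, μ σ = 1) {f : (ι → S) → ℝ}
    (hf : NonConstant f) : 0 < variance μ f := by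
  have h : variance μ f = ∑ σ, μ σ * (f σ - mean μ f) ^ 2 := finVar_eq hμ1 f
  rw [h]
  obtain ⟨σ, hσ⟩ := exists_ne_of_nonConstant hf (mean μ f)
  refine Finset.sum_pos' (fun σ _ => mul_nonneg (hμ σ).le (sq_nonneg _))
    ⟨σ, Finset.mem_univ σ, mul_pos (hμ σ) ?_⟩
  have := sub_ne_zero.2 hσ
  positivity

theorem entropy_pos (hμ : ∀ σ, 0 < μ σ) (hμ1 : ∑ σ, μ σ = 1) {f : (ι → S) → ℝ}
    (hf0 : ∀ σ, 0 ≤ f σ) (hf : NonConstant f) : 0 < entropy μ f := by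
  have hm : 0 < mean μ f := by
    obtain ⟨σ, hσ⟩ := exists_ne_of_nonConstant hf 0
    exact Finset.sum_pos' (fun σ _ => mul_nonneg (hμ σ).le (hf0 σ))
      ⟨σ, Finset.mem_univ σ, mul_pos (hμ σ) (lt_of_le_of_ne (hf0 σ) hσ.symm)⟩
  have h : entropy μ f = _ := finEnt_eq (F := f) hμ1 (mean μ f) rfl
  rw [h]
  have key : ∀ σ, (√(f σ) - √(mean μ f)) ^ 2 ≤
      f σ * Real.log (f σ) - f σ * Real.log (mean μ f) - f σ + mean μ f := by
    intro σ
    rcases (hf0 σ).eq_or_lt with h0 | h0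
    · rw [← h0]
      simp [Real.sq_sqrt hm.le]
    · exact sq_sqrt_sub_le h0 hm
  obtain ⟨σ, hσ⟩ := exists_ne_of_nonConstant hf (mean μ f)
  refine Finset.sum_pos' (fun σ _ => mul_nonneg (hμ σ).le ((sq_nonneg _).trans (key σ)))
    ⟨σ, Finset.mem_univ σ, mul_pos (hμ σ) (lt_of_lt_of_le ?_ (key σ))⟩
  have : √(f σ) - √(mean μ f) ≠ 0 := by
    rw [sub_ne_zero, Ne, Real.sqrt_inj (hf0 σ) hm.le]
    exact hσ
  positivity

theorem dirichletForm_add_const [Nonempty S] (hμ : ∀ σ, 0 < μ σ) (f : (ι → S) → ℝ) (c : ℝ) :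
    dirichletForm μ (fun σ => f σ + c) = dirichletForm μ f := by
  unfold dirichletForm
  refine Finset.sum_congr rfl fun x _ => ?_
  congr 1
  funext σ
  rw [siteVariance_eq_cE hμ, siteVariance_eq_cE hμ, cE_add, cE_const hμ]
  simp

theorem variance_add_const (hμ1 : ∑ σ, μ σ = 1) (f : (ι → S) → ℝ) (c : ℝ) :
    variance μ (fun σ => f σ + c) = variance μ f := by
  have h : ∀ f : (ι → S) → ℝ, variance μ f = ∑ σ, μ σ * (f σ - mean μ f) ^ 2 := finVar_eq hμ1
  have h2 : mean μ (fun σ => f σ + c) = mean μ f + c := by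
    rw [mean_add]
    congr 1
    rw [mean, ← Finset.sum_mul, hμ1, one_mul]
  rw [h, h, h2]
  simp

/-- Apply the hypothesis to `f + t` and let `t` decrease to `0`; both sides are continuous there, as
`y log y` is at `0`. -/
theorem entropy_le_of_pos {C : ℝ}
    (hC : ∀ f : (ι → S) → ℝ, (∀ σ, 0 < f σ) →
      entropy μ f ≤ C * dirichletForm μ fun σ => √(f σ))
    {f : (ι → S) → ℝ} (hf : ∀ σ, 0 ≤ f σ) :
    entropy μ f ≤ C * dirichletForm μ fun σ => √(f σ) := by
  have hE : Continuous fun t : ℝ => entropy μ fun σ => f σ + t := by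
    unfold entropy mean
    refine Continuous.sub (continuous_finsetSum _ fun σ _ => continuous_const.mul ?_) ?_
    · exact Real.continuous_mul_log.comp (by fun_prop)
    · exact Real.continuous_mul_log.comp (by fun_prop)
  have hD : Continuous fun t : ℝ => C * dirichletForm μ fun σ => √(f σ + t) := by
    unfold dirichletForm mean siteVariance siteMean
    fun_prop
  have h1 := (hE.tendsto 0).mono_left (nhdsWithin_le_nhds (s := Set.Ioi (0 : ℝ)))
  have h2 := (hD.tendsto 0).mono_left (nhdsWithin_le_nhds (s := Set.Ioi (0 : ℝ)))
  simp only [add_zero] at h1 h2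
  refine le_of_tendsto_of_tendsto h1 h2 ?_
  filter_upwards [self_mem_nhdsWithin] with t ht
  exact hC _ fun σ => add_pos_of_nonneg_of_pos (hf σ) ht

/-- For the gap, apply the logarithmic Sobolev inequality to `g ^ 2` with `g > 0` and use that the
variance of `g` is at most the entropy of `g ^ 2`. Variance and Dirichlet form ignore additive
constants, so a general function may be made positive. -/
theorem le_cGap_and_le_cSob [Nonempty ι] [Nontrivial S] (hμ : ∀ σ, 0 < μ σ)
    (hμ1 : ∑ σ, μ σ = 1) {C : ℝ} (hC0 : 0 < C)
    (hC : ∀ f : (ι → S) → ℝ, (∀ σ, 0 < f σ) →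
      entropy μ f ≤ C * dirichletForm μ fun σ => √(f σ)) :
    C⁻¹ ≤ cGap μ ∧ C⁻¹ ≤ cSob μ := by
  obtain ⟨s, s', hss⟩ := exists_pair_ne S
  obtain ⟨x⟩ : Nonempty ι := inferInstance
  classical
  have hnc : NonConstant fun σ : ι → S => if σ x = s then (1 : ℝ) else 0 :=
    ⟨fun _ => s, fun _ => s', by simp [hss.symm]⟩
  constructor
  · have : Nonempty {f : (ι → S) → ℝ // NonConstant f} := ⟨⟨_, hnc⟩⟩
    refine le_ciInf fun ⟨f, hf⟩ => ?_
    dsimp only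
    rw [le_div_iff₀ (variance_pos hμ hμ1 hf), inv_mul_le_iff₀ hC0]
    obtain ⟨σ₀, -, hmin⟩ := Finset.exists_min_image Finset.univ f ⟨fun _ => s, Finset.mem_univ _⟩
    set g : (ι → S) → ℝ := fun σ => f σ + (1 - f σ₀) with hg
    have hg0 : ∀ σ, 0 < g σ := fun σ => by
      have := hmin σ (Finset.mem_univ σ)
      simp only [hg]; linarith
    have h1 : variance μ g ≤ entropy μ fun σ => g σ ^ 2 :=
      finVar_le_finEnt_sq (fun σ => (hμ σ).le) hμ1 hg0
    have h2 := hC (fun σ => g σ ^ 2) fun σ => by have := hg0 σ; positivity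
    simp only [Real.sqrt_sq (hg0 _).le] at h2
    rw [hg, variance_add_const hμ1] at h1
    rw [hg, dirichletForm_add_const hμ] at h2
    exact h1.trans h2
  · have : Nonempty {f : (ι → S) → ℝ // (∀ σ, 0 ≤ f σ) ∧ NonConstant f} :=
      ⟨⟨_, fun σ => by split_ifs <;> norm_num, hnc⟩⟩
    refine le_ciInf fun ⟨f, hf0, hf⟩ => ?_
    dsimp only
    rw [le_div_iff₀ (entropy_pos hμ hμ1 hf0 hf), inv_mul_le_iff₀ hC0]
    exact entropy_le_of_pos hC hf0

end Functional

/-! ### Summing the local estimates over the tree -/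

section Assembly

variable {b q m : ℕ} {θ κ κ' δ r : ℝ} {τ : BoundaryCondition b q}

theorem card_block_le (x : Site b m) (L : ℕ) : (block x L).card ≤ (completeTree b L).card := by
  rw [← Finset.card_image_of_injective _ Subtype.val_injective]
  refine (Finset.card_le_card (t := (completeTree b L).image fun l => l ++ x.1) ?_).trans
    Finset.card_image_le
  intro v hv
  obtain ⟨w, hw, rfl⟩ := Finset.mem_image.1 hv
  obtain ⟨⟨l, hl⟩, hlen⟩ := mem_block.1 hw
  refine Finset.mem_image.2 ⟨l, mem_completeTree.2 ?_, hl⟩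
  rw [← hl, List.length_append] at hlen
  omega

/-- A site lies only in the blocks of itself and its ancestors at distance less than `L`, namely
`y.1.drop j` with `j < L`. -/
theorem card_filter_mem_block_le (y : Site b m) (L : ℕ) :
    (Finset.univ.filter fun x => y ∈ block x L).card ≤ L := by
  rw [← Finset.card_image_of_injective _ Subtype.val_injective]
  refine (Finset.card_le_card (t := (Finset.range L).image fun j => y.1.drop j) ?_).trans
    (Finset.card_image_le.trans (by simp))
  intro v hv
  obtain ⟨x, hx, rfl⟩ := Finset.mem_image.1 hv
  obtain ⟨⟨l, hl⟩, hlen⟩ := mem_block.1 (Finset.mem_filter.1 hx).2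
  refine Finset.mem_image.2 ⟨l.length, ?_, ?_⟩
  · rw [← hl, List.length_append] at hlen
    rw [Finset.mem_range]
    omega
  · rw [← hl, List.drop_left]

theorem sum_sum_block_le {a : Site b m → ℝ} (ha : ∀ y, 0 ≤ a y) (L : ℕ) :
    ∑ x, ∑ y ∈ block x L, a y ≤ L * ∑ y, a y := by
  have e : ∀ x : Site b m, ∑ y ∈ block x L, a y = ∑ y, if y ∈ block x L then a y else 0 := by
    intro x
    rw [Finset.sum_ite_mem, Finset.univ_inter]
  simp_rw [e]
  rw [Finset.sum_comm, Finset.mul_sum]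
  refine Finset.sum_le_sum fun y _ => ?_
  rw [Finset.sum_ite, Finset.sum_const_zero, add_zero, Finset.sum_const, nsmul_eq_mul]
  exact mul_le_mul_of_nonneg_right (by exact_mod_cast card_filter_mem_block_le y L) (ha y)

theorem block_mono (x : Site b m) {n n' : ℕ} (h : n ≤ n') : block x n ⊆ block x n' := by
  intro w hw
  rw [mem_block] at hw ⊢
  exact ⟨hw.1, by omega⟩

theorem mean_cEnt_block_le (hθ : 1 ≤ θ) (x : Site b m) {n L : ℕ} (hL : n ≤ L)
    {f : (Site b m → Fin q) → ℝ} (hf : ∀ σ, 0 < f σ) [Nonempty (Fin q)] :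
    mean (field θ τ m) (cEnt (field θ τ m) (block x n) f) ≤
      blockConst (θ ^ (b + 1) * q) (completeTree b L).card *
        ∑ y ∈ block x L, mean (field θ τ m) (siteVariance (field θ τ m) y fun σ => √(f σ)) := by
  have hθ0 : 0 < θ := one_pos.trans_le hθ
  have hμ : ∀ σ, 0 < field θ τ m σ := field_pos hθ0
  have hcard : (block x n).card ≤ (completeTree b L).card :=
    (Finset.card_le_card (block_mono x hL)).trans (card_block_le x L)
  have h1 := mean_mono hμ fun σ => cEnt_le_block hμ (one_le_pow₀ hθ : 1 ≤ θ ^ (b + 1))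
    (flipBound_field (τ := τ) (m := m) hθ) (block x n) hcard hf σ
  rw [mean_const_mul, mean_cE hμ (sum_field hθ0), mean_sum, Fintype.card_fin] at h1
  refine h1.trans (mul_le_mul_of_nonneg_left ?_ ?_)
  · exact Finset.sum_le_sum_of_subset_of_nonneg (block_mono x hL) fun y _ _ =>
      mean_nonneg hμ (siteVariance_nonneg hμ y)
  · unfold blockConst
    positivity

/-- If `x` is high, mixing applies to its top block. If it is near the leaves, the whole subtree is
a bounded block and no mixing is needed; this is why contraction is required only from height `K`
on. -/
theorem mean_rootEnt_le (hθ : 1 ≤ θ) (hκ : 0 ≤ κ) (hκ' : 1 ≤ b * κ') (hδ0 : 0 < δ) (hδ1 : δ ≤ 1)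
    (hδ : ∀ u, 0 ≤ u → u ≤ δ → (1 + κ * u) ^ b ≤ 1 + b * κ' * u)
    (hr0 : 0 < r) (hr : b * κ' * ((θ - 1) / (θ + 1)) ≤ r) (n K : ℕ)
    (hk : ∀ (y : Site b m) (k : ℕ), k + y.1.length = m → K ≤ k →
      Contracts (kernel θ (msg θ τ k y.1)) κ)
    {f : (Site b m → Fin q) → ℝ} (hf : ∀ σ, 0 < f σ) (x : Site b m) [Nonempty (Fin q)] :
    mean (field θ τ m) (rootEnt (field θ τ m) f x) ≤
      (q * (θ ^ (b + 1) * q) * 8 + 1) *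
        blockConst (θ ^ (b + 1) * q) (completeTree b (n + 1 + K)).card *
        ∑ y ∈ block x (n + 1 + K),
          mean (field θ τ m) (siteVariance (field θ τ m) y fun σ => √(f σ)) +
      q * (θ ^ (b + 1) * q) * (2 * ((4 + 2 / δ) * (2 * (θ ^ 2 - 1) * (b * κ') + 1))) * r ^ n *
        ∑ v ∈ block x (n + 2), mean (field θ τ m) (rootEnt (field θ τ m) f v) := by
  have hθ0 : 0 < θ := one_pos.trans_le hθ
  set μ := field θ τ m with hμdef
  have hμ : ∀ σ, 0 < μ σ := field_pos hθ0
  have hμ1 : ∑ σ, μ σ = 1 := sum_field hθ0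
  set BC := blockConst (θ ^ (b + 1) * q) (completeTree b (n + 1 + K)).card with hBC
  have hBC0 : 0 ≤ BC := by
    rw [hBC]; unfold blockConst; positivity
  set V := ∑ y ∈ block x (n + 1 + K), mean μ (siteVariance μ y fun σ => √(f σ)) with hV
  have hV0 : 0 ≤ V := Finset.sum_nonneg fun y _ => mean_nonneg hμ (siteVariance_nonneg hμ y)
  have hroot0 : ∀ v, 0 ≤ mean μ (rootEnt μ f v) := fun v =>
    mean_nonneg hμ (cEnt_nonneg hμ (cE_pos hμ hf))
  have hθ2 : 0 ≤ θ ^ 2 - 1 := by nlinarith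
  have ha0 : 0 ≤ b * κ' := zero_le_one.trans hκ'
  set C₁ := q * (θ ^ (b + 1) * q) with hC₁
  have hC₁0 : 0 ≤ C₁ := by positivity
  set C₂ := 2 * ((4 + 2 / δ) * (2 * (θ ^ 2 - 1) * (b * κ') + 1)) with hC₂
  have hC₂0 : 0 ≤ C₂ := by positivity
  set T := subtree (m := m) x.1 with hT
  by_cases hx : x.1.length + (n + 1 + K) ≤ m
  -- Averaging `f` over all sites more than `n + 1` levels below `x` preserves `rootEnt` at `x`,
  -- while the entropy left in the subtree spreads over only `n + 2` levels. Otherwise the error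
  -- would involve all descendants and could not be absorbed.
  · set D' := T.filter fun w => x.1.length + (n + 1) < w.1.length with hD'
    have hD'c : DescClosed D' := by
      intro v hv w hvw
      rw [hD', Finset.mem_filter] at hv ⊢
      exact ⟨descClosed_subtree x.1 v hv.1 w hvw, hv.2.trans_le hvw.length_le⟩
    have hD'T : D' ⊆ T := Finset.filter_subset _ _
    have hD'e : D' ⊆ T.erase x := fun w hw => by
      rw [hD', Finset.mem_filter] at hw
      refine Finset.mem_erase.2 ⟨?_, hw.1⟩
      rintro rfl
      omega
    set F := cE μ D' f with hF
    have hF0 : ∀ σ, 0 < F σ := cE_pos hμ hf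
    have hroot : rootEnt μ F x = rootEnt μ f x := by
      unfold rootEnt
      rw [← hT, show cE μ (T.erase x) F = cE μ (T.erase x) f from funext (cE_cE hμ hD'e f)]
    have hTD' : T \ D' = block x (n + 2) := by
      ext w
      rw [Finset.mem_sdiff, hD', Finset.mem_filter, mem_block, hT, mem_subtree]
      constructor
      · rintro ⟨h1, h2⟩
        exact ⟨h1, by by_contra h; exact h2 ⟨h1, by omega⟩⟩
      · rintro ⟨h1, h2⟩
        exact ⟨h1, fun h => by omega⟩
    -- The block stops at relative level `n` and `D'` starts at `n + 2`, so a full level separates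
    -- them.
    have hsep : Sep μ (block x (n + 1)) D' := by
      refine sep_of_nonadjacent fun v hv w hw => ?_
      rw [mem_block] at hv
      rw [hD', Finset.mem_filter] at hw
      refine ⟨fun h => ?_, fun h => ?_, fun h => ?_⟩
      · rw [h] at hv; omega
      · rw [← h, List.length_tail] at hw; omega
      · rw [← h, List.length_tail] at hv; omega
    have hmix := mean_mono hμ fun σ => entropy_mixing (τ := τ) hθ hκ hκ' hδ0 hδ1 hδ hr0 hr n x
      (fun y _ _ k hky hyl => hk y k hky (by omega)) hF0 σ
    rw [← hμdef, hroot, ← hT, mean_const_mul, mean_add, mean_const_mul, mean_const_mul,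
      mean_cE hμ hμ1] at hmix
    have h1 : mean μ (cEnt μ (block x (n + 1)) F) ≤ BC * V := by
      have h2 := mean_mono hμ fun σ => cEnt_cE_le_cE_cEnt hμ hsep hf σ
      rw [mean_cE hμ hμ1] at h2
      exact h2.trans (mean_cEnt_block_le hθ x (by omega) hf)
    have h2 : mean μ (cEnt μ T F) ≤ ∑ v ∈ block x (n + 2), mean μ (rootEnt μ f v) := by
      have h3 := mean_mono hμ fun σ => cEnt_le_sum_rootEnt (τ := τ) hθ0 hf hD'c (T \ D').card T
        (descClosed_subtree x.1) hD'T rfl σ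
      rw [← hμdef, mean_sum, hTD'] at h3
      simpa only [mean_cE hμ hμ1] using h3
    set A := ∑ v ∈ block x (n + 2), mean μ (rootEnt μ f v) with hA
    have hrn : 0 ≤ r ^ n := by positivity
    calc mean μ (rootEnt μ f x) ≤ _ := hmix
      _ ≤ C₁ * (8 * (BC * V) + C₂ * r ^ n * A) := by
        refine mul_le_mul_of_nonneg_left (add_le_add (mul_le_mul_of_nonneg_left h1 (by norm_num))
          ?_) hC₁0
        refine (le_of_eq ?_).trans (mul_le_mul_of_nonneg_left h2 (mul_nonneg hC₂0 hrn))
        rw [hC₂]; ring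
      _ ≤ _ := by
        have : 0 ≤ BC * V := mul_nonneg hBC0 hV0
        linarith
  · have hTB : T = block x (n + 1 + K) := by
      ext w
      rw [hT, mem_subtree, mem_block]
      have := w.length_le
      exact ⟨fun h => ⟨h, by omega⟩, fun h => h.1⟩
    have h1 : mean μ (rootEnt μ f x) ≤ mean μ (cEnt μ T f) :=
      mean_mono hμ fun σ => cEnt_cE_le hμ (Finset.erase_subset _ _) hf σ
    have h2 : mean μ (cEnt μ T f) ≤ BC * V := by
      rw [hTB]
      exact mean_cEnt_block_le hθ x le_rfl hf
    refine (h1.trans h2).trans ?_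
    have h3 : 0 ≤ C₁ * 8 * (BC * V) := by positivity
    have h4 : 0 ≤ C₁ * C₂ * r ^ n * ∑ v ∈ block x (n + 2), mean μ (rootEnt μ f v) :=
      mul_nonneg (by positivity) (Finset.sum_nonneg fun v _ => hroot0 v)
    linarith

/-- Uniform bounds for the spectral gap and the logarithmic Sobolev constant, if the conditional
laws of the spins at all sites at height at least `K` contract by `κ` and
`b * κ * (θ - 1) / (θ + 1) < 1`. -/
theorem exists_le_of_contracts (hb : 1 ≤ b) (hq : 2 ≤ q) (hθ : 1 ≤ θ) (hκ : 0 ≤ κ) (K : ℕ)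
    (hlt : b * κ * ((θ - 1) / (θ + 1)) < 1) :
    ∃ c : ℝ, 0 < c ∧ ∀ (τ : BoundaryCondition b q) (m : ℕ),
      (∀ (y : Site b m) (k : ℕ), k + y.1.length = m → K ≤ k →
        Contracts (kernel θ (msg θ τ k y.1)) κ) →
      c ≤ cGap (field θ τ m) ∧ c ≤ cSob (field θ τ m) := by
  have hθ0 : 0 < θ := one_pos.trans_le hθ
  have hb0 : (0 : ℝ) < b := by exact_mod_cast hb
  set γ := (θ - 1) / (θ + 1) with hγ
  have hγ0 : 0 ≤ γ := div_nonneg (by linarith) (by linarith)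
  have hγ1 : γ < 1 := by rw [hγ, div_lt_one (by linarith)]; linarith
  -- The margin between `κ` and `κ'` pays for linearising `(1 + κ u) ^ b`. The requirement `1 ≤ b *
  -- κ'` is compatible with the bound because `γ < 1`.
  obtain ⟨κ', hκκ', hκ'1, hκ'lt⟩ : ∃ κ', κ < κ' ∧ 1 ≤ b * κ' ∧ b * κ' * γ < 1 := by
    have hmax : b * max κ (1 / b) * γ < 1 := by
      rcases max_cases κ (1 / (b : ℝ)) with ⟨h, -⟩ | ⟨h, -⟩
      · rwa [h]
      · rw [h, mul_one_div_cancel hb0.ne', one_mul]; exact hγ1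
    have hcont : Filter.Tendsto (fun x : ℝ => b * x * γ) (nhdsWithin (max κ (1 / b)) (Set.Ioi (max κ (1 / (b : ℝ)))))
        (nhds (b * max κ (1 / b) * γ)) :=
      (Continuous.tendsto (by fun_prop) _).mono_left nhdsWithin_le_nhds
    obtain ⟨x, hx1, hx2⟩ := ((hcont.eventually_lt_const hmax).and self_mem_nhdsWithin).exists
    rw [max_lt_iff] at hx2
    refine ⟨x, hx2.1, ?_, hx1⟩
    have := hx2.2.le
    rwa [div_le_iff₀ hb0, mul_comm] at this
  obtain ⟨r, hr1, hr2⟩ := exists_between hκ'lt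
  have hr0 : 0 < r := lt_of_le_of_lt (by have := hκ.trans hκκ'.le; positivity) hr1
  -- With `y = b κ u`, the power is at most `exp y ≤ 1 + y + y ^ 2` for `y ≤ 1`; the denominator of
  -- `δ` is large enough for `y ≤ 1` and for `y ^ 2 ≤ b (κ' - κ) u`.
  obtain ⟨δ, hδ0, hδ1, hδ⟩ : ∃ δ : ℝ, 0 < δ ∧ δ ≤ 1 ∧
      ∀ u, 0 ≤ u → u ≤ δ → (1 + κ * u) ^ b ≤ 1 + b * κ' * u := by
    have hden : 0 < b * (κ ^ 2 * b + κ + 1) := by positivity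
    refine ⟨min 1 (min (1 / (b * (κ ^ 2 * b + κ + 1)))
      ((κ' - κ) / (b * (κ ^ 2 * b + κ + 1)))), ?_, min_le_left _ _, fun u hu0 hu => ?_⟩
    · have : 0 < κ' - κ := sub_pos.2 hκκ'
      refine lt_min one_pos (lt_min ?_ ?_) <;> positivity
    · have h1 := hu.trans ((min_le_right _ _).trans (min_le_left _ _))
      have h2 := hu.trans ((min_le_right _ _).trans (min_le_right _ _))
      rw [le_div_iff₀ hden] at h1 h2
      have hb1 : (1 : ℝ) ≤ b := by exact_mod_cast hb
      set y := b * κ * u with hy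
      have hy0 : 0 ≤ y := by positivity
      have hp1 : 0 ≤ u * (b * (κ ^ 2 * b)) := by positivity
      have hp2 : 0 ≤ u * b := by positivity
      have hp3 : 0 ≤ u * (b * κ) := by positivity
      have hy1 : y ≤ 1 := by rw [hy]; nlinarith
      have h3 : (1 + κ * u) ^ b ≤ Real.exp y := by
        have h4 : 1 + κ * u ≤ Real.exp (κ * u) := by
          have := Real.add_one_le_exp (κ * u); linarith
        calc (1 + κ * u) ^ b ≤ Real.exp (κ * u) ^ b := by gcongr
          _ = Real.exp y := by rw [← Real.exp_nat_mul, hy]; ring_nf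
      have h5 := Real.abs_exp_sub_one_sub_id_le (x := y) (by rwa [abs_of_nonneg hy0])
      have h6 := (abs_le.1 h5).2
      have h7 : y ^ 2 ≤ b * (κ' - κ) * u := by
        have h8 : u * (b * κ ^ 2) ≤ κ' - κ := by nlinarith
        calc y ^ 2 = (b * u) * (u * (b * κ ^ 2)) := by rw [hy]; ring
          _ ≤ (b * u) * (κ' - κ) := mul_le_mul_of_nonneg_left h8 (by positivity)
          _ = _ := by ring
      have h8 : b * κ' * u = y + b * (κ' - κ) * u := by rw [hy]; ring
      linarith
  have : Nontrivial (Fin q) := Fin.nontrivial_iff_two_le.2 hq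
  set C₂ := q * (θ ^ (b + 1) * q) * (2 * ((4 + 2 / δ) * (2 * (θ ^ 2 - 1) * (b * κ') + 1))) with hC₂
  -- The factor `n + 2` counts the blocks containing a given site; geometric decay beats it, and the
  -- error becomes at most half of the left-hand side.
  obtain ⟨n, hn⟩ : ∃ n : ℕ, C₂ * r ^ n * (n + 2) ≤ 1 / 2 := by
    have h1 := tendsto_self_mul_const_pow_of_lt_one hr0.le hr2
    have h2 := tendsto_pow_atTop_nhds_zero_of_lt_one hr0.le hr2
    have h3 : Filter.Tendsto (fun n : ℕ => C₂ * (n * r ^ n + 2 * r ^ n)) Filter.atTop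
        (nhds (C₂ * (0 + 2 * 0))) := (h1.add (h2.const_mul 2)).const_mul C₂
    rw [mul_zero, add_zero, mul_zero] at h3
    obtain ⟨n, hn⟩ := (h3.eventually_le_const (show (0 : ℝ) < 1 / 2 by norm_num)).exists
    exact ⟨n, le_trans (le_of_eq (by ring)) hn⟩
  set C₃ := (q * (θ ^ (b + 1) * q) * 8 + 1) *
    blockConst (θ ^ (b + 1) * q) (completeTree b (n + 1 + K)).card with hC₃
  have hC₃0 : 0 ≤ C₃ := by
    rw [hC₃]; unfold blockConst; positivity
  refine ⟨(2 * C₃ * (n + 1 + K : ℕ) + 1)⁻¹, by positivity, fun τ m hk => ?_⟩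
  set μ := field θ τ m with hμdef
  have hμ : ∀ σ, 0 < μ σ := field_pos hθ0
  have hμ1 : ∑ σ, μ σ = 1 := sum_field hθ0
  have : Nonempty (Site b m) := ⟨⟨[], by simp [mem_completeTree]⟩⟩
  refine le_cGap_and_le_cSob hμ hμ1 (by positivity) fun f hf => ?_
  set A : Site b m → ℝ := fun v => mean μ (rootEnt μ f v) with hA
  have hA0 : ∀ v, 0 ≤ A v := fun v => mean_nonneg hμ (cEnt_nonneg hμ (cE_pos hμ hf))
  set V : Site b m → ℝ := fun y => mean μ (siteVariance μ y fun σ => √(f σ)) with hV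
  have hV0 : ∀ v, 0 ≤ V v := fun v => mean_nonneg hμ (siteVariance_nonneg hμ v)
  have hD : dirichletForm μ (fun σ => √(f σ)) = ∑ y, V y := rfl
  have hD0 : 0 ≤ ∑ y, V y := Finset.sum_nonneg fun y _ => hV0 y
  have hEnt : entropy μ f ≤ ∑ v, A v := by
    obtain ⟨σ⟩ : Nonempty (Site b m → Fin q) := inferInstance
    have h1 := cEnt_le_sum_rootEnt (τ := τ) hθ0 hf (D' := ∅)
      (fun v hv => absurd hv (Finset.notMem_empty v)) (Finset.univ \ ∅ : Finset (Site b m)).card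
      Finset.univ (fun _ _ _ _ => Finset.mem_univ _) (Finset.empty_subset _) rfl σ
    rw [← hμdef, cE_empty hμ, Finset.sdiff_empty, cEnt, cE_univ hμ1, cE_univ hμ1] at h1
    refine h1.trans (le_of_eq (Finset.sum_congr rfl fun v _ => ?_))
    rw [cE_univ hμ1]
  have hsum : ∑ x, A x ≤ C₃ * ((n + 1 + K : ℕ) * ∑ y, V y) +
      C₂ * r ^ n * ((n + 2 : ℕ) * ∑ v, A v) := by
    have h1 := Finset.sum_le_sum fun x (_ : x ∈ Finset.univ) =>
      mean_rootEnt_le (τ := τ) hθ hκ hκ'1 hδ0 hδ1 hδ hr0 hr1.le n K hk hf x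
    rw [Finset.sum_add_distrib, ← Finset.mul_sum, ← Finset.mul_sum] at h1
    have hθ2 : 0 ≤ θ ^ 2 - 1 := by nlinarith
    have ha0 : 0 ≤ b * κ' := zero_le_one.trans hκ'1
    refine h1.trans (add_le_add (mul_le_mul_of_nonneg_left (sum_sum_block_le hV0 _) hC₃0)
      (mul_le_mul_of_nonneg_left (sum_sum_block_le hA0 _) ?_))
    positivity
  have hA1 : 0 ≤ ∑ v, A v := Finset.sum_nonneg fun v _ => hA0 v
  have h2 : C₂ * r ^ n * ((n + 2 : ℕ) * ∑ v, A v) ≤ 1 / 2 * ∑ v, A v := by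
    rw [← mul_assoc]
    refine mul_le_mul_of_nonneg_right ?_ hA1
    push_cast
    exact hn
  rw [hD]
  have h3 : ∑ v, A v ≤ 2 * C₃ * (n + 1 + K : ℕ) * ∑ y, V y := by linarith
  linarith

end Assembly

end

end PottsTree

namespace PottsTree

noncomputable section

/-! ### The recursion for the likelihood ratio at the root -/

section Recursion

variable {b q : ℕ} {θ x y : ℝ}

/-- The factor that a child with likelihood ratio `x` contributes to the likelihood ratio at its
parent. -/
def edgeRatio (q : ℕ) (θ x : ℝ) : ℝ := (θ * x + q - 1) / (x + θ + q - 2)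

/-- The likelihood ratio at a site of height `k` under a constant boundary condition. -/
def ratioSeq (b q : ℕ) (θ : ℝ) : ℕ → ℝ
  | 0 => θ ^ b
  | k + 1 => edgeRatio q θ (ratioSeq b q θ k) ^ b

/-- The contraction coefficient of the kernel at a site with likelihood ratio `x`; it is also the
derivative of `log (edgeRatio q θ x)` with respect to `log x`. -/
def ratioContraction (q : ℕ) (θ x : ℝ) : ℝ :=
  x * (θ - 1) * (θ + q - 1) / ((θ * x + q - 1) * (x + θ + q - 2))

theorem one_le_edgeRatio (hq : 2 ≤ q) (hθ : 1 ≤ θ) (hx : 1 ≤ x) : 1 ≤ edgeRatio q θ x := by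
  have hq' : (2 : ℝ) ≤ q := by exact_mod_cast hq
  rw [edgeRatio, one_le_div (by linarith)]
  nlinarith

theorem edgeRatio_lt (hq : 2 ≤ q) (hθ : 1 < θ) (hx : 1 ≤ x) : edgeRatio q θ x < θ := by
  have hq' : (2 : ℝ) ≤ q := by exact_mod_cast hq
  rw [edgeRatio, div_lt_iff₀ (by linarith)]
  nlinarith [mul_nonneg (sub_nonneg.2 hθ.le) (sub_nonneg.2 hq')]

theorem edgeRatio_lt_edgeRatio (hq : 2 ≤ q) (hθ : 1 < θ) (hx : 1 ≤ x) (hxy : x < y) :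
    edgeRatio q θ x < edgeRatio q θ y := by
  have hq' : (2 : ℝ) ≤ q := by exact_mod_cast hq
  rw [edgeRatio, edgeRatio, div_lt_div_iff₀ (by linarith) (by linarith)]
  have : 0 < (y - x) * ((θ - 1) * (θ + q - 1)) :=
    mul_pos (by linarith) (mul_pos (by linarith) (by linarith))
  nlinarith

theorem one_le_ratioSeq (hq : 2 ≤ q) (hθ : 1 ≤ θ) (k : ℕ) : 1 ≤ ratioSeq b q θ k := by
  induction k with
  | zero => exact one_le_pow₀ hθ
  | succ k ih => exact one_le_pow₀ (one_le_edgeRatio hq hθ ih)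

/-- The first step decreases because an edge transmits a ratio less than `θ`; monotonicity of the
recursion propagates this. -/
theorem ratioSeq_strictAnti (hb : 1 ≤ b) (hq : 2 ≤ q) (hθ : 1 < θ) :
    StrictAnti (ratioSeq b q θ) := by
  have hb' : b ≠ 0 := by omega
  refine strictAnti_nat_of_succ_lt fun k => ?_
  induction k with
  | zero =>
    have h1 := one_le_ratioSeq (b := b) hq hθ.le 0
    exact pow_lt_pow_left₀ (edgeRatio_lt hq hθ h1)
      (zero_le_one.trans (one_le_edgeRatio hq hθ.le h1)) hb'
  | succ k ih =>
    have h1 := one_le_ratioSeq (b := b) hq hθ.le (k + 1)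
    exact pow_lt_pow_left₀ (edgeRatio_lt_edgeRatio hq hθ h1 ih)
      (zero_le_one.trans (one_le_edgeRatio hq hθ.le h1)) hb'

theorem ratioContraction_nonneg (hq : 2 ≤ q) (hθ : 1 ≤ θ) (hx : 1 ≤ x) :
    0 ≤ ratioContraction q θ x := by
  have hq' : (2 : ℝ) ≤ q := by exact_mod_cast hq
  have h1 : 1 ≤ θ * x := by nlinarith
  have h2 : 0 ≤ θ - 1 := by linarith
  have h3 : 0 ≤ θ + q - 1 := by linarith
  have h4 : 0 ≤ θ * x + q - 1 := by linarith
  have h5 : 0 ≤ x + θ + q - 2 := by linarith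
  rw [ratioContraction]
  positivity

theorem hasDerivAt_log_edgeRatio (hq : 2 ≤ q) (hθ : 1 ≤ θ) (hx : 1 ≤ x) :
    HasDerivAt (fun y => b * (Real.log (θ * y + q - 1) - Real.log (y + θ + q - 2)) - Real.log y)
      ((b * ratioContraction q θ x - 1) / x) x := by
  have hq' : (2 : ℝ) ≤ q := by exact_mod_cast hq
  have h1 : 1 ≤ θ * x := by nlinarith
  have h4 : 0 < θ * x + q - 1 := by linarith
  have h5 : 0 < x + θ + q - 2 := by linarith
  have h0 : 0 < x := by linarith
  have d1 : HasDerivAt (fun y => θ * y + q - 1) θ x := by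
    simpa using (((hasDerivAt_id x).const_mul θ).add_const (q : ℝ)).sub_const 1
  have d2 : HasDerivAt (fun y => y + θ + q - 2) 1 x := by
    simpa using (((hasDerivAt_id x).add_const θ).add_const (q : ℝ)).sub_const 2
  have d3 := (((d1.log h4.ne').sub (d2.log h5.ne')).const_mul (b : ℝ)).sub
    (Real.hasDerivAt_log h0.ne')
  refine d3.congr_deriv ?_
  rw [ratioContraction]
  field_simp
  ring

/-- The likelihood ratios converge to a fixed point of the recursion, which is stable from
above. -/
theorem exists_tendsto_ratioSeq (hb : 1 ≤ b) (hq : 2 ≤ q) (hθ : 1 ≤ θ) :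
    ∃ R, 1 ≤ R ∧ edgeRatio q θ R ^ b = R ∧
      Filter.Tendsto (ratioSeq b q θ) Filter.atTop (nhds R) ∧ b * ratioContraction q θ R ≤ 1 := by
  have hq' : (2 : ℝ) ≤ q := by exact_mod_cast hq
  -- For `θ = 1` the sequence is constantly `1`; strict decrease, needed for the slopes below, holds
  -- only for `θ > 1`.
  rcases hθ.eq_or_lt with rfl | hθ1
  · have h1 : ratioSeq b q 1 = fun _ => 1 := by
      funext k
      induction k with
      | zero => simp [ratioSeq]
      | succ k ih =>
        rw [ratioSeq, ih, edgeRatio]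
        rw [show (1 * 1 + (q : ℝ) - 1) = q by ring, show (1 + 1 + (q : ℝ) - 2) = q by ring,
          div_self (by linarith), one_pow]
    refine ⟨1, le_rfl, ?_, h1 ▸ tendsto_const_nhds, by simp [ratioContraction]⟩
    rw [edgeRatio, show (1 * 1 + (q : ℝ) - 1) = q by ring, show (1 + 1 + (q : ℝ) - 2) = q by ring,
      div_self (by linarith), one_pow]
  have hanti := ratioSeq_strictAnti hb hq hθ1
  have hbdd : BddBelow (Set.range (ratioSeq b q θ)) :=
    ⟨1, by rintro _ ⟨k, rfl⟩; exact one_le_ratioSeq hq hθ k⟩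
  have hlim := tendsto_atTop_ciInf hanti.antitone hbdd
  set R := ⨅ k, ratioSeq b q θ k with hR
  have hR1 : 1 ≤ R := le_ciInf fun k => one_le_ratioSeq hq hθ k
  have hRlt : ∀ k, R < ratioSeq b q θ k := fun k =>
    (ciInf_le hbdd (k + 1)).trans_lt (hanti k.lt_succ_self)
  have hcont : ContinuousAt (fun x => edgeRatio q θ x ^ b) R := by
    refine ContinuousAt.pow (ContinuousAt.div ?_ ?_ ?_) b
    · exact ((continuousAt_const.mul continuousAt_id).add continuousAt_const).sub continuousAt_const
    · exact ((continuousAt_id.add continuousAt_const).add continuousAt_const).sub continuousAt_const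
    · linarith
  refine ⟨R, hR1, ?_, hlim, ?_⟩
  · exact tendsto_nhds_unique (hcont.tendsto.comp hlim)
      (hlim.comp (Filter.tendsto_add_atTop_nat 1))
  set G : ℝ → ℝ :=
    fun y => b * (Real.log (θ * y + q - 1) - Real.log (y + θ + q - 2)) - Real.log y with hG
  have hGeq : ∀ y, 1 ≤ y → G y = Real.log (edgeRatio q θ y ^ b) - Real.log y := by
    intro y hy
    have h1 : 1 ≤ θ * y := by nlinarith
    rw [hG, Real.log_pow, edgeRatio, Real.log_div (by linarith) (by linarith)]
  have hfix : edgeRatio q θ R ^ b = R := tendsto_nhds_unique (hcont.tendsto.comp hlim)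
      (hlim.comp (Filter.tendsto_add_atTop_nat 1))
  have hGR : G R = 0 := by rw [hGeq R hR1, hfix, sub_self]
  have hd : HasDerivAt G _ R := hasDerivAt_log_edgeRatio (b := b) hq hθ hR1
  have hlim' : Filter.Tendsto (ratioSeq b q θ) Filter.atTop (nhdsWithin R {R}ᶜ) :=
    tendsto_nhdsWithin_iff.2 ⟨hlim, Filter.Eventually.of_forall fun k => (hRlt k).ne'⟩
  -- `G R = 0` and `G ≤ 0` along the sequence, which decreases strictly to `R`. The slopes from the
  -- right are therefore nonpositive, and so is the derivative `(b κ - 1) / R`.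
  have hle := le_of_tendsto' ((hasDerivAt_iff_tendsto_slope.1 hd).comp hlim')
    (b := 0) fun k => by
      have hk := one_le_ratioSeq (b := b) hq hθ k
      rw [Function.comp_apply, slope_def_field, hGR, sub_zero, hGeq _ hk]
      refine div_nonpos_of_nonpos_of_nonneg (sub_nonpos.2 (Real.log_le_log ?_ ?_))
        (sub_nonneg.2 (hRlt k).le)
      · exact zero_lt_one.trans_le (one_le_ratioSeq (b := b) hq hθ (k + 1))
      · exact (hanti k.lt_succ_self).le
  have h0 : 0 < R := by linarith
  rw [div_le_iff₀ h0, zero_mul] at hle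
  linarith

end Recursion

/-! ### Contraction of the kernels -/

section Boundary

variable {b q : ℕ} {θ R M : ℝ} {h : Fin q → ℝ} {τ : BoundaryCondition b q}

theorem sum_single_eq (s : Fin q) (R : ℝ) : ∑ t, (if t = s then R else 1) = R + q - 1 := by
  have : ∀ t : Fin q, (if t = s then R else 1) = (if t = s then R - 1 else 0) + 1 := by
    intro t; split_ifs <;> ring
  simp_rw [this, Finset.sum_add_distrib]
  simp
  ring

/-- The favoured spin `s` together with any other spin is the extremal pair, and gives equality; two
ordinary spins differ by less. -/
theorem contracts_kernel_of_single (hq : 2 ≤ q) (hθ : 1 ≤ θ) (hR : 1 ≤ R) (s : Fin q) :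
    Contracts (kernel θ fun t => if t = s then R else 1) (ratioContraction q θ R) := by
  have hq' : (2 : ℝ) ≤ q := by exact_mod_cast hq
  have hθR : 1 ≤ θ * R := by nlinarith
  have h4 : 0 < θ * R + q - 1 := by linarith
  have h5 : 0 < R + θ + q - 2 := by linarith
  refine contracts_of_diag hθ (fun t => by split_ifs <;> linarith) fun a a' haa => ?_
  rcases eq_or_ne a' a with rfl | hne
  · rw [sub_self]
    exact ratioContraction_nonneg hq hθ hR
  rw [kernel_self, kernel_of_ne hne, sum_single_eq, ratioContraction]
  by_cases has : a = s
  · have ha's : a' ≠ s := fun h => hne (h.trans has.symm)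
    rw [if_pos has, if_neg ha's, show (θ - 1) * R + (R + q - 1) = θ * R + q - 1 by ring,
      show (θ - 1) * 1 + (R + q - 1) = R + θ + q - 2 by ring, div_sub_div _ _ h4.ne' h5.ne']
    refine le_of_eq ?_
    congr 1
    ring
  · rw [if_neg has]
    rw [if_neg has] at haa
    have hR' : (θ - 1) * (if a' = s then R else 1) = θ - 1 := by
      split_ifs at haa ⊢ with h
      · rw [le_antisymm haa hR, mul_one]
      · rw [mul_one]
    rw [hR', show (θ - 1) * 1 + (R + q - 1) = R + θ + q - 2 by ring,
      show θ - 1 + (R + q - 1) = R + θ + q - 2 by ring, ← sub_div,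
      div_le_div_iff₀ h5 (mul_pos h4 h5)]
    have : 0 ≤ (θ - 1) * (R - 1) * (q - 1) :=
      mul_nonneg (mul_nonneg (by linarith) (by linarith)) (by linarith)
    nlinarith

theorem exists_msg_const (hq : 2 ≤ q) (hθ : 1 ≤ θ) (s : Fin q) (k : ℕ) :
    ∃ c : ℝ, c ≠ 0 ∧ ∀ v, msg (b := b) θ (fun _ => some s) k v =
      fun t => c * if t = s then ratioSeq b q θ k else 1 := by
  induction k with
  | zero =>
    refine ⟨1, one_ne_zero, fun v => funext fun t => ?_⟩
    simp only [msg, Option.some.injEq, Finset.prod_const, Finset.card_univ, Fintype.card_fin,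
      ratioSeq, one_mul, eq_comm (a := s)]
    split_ifs <;> simp
  | succ k ih =>
    obtain ⟨c, hc, h⟩ := ih
    have hq' : (2 : ℝ) ≤ q := by exact_mod_cast hq
    have hx1 := one_le_ratioSeq (b := b) hq hθ k
    set x := ratioSeq b q θ k with hx
    have hd : x + θ + q - 2 ≠ 0 := by linarith
    refine ⟨(c * (x + θ + q - 2)) ^ b, pow_ne_zero _ (mul_ne_zero hc hd),
      fun v => funext fun t => ?_⟩
    simp only [msg, h, sum_pairWeight_mul, ← Finset.mul_sum, sum_single_eq, Finset.prod_const,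
      Finset.card_univ, Fintype.card_fin, ratioSeq, ← hx]
    split_ifs
    · rw [← mul_pow, edgeRatio]
      congr 1
      field_simp
      ring
    · rw [mul_one]
      ring

theorem contracts_msg_const (hq : 2 ≤ q) (hθ : 1 ≤ θ) (s : Fin q) (k : ℕ) (v : Vertex b) :
    Contracts (kernel θ (msg (b := b) θ (fun _ => some s) k v))
      (ratioContraction q θ (ratioSeq b q θ k)) := by
  obtain ⟨c, hc, h⟩ := exists_msg_const (b := b) hq hθ s k
  have : kernel θ (msg (b := b) θ (fun _ => some s) k v) =
      kernel θ fun t => if t = s then ratioSeq b q θ k else 1 := by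
    funext a t
    rw [h v, kernel_const_mul hc]
  rw [this]
  exact contracts_kernel_of_single hq hθ (one_le_ratioSeq hq hθ k) s

theorem exists_msg_free (hθ : 0 < θ) (hq : 0 < q) (k : ℕ) :
    ∃ c : ℝ, c ≠ 0 ∧ ∀ v : Vertex b, msg (q := q) θ (fun _ => none) k v = fun _ => c * 1 := by
  induction k with
  | zero => exact ⟨1, one_ne_zero, fun v => funext fun t => by simp [msg]⟩
  | succ k ih =>
    obtain ⟨c, hc, h⟩ := ih
    have hq' : (1 : ℝ) ≤ q := by exact_mod_cast hq
    refine ⟨((θ - 1 + q) * c) ^ b, pow_ne_zero _ (mul_ne_zero (by linarith) hc),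
      fun v => funext fun t => ?_⟩
    simp only [msg, h, sum_pairWeight_mul]
    simp
    ring

theorem contracts_msg_free (hq : 2 ≤ q) (hθ : 1 ≤ θ) (k : ℕ) (v : Vertex b) :
    Contracts (kernel θ (msg (q := q) θ (fun _ => none) k v)) ((θ - 1) / (θ + q - 1)) := by
  have hq' : (2 : ℝ) ≤ q := by exact_mod_cast hq
  obtain ⟨c, hc, h⟩ := exists_msg_free (b := b) (q := q) (one_pos.trans_le hθ) (by omega) k
  have e : kernel θ (msg (q := q) θ (fun _ => none) k v) = kernel θ fun _ => 1 := by
    funext a t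
    rw [h v, kernel_const_mul hc]
  rw [e]
  refine contracts_of_diag hθ (fun _ => one_pos) fun a a' _ => ?_
  rcases eq_or_ne a' a with rfl | hne
  · rw [sub_self]
    exact div_nonneg (by linarith) (by linarith)
  rw [kernel_self, kernel_of_ne hne, ← sub_div]
  refine le_of_eq ?_
  simp
  ring

/-- The worst field has weight `M` at `s` and equal weights `1` elsewhere, so the sum is bounded
below by giving the `q - 2` other spins their least weight `h s / M`. -/
theorem sum_pairWeight_mul_le (hq : 2 ≤ q) (hθ : 1 ≤ θ) (hM : 1 ≤ M) (hh : ∀ s, 0 < h s)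
    (hr : ∀ s s', h s ≤ M * h s') (s s' : Fin q) :
    ∑ t, pairWeight θ s t * h t ≤ edgeRatio q θ M * ∑ t, pairWeight θ s' t * h t := by
  have hq' : (2 : ℝ) ≤ q := by exact_mod_cast hq
  rcases eq_or_ne s s' with rfl | hne
  · exact le_mul_of_one_le_left (sum_pairWeight_mul_pos (by linarith) hh s).le
      (one_le_edgeRatio hq hθ hM)
  have hM0 : 0 < M := by linarith
  rw [sum_pairWeight_mul, sum_pairWeight_mul, edgeRatio, div_mul_eq_mul_div,
    le_div_iff₀ (by linarith)]
  set H := ∑ t, h t with hH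
  have hHge : h s + h s' + (q - 2) * (h s / M) ≤ H := by
    rw [hH, ← Finset.add_sum_erase _ _ (Finset.mem_univ s),
      ← Finset.add_sum_erase _ _ (Finset.mem_erase.2 ⟨hne.symm, Finset.mem_univ s'⟩), ← add_assoc]
    refine add_le_add_right ?_ _
    have := Finset.card_nsmul_le_sum ((Finset.univ.erase s).erase s') h (h s / M)
      fun t _ => (div_le_iff₀ hM0).2 (by rw [mul_comm]; exact hr s t)
    rw [Finset.card_erase_of_mem (Finset.mem_erase.2 ⟨hne.symm, Finset.mem_univ s'⟩),
      Finset.card_erase_of_mem (Finset.mem_univ s), Finset.card_univ, Fintype.card_fin,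
      nsmul_eq_mul, Nat.sub_sub, Nat.cast_sub hq] at this
    simpa using this
  set z := h s / M with hz
  have hzs : h s = z * M := by rw [hz]; field_simp
  have hzr : z ≤ h s' := (div_le_iff₀ hM0).2 (by rw [mul_comm]; exact hr s s')
  have key : h s * (M + θ + q - 2) ≤ h s' * (θ * M + q - 1) + H * (M - 1) := by
    have h1 := mul_le_mul_of_nonneg_right hHge (sub_nonneg.2 hM)
    have h2 : z * (θ * M + q - 1 + (M - 1)) ≤ h s' * (θ * M + q - 1 + (M - 1)) :=
      mul_le_mul_of_nonneg_right hzr (by nlinarith)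
    rw [hzs] at h1 ⊢
    nlinarith
  nlinarith [mul_le_mul_of_nonneg_left key (sub_nonneg.2 hθ)]

/-- The constant boundary is extremal: its likelihood ratios dominate those of every boundary
condition, by induction on the height. -/
theorem msg_ratio_le (hq : 2 ≤ q) (hθ : 1 ≤ θ) (k : ℕ) (v : Vertex b) (s s' : Fin q) :
    msg θ τ k v s ≤ ratioSeq b q θ k * msg θ τ k v s' := by
  have hθ0 : 0 < θ := by linarith
  induction k generalizing v s s' with
  | zero =>
    have : ratioSeq b q θ 0 = ∏ _i : Fin b, θ := by simp [ratioSeq]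
    rw [msg, msg, this, ← Finset.prod_mul_distrib]
    refine Finset.prod_le_prod (fun i _ => by split_ifs <;> linarith) fun i _ => ?_
    split_ifs <;> nlinarith
  | succ k ih =>
    have : ratioSeq b q θ (k + 1) = ∏ _i : Fin b, edgeRatio q θ (ratioSeq b q θ k) := by
      simp [ratioSeq]
    rw [msg, msg, this, ← Finset.prod_mul_distrib]
    exact Finset.prod_le_prod
      (fun i _ => (sum_pairWeight_mul_pos hθ0 (fun t => msg_pos hθ0 k _ t) s).le)
      fun i _ => sum_pairWeight_mul_le hq hθ (one_le_ratioSeq hq hθ k)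
        (fun t => msg_pos hθ0 k _ t) (ih _) s s'

/-- The two diagonal entries are bounded separately. This is wasteful for large `M`, but at `M = 1`
it is exact, and only the limit `M → 1` is used. -/
theorem contracts_kernel_of_ratio (hq : 2 ≤ q) (hθ : 1 ≤ θ) (hM : 1 ≤ M) (hh : ∀ s, 0 < h s)
    (hr : ∀ s s', h s ≤ M * h s') :
    Contracts (kernel θ h) (θ * M / (θ * M + q - 1) - 1 / (1 + M * (θ + q - 2))) := by
  have hq' : (2 : ℝ) ≤ q := by exact_mod_cast hq
  have hM0 : 0 < M := by linarith
  have hθM : 1 ≤ θ * M := by nlinarith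
  have hd1 : 0 < θ * M + q - 1 := by linarith
  have hd2 : 0 < 1 + M * (θ + q - 2) := by nlinarith
  refine contracts_of_diag hθ hh fun a a' haa => ?_
  rcases eq_or_ne a' a with rfl | hne
  · rw [sub_self, sub_nonneg, div_le_div_iff₀ hd2 hd1]
    nlinarith [mul_le_mul_of_nonneg_left hθM (mul_nonneg hM0.le (show 0 ≤ θ + q - 2 by linarith))]
  rw [kernel_self, kernel_of_ne hne, ← Finset.add_sum_erase _ _ (Finset.mem_univ a)]
  set X := ∑ t ∈ Finset.univ.erase a, h t with hX
  have hcard : (((Finset.univ : Finset (Fin q)).erase a).card : ℝ) = q - 1 := by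
    rw [Finset.card_erase_of_mem (Finset.mem_univ a), Finset.card_univ, Fintype.card_fin,
      Nat.cast_sub (by omega), Nat.cast_one]
  have ha := hh a
  have hX1 : (q - 1) * (h a / M) ≤ X := by
    have := Finset.card_nsmul_le_sum (Finset.univ.erase a) h (h a / M)
      fun t _ => (div_le_iff₀ hM0).2 (by rw [mul_comm]; exact hr a t)
    rwa [nsmul_eq_mul, hcard] at this
  have hX2 : X ≤ (q - 1) * (M * h a) := by
    have := Finset.sum_le_card_nsmul (Finset.univ.erase a) h (M * h a) fun t _ => hr t a
    rwa [nsmul_eq_mul, hcard] at this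
  have hX0 : 0 < X := lt_of_lt_of_le (mul_pos (by linarith) (div_pos ha hM0)) hX1
  rw [← mul_div_assoc, div_le_iff₀ hM0] at hX1
  refine sub_le_sub ?_ ?_
  · rw [div_le_div_iff₀ (by nlinarith) hd1]
    nlinarith [mul_le_mul_of_nonneg_left hX1 (show 0 ≤ θ by linarith)]
  · rw [div_le_div_iff₀ hd2 (by nlinarith [hh a'])]
    nlinarith [mul_le_mul_of_nonneg_left (hr a' a) (sub_nonneg.2 hθ)]

end Boundary

/-! ### Uniform bounds -/

section Bounds

variable {b q : ℕ} {θ L : ℝ}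

/-- A rate slightly above the limit still satisfies the strict condition and is valid at all sites
of sufficient height. -/
theorem exists_le_of_tendsto (hb : 1 ≤ b) (hq : 2 ≤ q) (hθ : 1 ≤ θ) {f : ℕ → ℝ} (hL : 0 ≤ L)
    (hf : Filter.Tendsto f Filter.atTop (nhds L)) (hlt : b * L * ((θ - 1) / (θ + 1)) < 1) :
    ∃ c : ℝ, 0 < c ∧ ∀ τ : BoundaryCondition b q,
      (∀ k v, Contracts (kernel θ (msg θ τ k v)) (f k)) →
        ∀ m, c ≤ cGap (field θ τ m) ∧ c ≤ cSob (field θ τ m) := by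
  have hcont : Filter.Tendsto (fun x : ℝ => b * x * ((θ - 1) / (θ + 1)))
      (nhdsWithin L (Set.Ioi L)) (nhds (b * L * ((θ - 1) / (θ + 1)))) :=
    (Continuous.tendsto (by fun_prop) _).mono_left nhdsWithin_le_nhds
  obtain ⟨κ, hκ1, hκ2⟩ := ((hcont.eventually_lt_const hlt).and self_mem_nhdsWithin).exists
  have hκ2 : L < κ := hκ2
  obtain ⟨K, hK⟩ := Filter.eventually_atTop.1 (hf.eventually_le_const hκ2)
  obtain ⟨c, hc, h⟩ := exists_le_of_contracts hb hq hθ (hL.trans hκ2.le) K hκ1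
  refine ⟨c, hc, fun τ hτ m => h τ m fun y k _ hk a a' F lo hi hlo hhi => ?_⟩
  exact (hτ k y.1 a a' F lo hi hlo hhi).trans (mul_le_mul_of_nonneg_right (hK k hk)
    (sub_nonneg.2 ((hlo a).trans (hhi a))))

theorem sub_div_add_lt_one (hθ : 1 ≤ θ) : (θ - 1) / (θ + 1) < 1 := by
  rw [div_lt_one (by linarith)]; linarith

theorem sub_div_add_nonneg (hθ : 1 ≤ θ) : 0 ≤ (θ - 1) / (θ + 1) :=
  div_nonneg (by linarith) (by linarith)

theorem continuousAt_ratioContraction (hq : 2 ≤ q) (hθ : 1 ≤ θ) {R : ℝ} (hR : 1 ≤ R) :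
    ContinuousAt (ratioContraction q θ) R := by
  have hq' : (2 : ℝ) ≤ q := by exact_mod_cast hq
  have hθR : 1 ≤ θ * R := by nlinarith
  unfold ratioContraction
  refine ContinuousAt.div (by fun_prop) (by fun_prop) (mul_ne_zero ?_ ?_) <;> linarith

theorem exists_le_const (hb : 1 ≤ b) (hq : 2 ≤ q) (hθ : 1 ≤ θ) :
    ∃ c : ℝ, 0 < c ∧ ∀ (s : Fin q) (m : ℕ),
      c ≤ cGap (field (b := b) θ (fun _ => some s) m) ∧
        c ≤ cSob (field (b := b) θ (fun _ => some s) m) := by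
  obtain ⟨R, hR, -, hlim, hle⟩ := exists_tendsto_ratioSeq hb hq hθ
  obtain ⟨c, hc, h⟩ := exists_le_of_tendsto hb hq hθ (ratioContraction_nonneg hq hθ hR)
    ((continuousAt_ratioContraction hq hθ hR).tendsto.comp hlim)
    ((mul_le_of_le_one_left (sub_div_add_nonneg hθ) hle).trans_lt (sub_div_add_lt_one hθ))
  exact ⟨c, hc, fun s => h _ fun k v => contracts_msg_const hq hθ s k v⟩

theorem exists_le_free (hb : 1 ≤ b) (hq : 2 ≤ q) (hθ : 1 ≤ θ)
    (hlt : (θ - 1) / (θ + q - 1) * ((θ - 1) / (θ + 1)) < 1 / b) :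
    ∃ c : ℝ, 0 < c ∧ ∀ m : ℕ, c ≤ cGap (field (b := b) (q := q) θ (fun _ => none) m) ∧
      c ≤ cSob (field (b := b) (q := q) θ (fun _ => none) m) := by
  have hq' : (2 : ℝ) ≤ q := by exact_mod_cast hq
  have hb0 : (0 : ℝ) < b := by exact_mod_cast hb
  rw [lt_div_iff₀ hb0] at hlt
  obtain ⟨c, hc, h⟩ := exists_le_of_tendsto (b := b) (θ := θ) (f := fun _ => (θ - 1) / (θ + q - 1))
    hb hq hθ (div_nonneg (by linarith) (by linarith)) tendsto_const_nhds (by linarith)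
  exact ⟨c, hc, h _ fun k v => contracts_msg_free hq hθ k v⟩

theorem exists_le_of_sq_lt (hb : 1 ≤ b) (hq : 2 ≤ q) (hθ : 1 ≤ θ)
    (hlt : b * ((θ - 1) / (θ + 1)) ^ 2 < 1) :
    ∃ c : ℝ, 0 < c ∧ ∀ (τ : BoundaryCondition b q) (m : ℕ),
      c ≤ cGap (field θ τ m) ∧ c ≤ cSob (field θ τ m) := by
  obtain ⟨c, hc, h⟩ := exists_le_of_tendsto (b := b) (θ := θ) (f := fun _ => (θ - 1) / (θ + 1))
    hb hq hθ (sub_div_add_nonneg hθ) tendsto_const_nhds (by rwa [mul_assoc, ← sq])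
  exact ⟨c, hc, fun τ => h τ fun k v =>
    contracts_kernel hθ fun s => msg_pos (one_pos.trans_le hθ) k v s⟩

/-- Uniform bounds for arbitrary boundary conditions, if the recursion for the likelihood ratio
has only the trivial fixed point. -/
theorem exists_le_of_fixedPoint (hb : 1 ≤ b) (hq : 2 ≤ q) (hθ : 1 ≤ θ)
    (hfix : ∀ R, 1 ≤ R → edgeRatio q θ R ^ b = R → R = 1) :
    ∃ c : ℝ, 0 < c ∧ ∀ (τ : BoundaryCondition b q) (m : ℕ),
      c ≤ cGap (field θ τ m) ∧ c ≤ cSob (field θ τ m) := by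
  have hq' : (2 : ℝ) ≤ q := by exact_mod_cast hq
  obtain ⟨R, hR, hRfix, hlim, hle⟩ := exists_tendsto_ratioSeq hb hq hθ
  -- The limit of the extremal ratios is `1`, so every message flattens and the rate tends to that
  -- of a flat field.
  obtain rfl := hfix R hR hRfix
  set f : ℝ → ℝ := fun M => θ * M / (θ * M + q - 1) - 1 / (1 + M * (θ + q - 2)) with hf
  have hf1 : f 1 = ratioContraction q θ 1 := by
    have : θ + q - 1 ≠ 0 := by linarith
    rw [hf, ratioContraction]
    dsimp only
    rw [show 1 + 1 * (θ + q - 2) = θ + q - 1 by ring, show θ * 1 + q - 1 = θ + q - 1 by ring,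
      show 1 + θ + q - 2 = θ + q - 1 by ring]
    field_simp
  have hcont : ContinuousAt f 1 := by
    refine ContinuousAt.sub (ContinuousAt.div (by fun_prop) (by fun_prop) ?_)
      (ContinuousAt.div (by fun_prop) (by fun_prop) ?_) <;> linarith
  obtain ⟨c, hc, h⟩ := exists_le_of_tendsto (b := b) hb hq hθ
    (ratioContraction_nonneg hq hθ le_rfl) (hf1 ▸ hcont.tendsto.comp hlim)
    ((mul_le_of_le_one_left (sub_div_add_nonneg hθ) hle).trans_lt (sub_div_add_lt_one hθ))
  exact ⟨c, hc, fun τ => h τ fun k v =>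
    contracts_kernel_of_ratio hq hθ (one_le_ratioSeq hq hθ k)
      (fun s => msg_pos (one_pos.trans_le hθ) k v s) (msg_ratio_le hq hθ k v)⟩

end Bounds

end

end PottsTree

namespace PottsTree

noncomputable section

open MeasureTheory

/-! ### Measures on configurations of the infinite tree -/

section Measures

variable {b q : ℕ}

/-- The configurations that coincide with `ζ` on the complete tree of depth `n`. -/
def treeAtom (n : ℕ) (ζ : Vertex b → Fin q) : Set (Vertex b → Fin q) :=
  {σ | ∀ v ∈ completeTree b n, σ v = ζ v}

theorem measurableSet_forall_mem (A : Finset (Vertex b)) (ζ : Vertex b → Fin q) :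
    MeasurableSet {σ : Vertex b → Fin q | ∀ v ∈ A, σ v = ζ v} := by
  have : {σ : Vertex b → Fin q | ∀ v ∈ A, σ v = ζ v} = ⋂ v ∈ A, (fun σ => σ v) ⁻¹' {ζ v} := by
    ext σ; simp
  rw [this]
  exact Finset.measurableSet_biInter A fun v _ => measurable_pi_apply v (measurableSet_singleton _)

theorem measurableSet_treeAtom (n : ℕ) (ζ : Vertex b → Fin q) :
    MeasurableSet (treeAtom n ζ) := measurableSet_forall_mem _ _

theorem nil_mem_completeTree (n : ℕ) : ([] : Vertex b) ∈ completeTree b n := by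
  simp [mem_completeTree]

theorem tail_mem_completeTree {n : ℕ} {w : Vertex b} (hw : w ∈ completeTree b n) :
    w.tail ∈ completeTree b n := by
  rw [mem_completeTree] at *
  rw [List.length_tail]
  omega

/-- A finite measure is determined by the probabilities of the configurations on large complete
trees. -/
theorem measure_eq_of_treeAtom {P Q : Measure (Vertex b → Fin q)} [IsFiniteMeasure P] (N : ℕ)
    (h : ∀ M, N ≤ M → ∀ ζ, Q (treeAtom M ζ) = P (treeAtom M ζ)) : Q = P := by
  have key : ∀ I : Finset (Vertex b), Q.map I.restrict = P.map I.restrict := by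
    intro I
    set M := max N (I.sup List.length) with hM
    have hIM : I ⊆ completeTree b M := fun v hv =>
      mem_completeTree.2 ((Finset.le_sup hv).trans (le_max_right _ _))
    have h1 : Q.map (completeTree b M).restrict = P.map (completeTree b M).restrict := by
      refine Measure.ext_of_singleton fun a => ?_
      rw [Measure.map_apply (Finset.measurable_restrict _) (measurableSet_singleton a),
        Measure.map_apply (Finset.measurable_restrict _) (measurableSet_singleton a)]
      have : Finset.restrict (π := fun _ => Fin q) (completeTree b M) ⁻¹' {a} = treeAtom M
          (fun v => if hv : v ∈ completeTree b M then a ⟨v, hv⟩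
            else a ⟨[], nil_mem_completeTree M⟩) := by
        ext σ
        simp only [Set.mem_preimage, Set.mem_singleton_iff, treeAtom, Set.mem_ofPred_eq]
        constructor
        · rintro rfl v hv
          rw [dif_pos hv]
          rfl
        · intro hσ
          funext v
          have := hσ v.1 v.2
          rw [dif_pos v.2] at this
          exact this
      rw [this]
      exact h M (le_max_left _ _) _
    have h2 : I.restrict (π := fun _ => Fin q) = Finset.restrict₂ (π := fun _ => Fin q) hIM ∘
        (completeTree b M).restrict := rfl
    rw [h2, ← Measure.map_map (Finset.measurable_restrict₂ _) (Finset.measurable_restrict _), h1,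
      Measure.map_map (Finset.measurable_restrict₂ _) (Finset.measurable_restrict _)]
  have : ∀ I : Finset (Vertex b), IsFiniteMeasure (P.map I.restrict) := fun I => inferInstance
  exact IsProjectiveLimit.unique (P := fun I => P.map I.restrict) key fun I => rfl

/-- The probability measure on a finite set with given weights. -/
def finiteLaw (p : Fin q → ℝ) : Measure (Fin q) := ∑ t, ENNReal.ofReal (p t) • Measure.dirac t

theorem finiteLaw_singleton (p : Fin q → ℝ) (t : Fin q) :
    finiteLaw p {t} = ENNReal.ofReal (p t) := by
  rw [finiteLaw, Measure.finsetSum_apply, Finset.sum_eq_single t]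
  · simp
  · intro s _ hs
    simp [hs]
  · simp

theorem isProbabilityMeasure_finiteLaw {p : Fin q → ℝ} (h0 : ∀ t, 0 ≤ p t) (h1 : ∑ t, p t = 1) :
    IsProbabilityMeasure (finiteLaw p) := by
  constructor
  rw [finiteLaw, Measure.finsetSum_apply]
  simp [← ENNReal.ofReal_sum_of_nonneg fun t _ => h0 t, h1]

/-- The configuration with the spin `ω ([], s)` at the root whose spin at a vertex `v` below a
vertex with spin `p` is `ω (v, p)`. -/
def chainSpin (s : Fin q) (ω : Vertex b × Fin q → Fin q) : Vertex b → Fin q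
  | [] => ω ([], s)
  | i :: v => ω (i :: v, chainSpin s ω v)

theorem measurable_chainSpin (s : Fin q) : Measurable (chainSpin (b := b) s) := by
  refine measurable_pi_lambda _ fun v => ?_
  induction v with
  | nil => exact measurable_pi_apply _
  | cons i v ih =>
    have : (fun ω : Vertex b × Fin q → Fin q => chainSpin s ω (i :: v)) =
        fun ω => (fun x : Fin q × (Fin q → Fin q) => x.2 x.1)
          (chainSpin s ω v, fun p => ω (i :: v, p)) := rfl
    rw [this]
    have hm : Measurable fun x : Fin q × (Fin q → Fin q) => x.2 x.1 := measurable_of_countable _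
    exact hm.comp
      (ih.prodMk (measurable_pi_lambda _ fun p => measurable_pi_apply _))

/-- Existence of tree-indexed Markov chains. -/
theorem exists_treeChain {p : Fin q → ℝ} {k : Fin q → Fin q → ℝ} (s : Fin q) (hp0 : ∀ t, 0 ≤ p t)
    (hp1 : ∑ t, p t = 1) (hk0 : ∀ a t, 0 ≤ k a t) (hk1 : ∀ a, ∑ t, k a t = 1) :
    ∃ P : Measure (Vertex b → Fin q), IsProbabilityMeasure P ∧ ∀ n ζ,
      P (treeAtom n ζ) = ENNReal.ofReal
        (p (ζ []) * ∏ w ∈ (completeTree b n).erase [], k (ζ w.tail) (ζ w)) := by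
  set law : Vertex b × Fin q → Measure (Fin q) :=
    fun x => if x.1 = [] then finiteLaw p else finiteLaw (k x.2) with hlaw
  have hprob : ∀ x, IsProbabilityMeasure (law x) := fun x => by
    rw [hlaw]
    dsimp only
    split_ifs
    exacts [isProbabilityMeasure_finiteLaw hp0 hp1,
      isProbabilityMeasure_finiteLaw (hk0 _) (hk1 _)]
  refine ⟨(Measure.infinitePi law).map (chainSpin s),
    Measure.isProbabilityMeasure_map (measurable_chainSpin s).aemeasurable, fun n ζ => ?_⟩
  -- The root has no parent; the dummy spin `s` takes its place.
  set par : Vertex b → Fin q := fun v => if v = [] then s else ζ v.tail with hpar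
  -- Once the spins of `ζ` are prescribed, each site reads a single independent coordinate, the one
  -- labelled by the spin of its parent. The event is therefore a cylinder, and its probability a
  -- product.
  have hset : chainSpin s ⁻¹' treeAtom n ζ =
      Set.pi ↑((completeTree b n).image fun v => (v, par v)) fun x => {ζ x.1} := by
    ext ω
    simp only [Set.mem_preimage, treeAtom, Set.mem_ofPred_eq, Set.mem_pi, Finset.coe_image,
      Set.forall_mem_image, Finset.mem_coe, Set.mem_singleton_iff]
    constructor
    · intro h v hv
      rw [← h v hv]
      cases v with
      | nil => simp [hpar, chainSpin]
      | cons i v =>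
        rw [chainSpin, h v (tail_mem_completeTree hv)]
        simp [hpar]
    · intro h v
      induction v with
      | nil =>
        intro hv
        rw [← h hv]
        simp [hpar, chainSpin]
      | cons i v ih =>
        intro hv
        rw [← h hv, chainSpin, ih (tail_mem_completeTree hv)]
        simp [hpar]
  rw [Measure.map_apply (measurable_chainSpin s) (measurableSet_treeAtom n ζ), hset,
    Measure.infinitePi_pi _ fun _ _ => measurableSet_singleton _,
    Finset.prod_image fun v _ w _ h => (Prod.ext_iff.1 h).1,
    ← Finset.mul_prod_erase _ _ (nil_mem_completeTree n), ENNReal.ofReal_mul (hp0 _),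
    ENNReal.ofReal_prod_of_nonneg fun w _ => hk0 _ _]
  congr 1
  · simp [hlaw, finiteLaw_singleton]
  · refine Finset.prod_congr rfl fun w hw => ?_
    have hw' := Finset.ne_of_mem_erase hw
    simp [hlaw, hw', hpar, finiteLaw_singleton]

end Measures

/-! ### The Dobrushin–Lanford–Ruelle equations -/

section DLR

variable {b q : ℕ} {β : ℝ}

/-- The vertices at distance `n` from the root. -/
def level (b : ℕ) : ℕ → Finset (Vertex b)
  | 0 => {[]}
  | n + 1 => (level b n).biUnion fun v => Finset.univ.image fun i => i :: v

theorem mem_level {n : ℕ} {v : Vertex b} : v ∈ level b n ↔ v.length = n := by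
  induction n generalizing v with
  | zero => simp [level]
  | succ n ih =>
    cases v with
    | nil => simp [level]
    | cons i v => simp [level, ih]

theorem prod_level_succ (n : ℕ) (f : Vertex b → ℝ) :
    ∏ w ∈ level b (n + 1), f w = ∏ v ∈ level b n, ∏ i, f (i :: v) := by
  rw [level, Finset.prod_biUnion]
  · exact Finset.prod_congr rfl fun v _ => Finset.prod_image (by intro i _ j _ h; simpa using h)
  · intro v _ w _ hvw
    refine Finset.disjoint_left.2 fun x hx hx' => hvw ?_
    simp only [Finset.mem_image, Finset.mem_univ, true_and] at hx hx'
    obtain ⟨i, rfl⟩ := hx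
    obtain ⟨j, hj⟩ := hx'
    exact (List.cons.inj hj).2.symm

theorem prod_completeTree_succ (n : ℕ) (f : Vertex b → ℝ) :
    ∏ w ∈ (completeTree b (n + 1)).erase [], f w =
      (∏ w ∈ (completeTree b n).erase [], f w) * ∏ v ∈ level b n, ∏ i, f (i :: v) := by
  rw [← prod_level_succ, ← Finset.prod_union]
  · refine Finset.prod_congr ?_ fun _ _ => rfl
    ext w
    simp only [Finset.mem_erase, Finset.mem_union, mem_completeTree, mem_level]
    constructor
    · rintro ⟨h1, h2⟩
      by_cases h : w.length = n + 1
      · exact Or.inr h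
      · exact Or.inl ⟨h1, by omega⟩
    · rintro (⟨h1, h2⟩ | h)
      · exact ⟨h1, by omega⟩
      · exact ⟨fun h' => by simp [h'] at h, h.le⟩
  · refine Finset.disjoint_left.2 fun w hw hw' => ?_
    rw [Finset.mem_erase, mem_completeTree] at hw
    rw [mem_level] at hw'
    omega

/-- The weight of a configuration on the complete tree of depth `n`, with prior weights `h` at the
leaves. -/
def leafWeight (θ : ℝ) (h : Fin q → ℝ) (n : ℕ) (ζ : Vertex b → Fin q) : ℝ :=
  (∏ w ∈ (completeTree b n).erase [], pairWeight θ (ζ w.tail) (ζ w)) * ∏ v ∈ level b n, h (ζ v)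

/-- The normalisers of the `b` kernels leaving `v` multiply to `C * h (ζ v)` by the fixed-point
equation, which cancels the prior weight at `v`. The prior thus moves down one level in each step,
leaving only edge factors above it. -/
theorem exists_prod_kernel_eq {θ C Z : ℝ} {h : Fin q → ℝ} (hh : ∀ s, 0 < h s)
    (hC : 0 < C) (hZ : 0 < Z) (hfix : ∀ a, (∑ t, pairWeight θ a t * h t) ^ b = C * h a) (n : ℕ) :
    ∃ c : ℝ, 0 < c ∧ ∀ ζ : Vertex b → Fin q,
      h (ζ []) / Z * ∏ w ∈ (completeTree b n).erase [], kernel θ h (ζ w.tail) (ζ w) =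
        c * leafWeight θ h n ζ := by
  induction n with
  | zero =>
    refine ⟨1 / Z, by positivity, fun ζ => ?_⟩
    have : (completeTree b 0).erase [] = ∅ := by
      ext w; simp [mem_completeTree]
    simp only [leafWeight, this, Finset.prod_empty, level, Finset.prod_singleton]
    ring
  | succ n ih =>
    obtain ⟨c, hc, ih⟩ := ih
    refine ⟨c * ∏ _v ∈ level b n, C⁻¹, by positivity, fun ζ => ?_⟩
    rw [prod_completeTree_succ, ← mul_assoc, ih, leafWeight, leafWeight, prod_completeTree_succ,
      prod_level_succ]
    simp only [List.tail_cons]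
    have key : ∀ v, ∏ i : Fin b, kernel θ h (ζ v) (ζ (i :: v)) =
        C⁻¹ * (h (ζ v))⁻¹ * ((∏ i : Fin b, pairWeight θ (ζ v) (ζ (i :: v))) *
          ∏ i : Fin b, h (ζ (i :: v))) := by
      intro v
      simp only [kernel]
      rw [Finset.prod_div_distrib, Finset.prod_mul_distrib, Finset.prod_const, Finset.card_univ,
        Fintype.card_fin, hfix, div_eq_inv_mul, mul_inv]
    simp only [key, Finset.prod_mul_distrib]
    have hne : ∏ v ∈ level b n, h (ζ v) ≠ 0 := (Finset.prod_pos fun v _ => hh _).ne'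
    rw [Finset.prod_inv_distrib (f := fun v => h (ζ v))]
    field_simp

theorem weight_some (Λ : Finset (Vertex b)) (η : Vertex b → Fin q) (ξ : Λ → Fin q) :
    weight β Λ (fun v => some (η v)) ξ = ∏ w ∈ edgesMeeting Λ,
      pairWeight (Real.exp (2 * β)) (glue Λ ξ η w.tail) (glue Λ ξ η w) := by
  have h : ∀ v, extend Λ (fun v => some (η v)) ξ v = some (glue Λ ξ η v) := fun v => by
    unfold extend glue; split_ifs <;> rfl
  simp only [pairWeight, Finset.prod_ite, Finset.prod_const, one_pow, mul_one]
  rw [weight, agreeingEdges, mul_comm (2 * β), Real.exp_nat_mul]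
  simp [h, eq_comm]

theorem measurable_glue (Λ : Finset (Vertex b)) (ξ : Λ → Fin q) : Measurable (glue Λ ξ) := by
  refine measurable_pi_lambda _ fun v => ?_
  unfold glue
  split_ifs
  exacts [measurable_const, measurable_pi_apply v]

theorem measurable_gibbs (Λ : Finset (Vertex b)) (ξ : Λ → Fin q) :
    Measurable fun η : Vertex b → Fin q => gibbs β Λ (fun v => some (η v)) ξ := by
  have h : ∀ ξ : Λ → Fin q,
      Measurable fun η : Vertex b → Fin q => weight β Λ (fun v => some (η v)) ξ := by
    intro ξ
    simp only [weight_some]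
    refine Finset.measurable_prod _ fun w _ => ?_
    have : Measurable fun x : Fin q × Fin q => pairWeight (Real.exp (2 * β)) x.1 x.2 :=
      measurable_of_countable _
    exact this.comp (((measurable_pi_apply w.tail).comp (measurable_glue Λ ξ)).prodMk
      ((measurable_pi_apply w).comp (measurable_glue Λ ξ)))
  exact (h ξ).div (Finset.measurable_sum _ fun ξ' _ => h ξ')

theorem glue_of_notMem {Λ : Finset (Vertex b)} {ξ : Λ → Fin q} {η : Vertex b → Fin q} {v : Vertex b}
    (hv : v ∉ Λ) : glue Λ ξ η v = η v := dif_neg hv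

theorem glue_of_mem {Λ : Finset (Vertex b)} {ξ : Λ → Fin q} {η : Vertex b → Fin q} {v : Vertex b}
    (hv : v ∈ Λ) : glue Λ ξ η v = ξ ⟨v, hv⟩ := dif_pos hv

/-- A probability measure for which the configurations on the complete trees have the
probabilities given by a prior weight at the leaves is a Gibbs measure. -/
theorem isGibbsMeasure_of_leafWeight {h : Fin q → ℝ} (hh : ∀ s, 0 < h s)
    {P : Measure (Vertex b → Fin q)} [IsProbabilityMeasure P]
    (hP : ∀ n, ∃ c : ℝ, 0 < c ∧ ∀ ζ, P (treeAtom n ζ) =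
      ENNReal.ofReal (c * leafWeight (Real.exp (2 * β)) h n ζ)) :
    IsGibbsMeasure β P := by
  classical
  refine ⟨inferInstance, fun Λ B hB => ?_⟩
  set θ := Real.exp (2 * β) with hθ
  have hθ0 : 0 < θ := Real.exp_pos _
  set γ : (Λ → Fin q) → (Vertex b → Fin q) → ENNReal :=
    fun ξ η => ENNReal.ofReal (gibbs β Λ (fun v => some (η v)) ξ) with hγ
  have hγm : ∀ ξ, Measurable (γ ξ) := fun ξ => (measurable_gibbs Λ ξ).ennreal_ofReal
  -- The law of a sample from `P` after its spins in `Λ` are resampled; the equation to prove says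
  -- that `Q = P`.
  set Q : Measure (Vertex b → Fin q) :=
    ∑ ξ : Λ → Fin q, (P.withDensity (γ ξ)).map (glue Λ ξ) with hQ
  have hQB : ∀ B : Set (Vertex b → Fin q), MeasurableSet B →
      Q B = ∑ ξ : Λ → Fin q, ∫⁻ η in glue Λ ξ ⁻¹' B, γ ξ η ∂P := by
    intro B hB
    rw [hQ, Measure.finsetSum_apply]
    refine Finset.sum_congr rfl fun ξ _ => ?_
    rw [Measure.map_apply (measurable_glue Λ ξ) hB,
      withDensity_apply _ (measurable_glue Λ ξ hB)]
  suffices hQP : Q = P by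
    have h1 := hQB B hB
    rw [hQP] at h1
    rw [h1, lintegral_finsetSum]
    · refine Finset.sum_congr rfl fun ξ _ => ?_
      rw [← lintegral_indicator (measurable_glue Λ ξ hB)]
      refine lintegral_congr fun η => ?_
      by_cases hη : glue Λ ξ η ∈ B
      · rw [Set.indicator_of_mem (show η ∈ glue Λ ξ ⁻¹' B from hη), Set.indicator_of_mem hη,
          mul_one]
      · rw [Set.indicator_of_notMem (show η ∉ glue Λ ξ ⁻¹' B from hη), Set.indicator_of_notMem hη,
          mul_zero]
    · exact fun ξ _ => (hγm ξ).mul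
        ((measurable_const.indicator hB).comp (measurable_glue Λ ξ))
  -- With `M` strictly larger than every depth in `Λ`, all edges meeting `Λ` lie in the tree and the
  -- leaves avoid `Λ`.
  refine measure_eq_of_treeAtom (Λ.sup List.length + 1) fun M hM ζ => ?_
  have hΛ : ∀ v ∈ Λ, v.length < M := fun v hv =>
    lt_of_lt_of_le (Nat.lt_succ_of_le (Finset.le_sup (f := List.length) hv)) hM
  have hΛM : ∀ v ∈ Λ, v ∈ completeTree b M := fun v hv => mem_completeTree.2 (hΛ v hv).le
  have hE : edgesMeeting Λ ⊆ (completeTree b M).erase [] := by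
    intro w hw
    rw [mem_edgesMeeting] at hw
    rw [Finset.mem_erase, mem_completeTree]
    refine ⟨hw.1, ?_⟩
    rcases hw.2 with h | h
    · exact (hΛ w h).le
    · have := hΛ _ h
      rw [List.length_tail] at this
      omega
  obtain ⟨c, hc, hPc⟩ := hP M
  set ξ₀ : Λ → Fin q := fun v => ζ v.1 with hξ₀
  have hglue : glue Λ ξ₀ ζ = ζ := by
    funext v
    unfold glue
    split_ifs <;> rfl
  set r : ℝ := (∏ w ∈ (completeTree b M).erase [] \ edgesMeeting Λ,
    pairWeight θ (ζ w.tail) (ζ w)) * ∏ v ∈ level b M, h (ζ v) with hr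
  set W : (Λ → Fin q) → ℝ := weight β Λ (fun v => some (ζ v)) with hW
  have hW0 : ∀ ξ, 0 < W ξ := fun ξ => Real.exp_pos _
  have hr0 : 0 < r := mul_pos (Finset.prod_pos fun w _ => pairWeight_pos hθ0 _ _)
    (Finset.prod_pos fun v _ => hh _)
  -- Changing spins in `Λ` affects only the Boltzmann weight of `Λ`; the other edges and the prior
  -- at the leaves form the common factor `r`.
  have hleaf : ∀ ξ, leafWeight θ h M (glue Λ ξ ζ) = W ξ * r := by
    intro ξ
    rw [leafWeight, ← Finset.prod_sdiff hE, hW, weight_some, hr, mul_comm (∏ w ∈ _ \ _, _),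
      mul_assoc]
    congr 2
    · refine Finset.prod_congr rfl fun w hw => ?_
      rw [Finset.mem_sdiff, Finset.mem_erase, mem_edgesMeeting] at hw
      have h1 : w ∉ Λ := fun h => hw.2 ⟨hw.1.1, Or.inl h⟩
      have h2 : w.tail ∉ Λ := fun h => hw.2 ⟨hw.1.1, Or.inr h⟩
      rw [glue_of_notMem h1, glue_of_notMem h2]
    · refine Finset.prod_congr rfl fun v hv => ?_
      rw [glue_of_notMem fun h => (hΛ v h).ne (mem_level.1 hv)]
  set E : Set (Vertex b → Fin q) := {η | ∀ v ∈ completeTree b M \ Λ, η v = ζ v} with hEdef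
  have hEm : MeasurableSet E := measurableSet_forall_mem _ _
  have hpre : glue Λ ξ₀ ⁻¹' treeAtom M ζ = E := by
    ext η
    simp only [Set.mem_preimage, treeAtom, Set.mem_ofPred_eq, hEdef, Finset.mem_sdiff]
    constructor
    · rintro h v ⟨hv, hv'⟩
      rw [← h v hv, glue_of_notMem hv']
    · intro h v hv
      by_cases hv' : v ∈ Λ
      · rw [glue_of_mem hv']
      · rw [glue_of_notMem hv', h v ⟨hv, hv'⟩]
  have hPE : P E = ENNReal.ofReal (c * (r * ∑ ξ, W ξ)) := by
    have hun : E = ⋃ ξ ∈ (Finset.univ : Finset (Λ → Fin q)), treeAtom M (glue Λ ξ ζ) := by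
      ext η
      simp only [hEdef, Set.mem_ofPred_eq, Set.mem_iUnion, Finset.mem_univ, treeAtom,
        Finset.mem_sdiff, exists_true_left]
      constructor
      · intro h
        refine ⟨fun v => η v.1, fun v hv => ?_⟩
        by_cases hv' : v ∈ Λ
        · rw [glue_of_mem hv']
        · rw [glue_of_notMem hv', h v ⟨hv, hv'⟩]
      · rintro ⟨ξ, h⟩ v ⟨hv, hv'⟩
        rw [h v hv, glue_of_notMem hv']
    rw [hun, measure_biUnion_finset]
    · simp only [hPc, hleaf]
      rw [← ENNReal.ofReal_sum_of_nonneg fun ξ _ => by have := hW0 ξ; positivity]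
      congr 1
      simp only [Finset.mul_sum]
      exact Finset.sum_congr rfl fun ξ _ => by ring
    · intro ξ _ ξ' _ hne
      refine Set.disjoint_left.2 fun η hη hη' => hne (funext fun v => ?_)
      have h1 := hη v.1 (hΛM v.1 v.2)
      have h2 := hη' v.1 (hΛM v.1 v.2)
      rw [glue_of_mem v.2] at h1 h2
      exact h1.symm.trans h2
    · exact fun ξ _ => measurableSet_treeAtom M _
  have hconst : ∀ η ∈ E, γ ξ₀ η = γ ξ₀ ζ := by
    intro η hη
    have hw : ∀ ξ, weight β Λ (fun v => some (η v)) ξ = W ξ := by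
      intro ξ
      rw [hW, weight_some, weight_some]
      refine Finset.prod_congr rfl fun w hw => ?_
      have hv : ∀ v ∈ completeTree b M, glue Λ ξ η v = glue Λ ξ ζ v := by
        intro v hv
        by_cases hv' : v ∈ Λ
        · rw [glue_of_mem hv', glue_of_mem hv']
        · rw [glue_of_notMem hv', glue_of_notMem hv']
          exact hη v (Finset.mem_sdiff.2 ⟨hv, hv'⟩)
      have hwM := Finset.mem_of_mem_erase (hE hw)
      rw [hv _ hwM, hv _ (tail_mem_completeTree hwM)]
    simp only [hγ, gibbs, hw]
    rfl
  rw [hQB _ (measurableSet_treeAtom M ζ), Finset.sum_eq_single ξ₀]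
  · rw [hpre, setLIntegral_congr_fun hEm hconst, setLIntegral_const, hPE, hγ]
    dsimp only
    have hS : 0 < ∑ ξ, W ξ := Finset.sum_pos (fun ξ _ => hW0 ξ) ⟨ξ₀, Finset.mem_univ _⟩
    have hg : gibbs β Λ (fun v => some (ζ v)) ξ₀ = W ξ₀ / ∑ ξ, W ξ := rfl
    have hl := hleaf ξ₀
    rw [hglue] at hl
    rw [hg, ← ENNReal.ofReal_mul (div_nonneg (hW0 _).le hS.le), hPc ζ, hl]
    congr 1
    field_simp
  · intro ξ _ hne
    have : glue Λ ξ ⁻¹' treeAtom M ζ = ∅ := by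
      refine Set.eq_empty_of_forall_notMem fun η hη => hne (funext fun v => ?_)
      have := hη v.1 (hΛM v.1 v.2)
      rwa [glue_of_mem v.2] at this
    rw [this, Measure.restrict_empty, lintegral_zero_measure]
  · simp

/-- A nontrivial fixed point of the recursion for the likelihood ratio yields several Gibbs
measures. -/
theorem multiplePhases_of_fixedPoint {R : ℝ} (hq : 2 ≤ q) (hβ : 0 ≤ β) (hR : 1 < R)
    (hfix : edgeRatio q (Real.exp (2 * β)) R ^ b = R) : MultiplePhases b q β := by
  set θ := Real.exp (2 * β) with hθ
  have hθ1 : 1 ≤ θ := Real.one_le_exp (by linarith)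
  have hq' : (2 : ℝ) ≤ q := by exact_mod_cast hq
  have hθ0 : 0 < θ := by linarith
  have hd : 0 < R + θ + q - 2 := by linarith
  have hZ : 0 < R + q - 1 := by linarith
  have main : ∀ s : Fin q, ∃ P : Measure (Vertex b → Fin q), IsGibbsMeasure β P ∧
      ∀ ζ, P (treeAtom 0 ζ) = ENNReal.ofReal ((if ζ [] = s then R else 1) / (R + q - 1)) := by
    intro s
    set h : Fin q → ℝ := fun t => if t = s then R else 1 with hh
    have hh0 : ∀ t, 0 < h t := fun t => by
      simp only [hh]; split_ifs <;> linarith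
    have hsum : ∑ t, h t = R + q - 1 := sum_single_eq s R
    have hstep : ∀ a, (∑ t, pairWeight θ a t * h t) ^ b = (R + θ + q - 2) ^ b * h a := by
      intro a
      rw [sum_pairWeight_mul, hsum]
      simp only [hh]
      split_ifs
      · have : (R + θ + q - 2) ^ b * R = (R + θ + q - 2) ^ b * edgeRatio q θ R ^ b := by rw [hfix]
        rw [this, ← mul_pow, edgeRatio]
        congr 1
        field_simp
        ring
      · rw [mul_one]
        ring
    obtain ⟨P, hP, hPa⟩ := exists_treeChain (b := b) (p := fun t => h t / (R + q - 1))
      (k := kernel θ h) s (fun t => div_nonneg (hh0 t).le hZ.le)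
      (by rw [← Finset.sum_div, hsum, div_self hZ.ne']) (fun a t => (kernel_pos hθ0 hh0 a t).le)
      (sum_kernel hθ0 hh0)
    refine ⟨P, isGibbsMeasure_of_leafWeight hh0 fun n => ?_, fun ζ => ?_⟩
    · obtain ⟨c, hc, hcζ⟩ := exists_prod_kernel_eq (b := b) hh0 (pow_pos hd b) hZ hstep n
      exact ⟨c, hc, fun ζ => by rw [hPa, hcζ]⟩
    · have : (completeTree b 0).erase [] = ∅ := by
        ext w; simp [mem_completeTree]
      rw [hPa, this, Finset.prod_empty, mul_one]
  obtain ⟨P, hP, hP0⟩ := main ⟨0, by omega⟩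
  obtain ⟨P', hP', hP0'⟩ := main ⟨1, by omega⟩
  refine ⟨P, P', hP, hP', fun hPP => ?_⟩
  -- The two chains favour different root spins: spin `0` has weight `R` under one law and weight
  -- `1` under the other.
  have h1 := hP0 fun _ => ⟨0, by omega⟩
  rw [hPP, hP0', if_neg (by simp), if_pos rfl,
    ENNReal.ofReal_eq_ofReal_iff (by positivity) (by positivity),
    div_left_inj' hZ.ne'] at h1
  exact hR.ne h1

end DLR

end

end PottsTree

namespace PottsTree

noncomputable section

/-! ### The thresholds for the inverse temperature -/

section Thresholds

variable {b q : ℕ} {β : ℝ}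

/-- Only the lower-bound property of the infimum is needed, not monotonicity of the phase
transition. If no `β` has several phases, the infimum takes the default value `0` and the hypotheses
are contradictory. -/
theorem not_multiplePhases_of_lt_betaZero (hβ : 0 ≤ β) (h : β < betaZero b q) :
    ¬ MultiplePhases b q β := fun hm =>
  not_le.2 h (csInf_le ⟨0, fun _ hx => hx.1⟩ ⟨hβ, hm⟩)

/-- The logarithm inverts `√b * (θ - 1)/(θ + 1) = 1`, so below it this quantity is less than `1`. -/
theorem mul_sq_lt_one_of_lt_log (hb : 2 ≤ b)
    (h : β < 1 / 2 * Real.log ((√(b : ℝ) + 1) / (√(b : ℝ) - 1))) (hβ : 0 ≤ β) :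
    b * ((Real.exp (2 * β) - 1) / (Real.exp (2 * β) + 1)) ^ 2 < 1 := by
  have hb' : (2 : ℝ) ≤ b := by exact_mod_cast hb
  have hθ : 1 ≤ Real.exp (2 * β) := Real.one_le_exp (by linarith)
  set x := √(b : ℝ) with hx
  have hx2 : x ^ 2 = b := Real.sq_sqrt (by linarith)
  have hx1 : 1 < x := by
    rw [hx, Real.lt_sqrt zero_le_one]
    linarith
  have h1 : Real.exp (2 * β) < (x + 1) / (x - 1) := by
    rw [← Real.lt_log_iff_exp_lt (div_pos (by linarith) (by linarith))]
    linarith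
  rw [lt_div_iff₀ (by linarith)] at h1
  rw [← hx2, ← mul_pow]
  have h0 : 0 ≤ x * ((Real.exp (2 * β) - 1) / (Real.exp (2 * β) + 1)) :=
    mul_nonneg (by linarith) (div_nonneg (by linarith) (by linarith))
  refine pow_lt_one₀ h0 ?_ two_ne_zero
  rw [← mul_div_assoc, div_lt_one (by linarith)]
  nlinarith

/-- The left-hand side of the equation for `β₁`. -/
def betaOneFun (q : ℕ) (β : ℝ) : ℝ :=
  (Real.exp (2 * β) - 1) / (Real.exp (2 * β) + q - 1) *
    ((Real.exp (2 * β) - 1) / (Real.exp (2 * β) + 1))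

theorem betaOneFun_strictMonoOn (hq : 2 ≤ q) : StrictMonoOn (betaOneFun q) (Set.Ici 0) := by
  have hq' : (2 : ℝ) ≤ q := by exact_mod_cast hq
  intro x hx y hy hxy
  have hx1 : 1 ≤ Real.exp (2 * x) := Real.one_le_exp (by have : 0 ≤ x := hx; linarith)
  have hxy1 : Real.exp (2 * x) < Real.exp (2 * y) := Real.exp_lt_exp.2 (by linarith)
  rw [betaOneFun, betaOneFun]
  set u := Real.exp (2 * x)
  set v := Real.exp (2 * y)
  have h0 : 0 ≤ (u - 1) / (u + q - 1) := div_nonneg (by linarith) (by linarith)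
  have h0' : 0 ≤ (u - 1) / (u + 1) := div_nonneg (by linarith) (by linarith)
  refine mul_lt_mul'' ?_ ?_ h0 h0'
  · rw [div_lt_div_iff₀ (by linarith) (by linarith)]
    nlinarith
  · rw [div_lt_div_iff₀ (by linarith) (by linarith)]
    nlinarith

theorem continuous_betaOneFun (hq : 2 ≤ q) : Continuous (betaOneFun q) := by
  have hq' : (2 : ℝ) ≤ q := by exact_mod_cast hq
  have h : ∀ β : ℝ, 0 < Real.exp (2 * β) := fun β => Real.exp_pos _
  unfold betaOneFun
  refine Continuous.mul (Continuous.div (by fun_prop) (by fun_prop) fun β => ?_)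
    (Continuous.div (by fun_prop) (by fun_prop) fun β => ?_) <;>
  · have := h β
    linarith

theorem existsUnique_betaOneEquation (hb : 2 ≤ b) (hq : 2 ≤ q) :
    ∃! β₁ : ℝ, 0 < β₁ ∧ BetaOneEquation b q β₁ := by
  have hb' : (2 : ℝ) ≤ b := by exact_mod_cast hb
  have hq' : (2 : ℝ) ≤ q := by exact_mod_cast hq
  have hmono := betaOneFun_strictMonoOn hq
  have h0 : betaOneFun q 0 = 0 := by simp [betaOneFun]
  obtain ⟨B, hB0, hB⟩ : ∃ B : ℝ, 0 ≤ B ∧ 1 / b ≤ betaOneFun q B := by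
    -- At `exp (2β) = 4q` the left-hand side already exceeds `1/2`, hence `1/b`.
    refine ⟨Real.log (4 * q) / 2, div_nonneg (Real.log_nonneg (by linarith)) zero_le_two, ?_⟩
    rw [betaOneFun, mul_div_cancel₀ _ two_ne_zero, Real.exp_log (by linarith)]
    have h1 : (1 : ℝ) / b ≤ 1 / 2 := one_div_le_one_div_of_le two_pos hb'
    refine h1.trans ?_
    rw [div_mul_div_comm, div_le_div_iff₀ two_pos (mul_pos (by linarith) (by linarith))]
    nlinarith
  obtain ⟨β₁, hβ₁, heq⟩ := intermediate_value_Icc hB0 (continuous_betaOneFun hq).continuousOn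
    (show 1 / (b : ℝ) ∈ Set.Icc (betaOneFun q 0) (betaOneFun q B) from
      ⟨by rw [h0]; positivity, hB⟩)
  have hpos : 0 < β₁ := by
    refine lt_of_le_of_ne hβ₁.1 fun h => ?_
    rw [← h, h0] at heq
    have : (0 : ℝ) < 1 / b := by positivity
    exact this.ne heq
  refine ⟨β₁, ⟨hpos, heq⟩, fun y hy => ?_⟩
  exact hmono.injOn hy.1.le hpos.le (hy.2.trans heq.symm)

end Thresholds

end

end PottsTree

theorem theoremt (b q : ℕ) (hb : 2 ≤ b) (hq : 2 ≤ q) :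
    -- (i) arbitrary boundary condition
    (∀ β : ℝ, 0 ≤ β →
      β < max (PottsTree.betaZero b q)
        (1 / 2 * Real.log ((√(b : ℝ) + 1) / (√(b : ℝ) - 1))) →
      ∃ c : ℝ, 0 < c ∧ ∀ (τ : PottsTree.BoundaryCondition b q) (m : ℕ),
        c ≤ PottsTree.cGap (PottsTree.treeGibbs β τ m) ∧
        c ≤ PottsTree.cSob (PottsTree.treeGibbs β τ m)) ∧
    -- (ii) constant boundary condition
    (∀ β : ℝ, 0 ≤ β →
      ∃ c : ℝ, 0 < c ∧ ∀ (s : Fin q) (m : ℕ),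
        c ≤ PottsTree.cGap (PottsTree.treeGibbs (b := b) β (fun _ => some s) m) ∧
        c ≤ PottsTree.cSob (PottsTree.treeGibbs (b := b) β (fun _ => some s) m)) ∧
    -- (iii) free boundary condition
    ((∃! β₁ : ℝ, 0 < β₁ ∧ PottsTree.BetaOneEquation b q β₁) ∧
      ∀ β₁ : ℝ, 0 < β₁ → PottsTree.BetaOneEquation b q β₁ →
        ∀ β : ℝ, 0 ≤ β → β < β₁ →
          ∃ c : ℝ, 0 < c ∧ ∀ m : ℕ,
            c ≤ PottsTree.cGap
              (PottsTree.treeGibbs (b := b) (q := q) β (fun _ => none) m) ∧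
            c ≤ PottsTree.cSob
              (PottsTree.treeGibbs (b := b) (q := q) β (fun _ => none) m)) := by
  have hb1 : 1 ≤ b := by omega
  have hθ : ∀ β : ℝ, 0 ≤ β → 1 ≤ Real.exp (2 * β) := fun β hβ => Real.one_le_exp (by linarith)
  simp only [PottsTree.treeGibbs_eq_field]
  refine ⟨fun β hβ hlt => ?_, fun β hβ => PottsTree.exists_le_const hb1 hq (hθ β hβ),
    PottsTree.existsUnique_betaOneEquation hb hq, fun β₁ hβ₁ heq β hβ hlt =>
      PottsTree.exists_le_free hb1 hq (hθ β hβ) ?_⟩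
  -- Below `β₀` a fixed point above `1` would contradict uniqueness; below the other threshold `b *
  -- γ ^ 2 < 1` suffices.
  · rcases lt_max_iff.1 hlt with h | h
    · refine PottsTree.exists_le_of_fixedPoint hb1 hq (hθ β hβ) fun R hR hfix => ?_
      by_contra hne
      exact PottsTree.not_multiplePhases_of_lt_betaZero hβ h
        (PottsTree.multiplePhases_of_fixedPoint hq hβ (lt_of_le_of_ne hR (Ne.symm hne)) hfix)
    · exact PottsTree.exists_le_of_sq_lt hb1 hq (hθ β hβ)
        (PottsTree.mul_sq_lt_one_of_lt_log hb h hβ)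
  · have h := PottsTree.betaOneFun_strictMonoOn hq hβ hβ₁.le hlt
    exact h.trans_eq heq
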